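/- Let $\lambda,\mu,\lambda_0,\mu_0>0$ and let $\{X_t:t\ge 0\}$ be the birth-death process on $\mathbb{Z}$ (right-continuous paths) with birth rates $\lambda_n$ and death rates $\mu_n$, where $\lambda_n=\lambda$, $\mu_n=\mu$ for $n\in\mathbb{Z}\setminus\{0\}$ and the rates at $0$ are $\lambda_0,\mu_0$. Let $P_{ij}(t)=\mathbb{P}(X_t=j\mid X_0=i)$, let $(\pi_n)_{n\in\mathbb{Z}}$ be the potential coefficients, $$\pi_0=1,\qquad \pi_n=\frac{\lambda_0\cdots\lambda_{n-1}}{\mu_1\cdots\mu_n},\qquad \pi_{-n}=\frac{\mu_0\mu_{-1}\cdots\mu_{-n+1}}{\lambda_{-1}\cdots\lambda_{-n}}\quad(n\ge1),$$ and let $(Q^\alpha_n)_{n\in\mathbb{Z}}$, $\alpha=1,2$, be the polynomials with $Q^1_0=1$, $Q^1_{-1}=0$, $Q^2_0=0$, $Q^2_{-1}=1$ and $$-xQ^\alpha_n(x)=\lambda_nQ^\alpha_{n+1}(x)-(\lambda_n+\mu_n)Q^\alpha_n(x)+\mu_nQ^\alpha_{n-1}(x),\qquad n\in\mathbb{Z}.$$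 A spectral matrix is a positive semidefinite $2\times2$ matrix $\Psi=(\psi_{\alpha\beta})$ of finite signed measures supported on $[0,\infty)$ such that the Karlin--McGregor formula $$P_{ij}(t)=\pi_j\int_0^\infty e^{-xt}\sum_{\alpha,\beta=1}^2Q_i^\alpha(x)Q_j^\beta(x)\,d\psi_{\alpha\beta}(x)$$ holds (with all integrals absolutely convergent) for all $i,j\in\mathbb{Z}$, $t\ge0$. Then there is exactly one spectral matrix $\Psi$, and the following hold. **(1) Stieltjes transforms.** For $z\in\mathbb{C}\setminus[0,\infty)$ the integral $B(z;\psi_{\alpha\beta})=\int_0^\infty (x-z)^{-1}d\psi_{\alpha\beta}(x)$ converges absolutely and, if $D(z)\ne0$, $$B(z;\psi_{\alpha\beta})=\frac{p_{\alpha\beta}(z)+q_{\alpha\beta}(z)\sqrt{(\lambda+\mu-z)^2-4\lambda\mu}}{D(z)},\qquad \alpha,\beta=1,2,$$ where the square root is the analytic branch on $\mathbb{C}\setminus[0,\infty)$ that is positive for $z<0$, $p_{21}=p_{12}$, $q_{21}=q_{12}$, and \begin{align*} p_{11}(z)&=(\lambda_0\mu+\mu_0\lambda-2\lambda\mu)z+(\lambda-\mu)(\lambda_0\mu-\mu_0\lambda),\qquad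 q_{11}(z)=-(\lambda_0\mu+\lambda\mu_0),\\ p_{12}(z)&=\lambda\left[z^2-(\lambda_0+\mu_0+\lambda+\mu)z+(\lambda-\mu)(\lambda_0-\mu_0)\right],\qquad q_{12}(z)=-\lambda(\lambda_0+\mu_0-z),\\ p_{22}(z)&=\tfrac1{\mu_0}\big[(\lambda_0-\lambda)z^3+(-\lambda_0^2-\lambda_0\mu_0-2\lambda_0\mu+2\mu_0\lambda+\lambda^2+\lambda\mu)z^2+\mu_0(\lambda-\mu)(\lambda_0\mu-\mu_0\lambda)\\ &\quad+(\lambda_0^2\lambda+\lambda_0^2\mu-\lambda_0\mu_0\lambda+2\lambda_0\mu_0\mu-\lambda_0\lambda^2+\lambda_0\mu^2-\mu_0^2\lambda-2\mu_0\lambda\mu)z\big],\\ q_{22}(z)&=-\tfrac1{\mu_0}\big[(\lambda-\lambda_0)z^2+(\lambda_0^2+\lambda_0\mu_0-\lambda_0\lambda+\lambda_0\mu-2\mu_0\lambda)z+\mu_0(2\lambda_0\lambda-\lambda_0\mu+\mu_0\lambda)\big],\\ D(z)&=(-2\lambda_0\mu-2\mu_0\lambda+2\lambda\mu)z^2-2\lambda_0\mu_0(\lambda-\mu)^2\\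 &\quad+(2\lambda_0^2\mu+2\lambda_0\mu_0\lambda+2\lambda_0\mu_0\mu-2\lambda_0\lambda\mu+2\lambda_0\mu^2+2\mu_0^2\lambda+2\mu_0\lambda^2-2\mu_0\lambda\mu)z. \end{align*} **(2) Spectral matrix.** Let $\sigma_\pm=(\sqrt\lambda\pm\sqrt\mu)^2$. Then $\Psi=\Psi_c+\Psi_d$, where $\Psi_c$ is absolutely continuous with the integrable density $$\frac{\sqrt{(x-\sigma_-)(\sigma_+-x)}}{\pi D(x)}\begin{pmatrix}\lambda_0\mu+\lambda\mu_0&\lambda(\lambda_0+\mu_0-x)\\ \lambda(\lambda_0+\mu_0-x)&-q_{22}(x)\end{pmatrix},\qquad x\in[\sigma_-,\sigma_+],$$ and $\Psi_d$ is concentrated on the real zeros of $D$. Put $\kappa=\lambda_0\mu+\mu_0\lambda-\lambda\mu$. If $\kappa\neq0$, then $D$ is a quadratic polynomial whose roots are $$\gamma_\pm=\frac{(\lambda_0\mu+\mu_0\lambda)(\lambda_0+\mu_0)+(\lambda_0\mu-\mu_0\lambda)(\mu-\lambda)\pm(\lambda_0\mu+\mu_0\lambda)\sqrt R}{2\kappa},\qquad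 R=(\lambda_0-\mu_0-\lambda+\mu)^2+4\lambda_0\mu_0,$$ and $$\Psi_d=\begin{pmatrix}A_{11}^-&A_{12}^-\\A_{12}^-&A_{22}^-\end{pmatrix}\delta_{\gamma_+}\mathbf 1_{\{A_{11}^->0,\ \gamma_+>0\}}+\begin{pmatrix}A_{11}^+&A_{12}^+\\A_{12}^+&A_{22}^+\end{pmatrix}\delta_{\gamma_-}\mathbf 1_{\{A_{11}^+>0,\ \gamma_->0\}},$$ where, with $C=\lambda\mu R-\kappa(\lambda_0\mu+\mu_0\lambda+2\lambda\mu)$, \begin{align*} A_{11}^\pm&=\frac1{2\kappa}\Big[\lambda_0\mu+\mu_0\lambda-2\lambda\mu\pm(\lambda_0\mu+\mu_0\lambda)(\lambda+\mu-\lambda_0-\mu_0)\tfrac{\sqrt R}{R}\Big],\\ A_{12}^\pm&=\frac{\lambda}{2\kappa^2}\Big[\lambda\mu(\lambda+\mu-\lambda_0-\mu_0)\mp\big(C-\kappa(\lambda_0\mu+\mu_0\lambda-2\lambda\mu)\big)\tfrac{\sqrt R}{R}\Big],\\ A_{22}^\pm&=\frac{\lambda^2}{2\kappa^3}\Big[-C\pm(\lambda+\mu-\lambda_0-\mu_0)(C+2\lambda\mu\kappa)\tfrac{\sqrt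 R}{R}\Big]. \end{align*} If $\kappa\ne0$ and $\lambda=\mu$, then $\gamma_-=0$, $\gamma_+=(\lambda_0+\mu_0)^2/(\lambda_0+\mu_0-\lambda)$ and $A^+_{ij}=0$ for $i,j=1,2$. **(3) Polynomials.** With $y=(\lambda+\mu-x)/(2\sqrt{\lambda\mu})$, $T_n,U_n$ the Chebyshev polynomials of the first and second kind and $U_{-1}=0$, for all $n\ge0$, \begin{align*} Q_n^1(x)&=\left(\tfrac\mu\lambda\right)^{n/2}\Big[\tfrac{2(\lambda_0-\lambda)}{\lambda_0}T_n(y)+\tfrac{2\lambda-\lambda_0}{\lambda_0}U_n(y)+\sqrt{\tfrac\lambda\mu}\,\tfrac{\lambda_0+\mu_0-\lambda-\mu}{\lambda_0}U_{n-1}(y)\Big],\\ Q_{-n-1}^1(x)&=-\left(\tfrac\lambda\mu\right)^{(n+1)/2}U_{n-1}(y),\qquad Q_n^2(x)=-\tfrac{\mu_0}{\lambda_0}\left(\tfrac\mu\lambda\right)^{(n-1)/2}U_{n-1}(y),\qquad Q_{-n-1}^2(x)=\left(\tfrac\lambda\mu\right)^{n/2}U_n(y). \end{align*} **(4) Recurrence.**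 For $\alpha=1,2$, $\int_0^\infty x^{-1}d\psi_{\alpha\alpha}(x)<\infty$ if and only if $\lambda\ne\mu$. If $\lambda\neq\mu$ the process is transient (every state has return probability less than $1$). If $\lambda=\mu$, then $\Psi(\{0\})=0$ and the process is null recurrent (every state has return probability $1$ and infinite mean recurrence time). -/

import Mathlib

open MeasureTheory Polynomial
open scoped ENNReal NNReal

namespace BilateralBD

/-! ### Bilateral birth-death processes with birth rates `l` and death rates `m` -/

/-- The doubly infinite tridiagonal infinitesimal operator. -/
def generator (l m : ℤ → ℝ) (i j : ℤ) : ℝ :=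
  if j = i + 1 then l i else if j = i - 1 then m i else if j = i then -(l i + m i) else 0

/-- `P i j t`, the probability of being in `j` at time `t` when started from `i`. -/
noncomputable def transProb {Ω : Type*} [MeasurableSpace Ω] (Pr : ℤ → Measure Ω)
    (X : ℝ≥0 → Ω → ℤ) (i j : ℤ) (t : ℝ≥0) : ℝ :=
  (Pr i).real {ω | X t ω = j}

/-- `X` is, under the laws `Pr i` (`i` the initial state), a birth-death process on `ℤ` with birth
rates `l` and death rates `m`: a time-homogeneous Markov process with right-continuous paths whose
transition probabilities satisfy `P i j h = δ i j + h * generator l m i j + o(h)` as `h ↓ 0`. -/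
structure IsBirthDeathProcess {Ω : Type*} [MeasurableSpace Ω] (l m : ℤ → ℝ)
    (Pr : ℤ → Measure Ω) (X : ℝ≥0 → Ω → ℤ) : Prop where
  isProb : ∀ i, IsProbabilityMeasure (Pr i)
  measurable : ∀ t, Measurable (X t)
  rightCont : ∀ ω t, ContinuousWithinAt (fun s => X s ω) (Set.Ici t) t
  start : ∀ i, ∀ᵐ ω ∂(Pr i), X 0 ω = i
  markov : ∀ (i : ℤ) (s t : ℝ≥0) (j k : ℤ) (E : Set Ω),
    MeasurableSet[⨆ (u : ℝ≥0) (_ : u ≤ s), MeasurableSpace.comap (X u) ⊤] E →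
      (Pr i) (E ∩ {ω | X s ω = j} ∩ {ω | X (s + t) ω = k}) =
        (Pr i) (E ∩ {ω | X s ω = j}) * (Pr j) {ω | X t ω = k}
  rates : ∀ i j, HasDerivWithinAt (fun h : ℝ => transProb Pr X i j h.toNNReal)
    (generator l m i j) (Set.Ici 0) 0

/-- The recurrence time of `i`: the first time at which the path is in `i` after having been
outside `i` (`⊤` if there is none). -/
noncomputable def returnTime {Ω : Type*} (X : ℝ≥0 → Ω → ℤ) (i : ℤ) (ω : Ω) : ℝ≥0∞ :=
  ⨅ (t : ℝ≥0) (_ : X t ω = i ∧ ∃ s < t, X s ω ≠ i), (t : ℝ≥0∞)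

/-- Every state has return probability less than one. -/
def IsTransient {Ω : Type*} [MeasurableSpace Ω] (Pr : ℤ → Measure Ω) (X : ℝ≥0 → Ω → ℤ) : Prop :=
  ∀ i, (Pr i) {ω | returnTime X i ω < ⊤} < 1

/-- Every state has return probability one. -/
def IsRecurrent {Ω : Type*} [MeasurableSpace Ω] (Pr : ℤ → Measure Ω) (X : ℝ≥0 → Ω → ℤ) : Prop :=
  ∀ i, (Pr i) {ω | returnTime X i ω < ⊤} = 1

/-- Recurrent, with infinite mean recurrence times. -/
def IsNullRecurrent {Ω : Type*} [MeasurableSpace Ω] (Pr : ℤ → Measure Ω)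
    (X : ℝ≥0 → Ω → ℤ) : Prop :=
  IsRecurrent Pr X ∧ ∀ i, ∫⁻ ω, returnTime X i ω ∂(Pr i) = ⊤

/-! ### Orthogonal polynomials and the spectral matrix -/

/-- Potential coefficients: `π 0 = 1`, `π n = (l 0 ⋯ l (n-1)) / (m 1 ⋯ m n)` and
`π (-n) = (m 0 m (-1) ⋯ m (-n+1)) / (l (-1) ⋯ l (-n))`. -/
noncomputable def potCoef (l m : ℤ → ℝ) : ℤ → ℝ
  | Int.ofNat n => ∏ k ∈ Finset.range n, l k / m (k + 1)
  | Int.negSucc n => ∏ k ∈ Finset.range (n + 1), m (-k) / l (-k - 1)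

/-- `Q n` for `n ≥ 0`, with initial values `Q 0 = a`, `Q (-1) = b`. -/
noncomputable def polyUp (l m : ℤ → ℝ) (a b : ℝ[X]) : ℕ → ℝ[X]
  | 0 => a
  | 1 => C (l 0)⁻¹ * ((C (l 0 + m 0) - X) * a - C (m 0) * b)
  | n + 2 => C (l (n + 1))⁻¹ * ((C (l (n + 1) + m (n + 1)) - X) * polyUp l m a b (n + 1)
      - C (m (n + 1)) * polyUp l m a b n)

/-- `Q (-n-1)` for `n ≥ 0`, with initial values `Q 0 = a`, `Q (-1) = b`. -/
noncomputable def polyDown (l m : ℤ → ℝ) (a b : ℝ[X]) : ℕ → ℝ[X]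
  | 0 => b
  | 1 => C (m (-1))⁻¹ * ((C (l (-1) + m (-1)) - X) * b - C (l (-1)) * a)
  | n + 2 => C (m (-n - 2))⁻¹ * ((C (l (-n - 2) + m (-n - 2)) - X) * polyDown l m a b (n + 1)
      - C (l (-n - 2)) * polyDown l m a b n)

/-- The two families `Q^1` (index `0`) and `Q^2` (index `1`). -/
noncomputable def Q (l m : ℤ → ℝ) (α : Fin 2) : ℤ → ℝ[X]
  | Int.ofNat n => polyUp l m (if α = 0 then 1 else 0) (if α = 0 then 0 else 1) n
  | Int.negSucc n => polyDown l m (if α = 0 then 1 else 0) (if α = 0 then 0 else 1) n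

theorem Q_initial (l m : ℤ → ℝ) :
    Q l m 0 0 = 1 ∧ Q l m 1 0 = 0 ∧ Q l m 0 (-1) = 0 ∧ Q l m 1 (-1) = 1 :=
  ⟨rfl, rfl, rfl, rfl⟩

/-- The three-term recurrence relation that determines `Q`. -/
theorem Q_recurrence (l m : ℤ → ℝ) (hl : ∀ n, l n ≠ 0) (hm : ∀ n, m n ≠ 0) (α : Fin 2) (n : ℤ) :
    -X * Q l m α n =
      C (l n) * Q l m α (n + 1) - C (l n + m n) * Q l m α n + C (m n) * Q l m α (n - 1) := by
  have hC : ∀ c : ℝ, c ≠ 0 → (C c : ℝ[X]) * C c⁻¹ = 1 := fun c hc => by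
    rw [← C_mul, mul_inv_cancel₀ hc, C_1]
  rcases n with n | n
  · rcases n with _ | n
    · have h1 : Q l m α (Int.ofNat 0 + 1) = C (l 0)⁻¹ * ((C (l 0 + m 0) - X) *
          (if α = 0 then 1 else 0) - C (m 0) * (if α = 0 then 0 else 1)) := rfl
      have h0 : Q l m α (Int.ofNat 0) = if α = 0 then 1 else 0 := rfl
      have h2 : Q l m α (Int.ofNat 0 - 1) = if α = 0 then 0 else 1 := rfl
      rw [h1, h0, h2, ← mul_assoc, show (Int.ofNat 0) = 0 from rfl, hC _ (hl 0)]
      ring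
    · have h1 : Q l m α (Int.ofNat (n + 1) + 1) =
          C (l (n + 1))⁻¹ * ((C (l (n + 1) + m (n + 1)) - X) * Q l m α (Int.ofNat (n + 1))
            - C (m (n + 1)) * Q l m α (Int.ofNat n)) := rfl
      have h2 : (Int.ofNat (n + 1) - 1) = Int.ofNat n := by simp
      rw [h1, h2, ← mul_assoc, show Int.ofNat (n + 1) = (n : ℤ) + 1 from rfl, hC _ (hl _)]
      ring
  · rcases n with _ | n
    · have h1 : Q l m α (Int.negSucc 0 - 1) = C (m (-1))⁻¹ * ((C (l (-1) + m (-1)) - X) *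
          (if α = 0 then 0 else 1) - C (l (-1)) * (if α = 0 then 1 else 0)) := rfl
      have h0 : Q l m α (Int.negSucc 0) = if α = 0 then 0 else 1 := rfl
      have h2 : Q l m α (Int.negSucc 0 + 1) = if α = 0 then 1 else 0 := rfl
      rw [h1, h0, h2, ← mul_assoc, show (Int.negSucc 0) = -1 from rfl, hC _ (hm _)]
      ring
    · have h1 : Q l m α (Int.negSucc (n + 1) - 1) =
          C (m (-n - 2))⁻¹ * ((C (l (-n - 2) + m (-n - 2)) - X) * Q l m α (Int.negSucc (n + 1))
            - C (l (-n - 2)) * Q l m α (Int.negSucc n)) := rfl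
      have h2 : (Int.negSucc (n + 1) + 1) = Int.negSucc n := by omega
      have h3 : (Int.negSucc (n + 1)) = (-n - 2 : ℤ) := by omega
      rw [h1, h2, ← mul_assoc, ← h3, hC _ (hm _)]
      ring

/-- `Ψ` is a spectral matrix for the transition probabilities `P`: a positive semidefinite
`2 × 2` matrix of finite signed measures supported on `[0, ∞)` that satisfies the
Karlin-McGregor formula. -/
structure IsSpectralMatrix (l m : ℤ → ℝ) (P : ℤ → ℤ → ℝ≥0 → ℝ)
    (Ψ : Matrix (Fin 2) (Fin 2) (SignedMeasure ℝ)) : Prop where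
  posSemidef : ∀ S : Set ℝ, MeasurableSet S →
    (Matrix.of fun α β => Ψ α β S : Matrix (Fin 2) (Fin 2) ℝ).PosSemidef
  support : ∀ α β, (Ψ α β).variation (Set.Iio 0) = 0
  integrable : ∀ (i j : ℤ) (t : ℝ≥0) (α β : Fin 2), (Ψ α β).Integrable
    (fun x : ℝ => Real.exp (-x * t) * (Q l m α i).eval x * (Q l m β j).eval x)
  karlinMcGregor : ∀ (i j : ℤ) (t : ℝ≥0), P i j t = potCoef l m j * ∑ α, ∑ β,
    ∫ᵛ x, Real.exp (-x * t) * (Q l m α i).eval x * (Q l m β j).eval x ∂<•(Ψ α β)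

/-- The Stieltjes transform `B(z; ν) = ∫ dν(x) / (x - z)`. -/
noncomputable def stieltjes (ν : SignedMeasure ℝ) (z : ℂ) : ℂ :=
  ∫ᵛ x, ((x : ℂ) - z)⁻¹ ∂<•ν

/-! ### Constant rates with a defect at the origin

From here on `l`, `m` are the constant rates and `l0`, `m0` the rates at the state `0`. -/

/-- The rate `r` at all states but `0`, where it is `r0`. -/
def defectRate (r r0 : ℝ) (n : ℤ) : ℝ := if n = 0 then r0 else r

noncomputable def sigmaMinus (l m : ℝ) : ℝ := (√l - √m) ^ 2

noncomputable def sigmaPlus (l m : ℝ) : ℝ := (√l + √m) ^ 2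

/-- The branch of `√((l + m - z)² - 4 l m)`, analytic on `ℂ \ [0, ∞)` and positive for `z < 0`. -/
noncomputable def sqrtBranch (l m : ℝ) (z : ℂ) : ℂ :=
  ((sigmaMinus l m : ℂ) - z) ^ (1 / 2 : ℂ) * ((sigmaPlus l m : ℂ) - z) ^ (1 / 2 : ℂ)

theorem sqrtBranch_sq {l m : ℝ} (hl : 0 ≤ l) (hm : 0 ≤ m) (z : ℂ) :
    sqrtBranch l m z ^ 2 = ((l : ℂ) + m - z) ^ 2 - 4 * l * m := by
  have h : ∀ w : ℂ, (w ^ (1 / 2 : ℂ)) ^ 2 = w := fun w => by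
    rw [one_div]; exact Complex.cpow_nat_inv_pow w two_ne_zero
  have h1 : ((√l : ℝ) : ℂ) ^ 2 = l := by exact_mod_cast Real.sq_sqrt hl
  have h2 : ((√m : ℝ) : ℂ) ^ 2 = m := by exact_mod_cast Real.sq_sqrt hm
  rw [sqrtBranch, mul_pow, h, h, sigmaMinus, sigmaPlus, ← h1, ← h2]
  push_cast
  ring

theorem sqrtBranch_pos (l m : ℝ) {x : ℝ} (hx : x < 0) :
    ∃ r : ℝ, 0 < r ∧ sqrtBranch l m x = r := by
  have h1 : 0 < sigmaMinus l m - x := by have := sq_nonneg (√l - √m); unfold sigmaMinus; linarith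
  have h2 : 0 < sigmaPlus l m - x := by have := sq_nonneg (√l + √m); unfold sigmaPlus; linarith
  refine ⟨(sigmaMinus l m - x) ^ (1 / 2 : ℝ) * (sigmaPlus l m - x) ^ (1 / 2 : ℝ),
    by positivity, ?_⟩
  rw [sqrtBranch, Complex.ofReal_mul, Complex.ofReal_cpow h1.le, Complex.ofReal_cpow h2.le]
  push_cast
  ring_nf

section coefficients

variable {K : Type*} [Field K] (l m l0 m0 z : K)

def p11 : K := (l0 * m + m0 * l - 2 * l * m) * z + (l - m) * (l0 * m - m0 * l)

def p12 : K := l * (z ^ 2 - (l0 + m0 + l + m) * z + (l - m) * (l0 - m0))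

def p22 : K :=
  1 / m0 * ((l0 - l) * z ^ 3
    + (-l0 ^ 2 - l0 * m0 - 2 * l0 * m + 2 * m0 * l + l ^ 2 + l * m) * z ^ 2
    + m0 * (l - m) * (l0 * m - m0 * l)
    + (l0 ^ 2 * l + l0 ^ 2 * m - l0 * m0 * l + 2 * l0 * m0 * m - l0 * l ^ 2 + l0 * m ^ 2
        - m0 ^ 2 * l - 2 * m0 * l * m) * z)

def q11 : K := -(l0 * m + l * m0)

def q12 : K := -(l * (l0 + m0 - z))

def q22 : K :=
  -(1 / m0 * ((l - l0) * z ^ 2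
    + (l0 ^ 2 + l0 * m0 - l0 * l + l0 * m - 2 * m0 * l) * z
    + m0 * (2 * l0 * l - l0 * m + m0 * l)))

def D : K :=
  (-2 * l0 * m - 2 * m0 * l + 2 * l * m) * z ^ 2 - 2 * l0 * m0 * (l - m) ^ 2
    + (2 * l0 ^ 2 * m + 2 * l0 * m0 * l + 2 * l0 * m0 * m - 2 * l0 * l * m + 2 * l0 * m ^ 2
        + 2 * m0 ^ 2 * l + 2 * m0 * l ^ 2 - 2 * m0 * l * m) * z

def pMat : Matrix (Fin 2) (Fin 2) K :=
  !![p11 l m l0 m0 z, p12 l m l0 m0 z; p12 l m l0 m0 z, p22 l m l0 m0 z]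

def qMat : Matrix (Fin 2) (Fin 2) K :=
  !![q11 l m l0 m0, q12 l l0 m0 z; q12 l l0 m0 z, q22 l m l0 m0 z]

end coefficients

/-- Lebesgue density of the absolutely continuous part of the spectral matrix. -/
noncomputable def acDensity (l m l0 m0 : ℝ) (α β : Fin 2) : ℝ → ℝ :=
  (Set.Icc (sigmaMinus l m) (sigmaPlus l m)).indicator fun x =>
    √((x - sigmaMinus l m) * (sigmaPlus l m - x)) / (Real.pi * D l m l0 m0 x) *
      (!![l0 * m + l * m0, l * (l0 + m0 - x); l * (l0 + m0 - x), -q22 l m l0 m0 x] :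
        Matrix (Fin 2) (Fin 2) ℝ) α β

noncomputable def acPart (l m l0 m0 : ℝ) : Matrix (Fin 2) (Fin 2) (SignedMeasure ℝ) :=
  Matrix.of fun α β => (volume : Measure ℝ).withDensityᵥ (acDensity l m l0 m0 α β)

def kappa (l m l0 m0 : ℝ) : ℝ := l0 * m + m0 * l - l * m

def R (l m l0 m0 : ℝ) : ℝ := (l0 - m0 - l + m) ^ 2 + 4 * l0 * m0

def bigC (l m l0 m0 : ℝ) : ℝ :=
  l * m * R l m l0 m0 - kappa l m l0 m0 * (l0 * m + m0 * l + 2 * l * m)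

/-- `gam 1` is `γ₊` and `gam (-1)` is `γ₋`. -/
noncomputable def gam (ε l m l0 m0 : ℝ) : ℝ :=
  ((l0 * m + m0 * l) * (l0 + m0) + (l0 * m - m0 * l) * (m - l)
    + ε * ((l0 * m + m0 * l) * √(R l m l0 m0))) / (2 * kappa l m l0 m0)

/-- `weight 1` is the matrix of the `A⁺` and `weight (-1)` that of the `A⁻`. -/
noncomputable def weight (ε l m l0 m0 : ℝ) : Matrix (Fin 2) (Fin 2) ℝ :=
  let κ := kappa l m l0 m0
  let C := bigC l m l0 m0
  let r := R l m l0 m0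
  let A11 := 1 / (2 * κ) *
    (l0 * m + m0 * l - 2 * l * m + ε * ((l0 * m + m0 * l) * (l + m - l0 - m0) * (√r / r)))
  let A12 := l / (2 * κ ^ 2) *
    (l * m * (l + m - l0 - m0) - ε * ((C - κ * (l0 * m + m0 * l - 2 * l * m)) * (√r / r)))
  let A22 := l ^ 2 / (2 * κ ^ 3) *
    (-C + ε * ((l + m - l0 - m0) * (C + 2 * l * m * κ) * (√r / r)))
  !![A11, A12; A12, A22]

open scoped Classical in
/-- The discrete part: mass `A⁻` at `γ₊` if `A⁻₁₁ > 0`, `γ₊ > 0`, and mass `A⁺` at `γ₋` if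
`A⁺₁₁ > 0`, `γ₋ > 0`. -/
noncomputable def discretePart (l m l0 m0 : ℝ) : Matrix (Fin 2) (Fin 2) (SignedMeasure ℝ) :=
  Matrix.of fun α β =>
    (if 0 < weight (-1) l m l0 m0 0 0 ∧ 0 < gam 1 l m l0 m0 then
      VectorMeasure.dirac (gam 1 l m l0 m0) (weight (-1) l m l0 m0 α β) else 0) +
    (if 0 < weight 1 l m l0 m0 0 0 ∧ 0 < gam (-1) l m l0 m0 then
      VectorMeasure.dirac (gam (-1) l m l0 m0) (weight 1 l m l0 m0 α β) else 0)

/-- The variable `y = (l + m - x) / (2 √(l m))`. -/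
noncomputable def yVar (l m x : ℝ) : ℝ := (l + m - x) / (2 * √(l * m))

end BilateralBD

/-! The spectral matrix has a scalar carrier. Put `q = l0 * m + l * m0` and let `numer` be the
polynomial matrix `-qMat`, whose determinant is `l0 / (2 * m0) * D`. Then `Ψ = numer • ν` for one
positive finite measure `ν` on a bounded part of `(0, ∞)`: on `(σ₋, σ₊)` it has the semicircle
density divided by `π * D`, and it may have atoms at roots of `D`. Since `p11 ^ 2` equals `q ^ 2`
times the discriminant plus `2 * l * m * D`, the polynomial `D` is positive on `(σ₋, σ₊)`; hence
`numer` is positive semidefinite `ν`-almost everywhere.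

Three integrals carry the algebra: the mass of `ν`, its mean, and `∫ D(x) / (x - z) dν`. In the last
one `D` cancels the denominator of the density and kills the atoms, so it is the Stieltjes transform
of the semicircle law (`semicircle_stieltjes`). The entries of `numer` and `D` are at most
quadratic, so division by `x - z` leaves a linear quotient and these three facts give every
Stieltjes transform (`integral_numer_mul_inv`). The masses of the atoms are residues at the roots.
At a root `p11` is plus or minus `q` times the square root, so a residue either vanishes or is `A₁₁
/ q` (`atoms_of_kappa_ne_zero`).

For the Karlin-McGregor formula, the integrals of the rows against `(x + θ)⁻¹` satisfy the
three-term recurrence up to their moments. Starting from the explicit transforms at `0` and `-1` and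
letting `θ → ∞`, induction outwards yields all moments, each resolvent being a decaying ratio times
the preceding one (`moment_eq`). This is orthogonality. The integrals of `exp (-x * t)` against the
kernel then solve the backward equation with the initial values and growth bound of the transition
probabilities, and `backward_unique` identifies the two. Uniqueness of `Ψ` comes from the states `0`
and `-1`, where the formula gives the Laplace transform of each entry.

For recurrence, a renewal argument along the times `n * h`, with `h → 0`, bounds `E (1 - exp (-θ
T))` below by `1 / ((θ + l i + m i) * G)`, where `G` bounds the Laplace transform of `P i i` at `θ`.
If `l ≠ m`, the support of `ν` stays away from `0`, the return probabilities decay exponentially and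
`G` stays bounded as `θ → 0`: transience. If `l = m`, then `ν` has no mass at `0`, so `P i i t → 0`,
which gives infinite mean recurrence time; and `x⁻¹` is not `ν`-integrable, which makes the expected
number of visits infinite. -/

namespace BilateralBD

/-! ### Signed measures with a density and Laplace transforms -/

-- Polynomials in `exp (-x)` form an algebra of bounded continuous functions separating the points
-- of the half line, and such an algebra determines a finite measure. The Laplace transform at
-- integers is therefore enough.
open scoped BoundedContinuousFunction in
theorem ext_of_integral_exp_neg_nnreal {μ ν : Measure ℝ≥0} [IsFiniteMeasure μ] [IsFiniteMeasure ν]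
    (h : ∀ n : ℕ, ∫ x : ℝ≥0, Real.exp (-(x : ℝ)) ^ n ∂μ = ∫ x : ℝ≥0, Real.exp (-(x : ℝ)) ^ n ∂ν) :
    μ = ν := by
  let e : ℝ≥0 →ᵇ ℝ := BoundedContinuousFunction.ofNormedAddCommGroup
    (fun x => Real.exp (-(x : ℝ))) (by fun_prop) 1 (fun x => by
      rw [Real.norm_eq_abs, abs_of_pos (Real.exp_pos _)]
      exact Real.exp_le_one_iff.2 (neg_nonpos.2 x.2))
  let A : StarSubalgebra ℝ (ℝ≥0 →ᵇ ℝ) :=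
    { Algebra.adjoin ℝ {e} with
      star_mem' := fun {f} hf => by
        have : star f = f := by ext x; simp
        rw [this]; exact hf }
  refine ext_of_forall_mem_subalgebra_integral_eq_of_polish (𝕜 := ℝ) (A := A) ?_ ?_
  · intro x y hxy
    refine ⟨e, ⟨_, ⟨e, Algebra.subset_adjoin rfl, rfl⟩, rfl⟩, ?_⟩
    intro hne
    have h1 : Real.exp (-(x : ℝ)) = Real.exp (-(y : ℝ)) := hne
    exact hxy (NNReal.eq (neg_injective (Real.exp_injective h1)))
  · intro g hg
    have hg' : g ∈ Algebra.adjoin ℝ {e} := hg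
    rw [Algebra.adjoin_singleton_eq_range_aeval] at hg'
    obtain ⟨p, rfl⟩ := hg'
    have hev : ∀ x, (aeval e p : ℝ≥0 →ᵇ ℝ) x =
        ∑ n ∈ p.support, p.coeff n * Real.exp (-(x : ℝ)) ^ n := by
      intro x
      rw [aeval_def, eval₂_eq_sum, Polynomial.sum_def, BoundedContinuousFunction.coe_sum,
        Finset.sum_apply]
      refine Finset.sum_congr rfl fun n _ => ?_
      simp [e]
    have hint : ∀ (ρ : Measure ℝ≥0) [IsFiniteMeasure ρ], ∫ x, (aeval e p : ℝ≥0 →ᵇ ℝ) x ∂ρ =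
        ∑ n ∈ p.support, p.coeff n * ∫ x : ℝ≥0, Real.exp (-(x : ℝ)) ^ n ∂ρ := by
      intro ρ _
      simp_rw [hev]
      rw [integral_finsetSum]
      · simp_rw [integral_const_mul]
      · intro n _
        have := ((e ^ n).integrable ρ).const_mul (p.coeff n)
        simpa [e] using this
    exact (hint μ).trans ((Finset.sum_congr rfl fun n _ => by rw [h n]).trans (hint ν).symm)

/-- A measure that does not charge the negative half line is recovered from its image under
`Real.toNNReal`, which is almost everywhere the identity. -/
theorem ext_of_integral_exp_neg {μ ν : Measure ℝ} [IsFiniteMeasure μ] [IsFiniteMeasure ν]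
    (hμ : μ (Set.Iio 0) = 0) (hν : ν (Set.Iio 0) = 0)
    (h : ∀ n : ℕ, ∫ x : ℝ, Real.exp (-x * n) ∂μ = ∫ x : ℝ, Real.exp (-x * n) ∂ν) : μ = ν := by
  have hm : Measurable Real.toNNReal := measurable_real_toNNReal
  have key : ∀ ρ : Measure ℝ, ρ (Set.Iio 0) = 0 →
      (ρ.map Real.toNNReal).map ((↑) : ℝ≥0 → ℝ) = ρ ∧
      ∀ n : ℕ, ∫ x : ℝ≥0, Real.exp (-(x : ℝ)) ^ n ∂(ρ.map Real.toNNReal) =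
        ∫ x : ℝ, Real.exp (-x * n) ∂ρ := by
    intro ρ hρ
    have hae : ∀ᵐ x ∂ρ, ((Real.toNNReal x : ℝ≥0) : ℝ) = x := by
      have : ∀ᵐ x ∂ρ, x ∉ Set.Iio (0 : ℝ) := measure_eq_zero_iff_ae_notMem.1 hρ
      filter_upwards [this] with x hx
      exact Real.coe_toNNReal x (not_lt.1 hx)
    refine ⟨?_, fun n => ?_⟩
    · rw [Measure.map_map (by fun_prop) hm]
      exact (Measure.map_congr hae).trans Measure.map_id
    · rw [integral_map hm.aemeasurable (by fun_prop)]
      refine integral_congr_ae ?_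
      filter_upwards [hae] with x hx
      rw [hx, ← Real.exp_nat_mul]; ring_nf
  rw [← (key μ hμ).1, ← (key ν hν).1]
  congr 1
  have := Measure.isFiniteMeasure_map μ Real.toNNReal
  have := Measure.isFiniteMeasure_map ν Real.toNNReal
  exact ext_of_integral_exp_neg_nnreal fun n => by rw [(key μ hμ).2, (key ν hν).2, h]

/-- Moving the negative Jordan parts across the equality leaves two finite positive measures with
equal Laplace transforms. The Jordan parts do not charge the negative half line because the total
variation, their sum, does not. -/
theorem signedMeasure_ext_of_laplace {μ ν : SignedMeasure ℝ}
    (hμ : μ.variation (Set.Iio 0) = 0) (hν : ν.variation (Set.Iio 0) = 0)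
    (h : ∀ t : ℝ≥0, ∫ᵛ x, Real.exp (-x * t) ∂<•μ = ∫ᵛ x, Real.exp (-x * t) ∂<•ν) : μ = ν := by
  have hint : ∀ (ρ : Measure ℝ) [IsFiniteMeasure ρ] (n : ℕ), ρ (Set.Iio 0) = 0 →
      Integrable (fun x => Real.exp (-x * n)) ρ := by
    intro ρ _ n hρ
    refine Integrable.of_bound (by fun_prop) 1 ?_
    filter_upwards [measure_eq_zero_iff_ae_notMem.1 hρ] with x hx
    rw [Real.norm_eq_abs, abs_of_pos (Real.exp_pos _)]
    refine Real.exp_le_one_iff.2 ?_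
    have : 0 ≤ x := not_lt.1 hx
    nlinarith [Nat.cast_nonneg (α := ℝ) n]
  have hJ : ∀ ρ : SignedMeasure ℝ, ρ.variation (Set.Iio 0) = 0 →
      ρ.toJordanDecomposition.posPart (Set.Iio 0) = 0 ∧
      ρ.toJordanDecomposition.negPart (Set.Iio 0) = 0 := by
    intro ρ hρ
    rw [← SignedMeasure.totalVariation_eq_variation, SignedMeasure.totalVariation,
      Measure.add_apply, add_eq_zero] at hρ
    exact hρ
  have hI : ∀ (ρ : SignedMeasure ℝ), ρ.variation (Set.Iio 0) = 0 → ∀ n : ℕ,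
      ∫ᵛ x, Real.exp (-x * n) ∂<•ρ =
      ∫ x, Real.exp (-x * n) ∂ρ.toJordanDecomposition.posPart -
        ∫ x, Real.exp (-x * n) ∂ρ.toJordanDecomposition.negPart := by
    intro ρ hρ n
    conv_lhs => rw [← SignedMeasure.toSignedMeasure_toJordanDecomposition ρ,
      JordanDecomposition.toSignedMeasure]
    rw [VectorMeasure.integral_sub_vectorMeasure, VectorMeasure.integral_toSignedMeasure,
      VectorMeasure.integral_toSignedMeasure]
    · rw [VectorMeasure.Integrable, Measure.variation_toSignedMeasure]
      exact hint _ n (hJ ρ hρ).1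
    · rw [VectorMeasure.Integrable, Measure.variation_toSignedMeasure]
      exact hint _ n (hJ ρ hρ).2
  have hkey : μ.toJordanDecomposition.posPart + ν.toJordanDecomposition.negPart =
      ν.toJordanDecomposition.posPart + μ.toJordanDecomposition.negPart := by
    obtain ⟨h1, h2⟩ := hJ μ hμ
    obtain ⟨h3, h4⟩ := hJ ν hν
    refine ext_of_integral_exp_neg (by simp [h1, h4]) (by simp [h2, h3]) fun n => ?_
    rw [integral_add_measure (hint _ n h1) (hint _ n h4),
      integral_add_measure (hint _ n h3) (hint _ n h2)]
    have := h n
    simp only [NNReal.coe_natCast] at this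
    rw [hI μ hμ, hI ν hν] at this
    linarith
  rw [← SignedMeasure.toSignedMeasure_toJordanDecomposition μ,
    ← SignedMeasure.toSignedMeasure_toJordanDecomposition ν, JordanDecomposition.toSignedMeasure,
    JordanDecomposition.toSignedMeasure, sub_eq_sub_iff_add_eq_add, ← Measure.toSignedMeasure_add,
    ← Measure.toSignedMeasure_add]
  exact Measure.toSignedMeasure_congr hkey

/-- The variation of a signed measure with density `g` has density `|g|`, so integrability is that
of `g • f` for the base measure. -/
theorem integrable_withDensityV {ν : Measure ℝ} {g : ℝ → ℝ} (hg : Integrable g ν)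
    (hgm : Measurable g) {E : Type*} [NormedAddCommGroup E] [NormedSpace ℝ E] {f : ℝ → E}
    (hfm : StronglyMeasurable f)
    (hf : Integrable (fun x => g x • f x) ν) : (ν.withDensityᵥ g).Integrable f := by
  rw [VectorMeasure.Integrable, Measure.variation_withDensityᵥ hg]
  change Integrable f (ν.withDensity fun x => ((‖g x‖₊ : ℝ≥0) : ℝ≥0∞))
  rw [integrable_withDensity_iff_integrable_smul hgm.nnnorm]
  refine (integrable_norm_iff ?_).1 ?_
  · exact (hgm.nnnorm.stronglyMeasurable.smul hfm).aestronglyMeasurable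
  · refine hf.norm.congr (Filter.Eventually.of_forall fun x => ?_)
    simp [norm_smul, NNReal.smul_def]

/-- The signed measure splits as the difference of the measures with densities `g⁺` and `g⁻`. Each
is handled by the formula for positive densities, with `g • f` as integrable majorant. -/
theorem integral_withDensityV {ν : Measure ℝ} {g : ℝ → ℝ} (hg : Integrable g ν)
    (hgm : Measurable g) {E : Type*} [NormedAddCommGroup E] [NormedSpace ℝ E] [CompleteSpace E]
    {f : ℝ → E} (hfm : StronglyMeasurable f)
    (hf : Integrable (fun x => g x • f x) ν) :
    ∫ᵛ x, f x ∂<•(ν.withDensityᵥ g) = ∫ x, g x • f x ∂ν := by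
  have hpart : ∀ u : ℝ → ℝ, Measurable u → (∀ x, |u x| ≤ |g x|) →
      Integrable (fun x => Real.toNNReal (u x) • f x) ν := by
    intro u hu hle
    refine Integrable.mono hf ?_ (Filter.Eventually.of_forall fun x => ?_)
    · exact (hu.real_toNNReal.stronglyMeasurable.smul hfm).aestronglyMeasurable
    · rw [NNReal.smul_def, norm_smul, norm_smul]
      refine mul_le_mul_of_nonneg_right ?_ (norm_nonneg _)
      rw [Real.norm_eq_abs, Real.norm_eq_abs]
      refine le_trans ?_ (hle x)
      rw [Real.coe_toNNReal', abs_of_nonneg (le_max_right _ _)]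
      exact max_le (le_abs_self _) (abs_nonneg _)
  have h1 := hpart g hgm fun x => le_rfl
  have h2 := hpart (fun x => -g x) hgm.neg fun x => (abs_neg _).le
  have := isFiniteMeasure_withDensity_ofReal hg.2
  have := isFiniteMeasure_withDensity_ofReal hg.neg.2
  rw [withDensityᵥ_eq_withDensity_pos_part_sub_withDensity_neg_part hg,
    VectorMeasure.integral_sub_vectorMeasure, VectorMeasure.integral_toSignedMeasure,
    VectorMeasure.integral_toSignedMeasure]
  · simp only [ENNReal.ofReal]
    have hgn : Measurable fun x => (-g x).toNNReal := hgm.neg.real_toNNReal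
    rw [integral_withDensity_eq_integral_smul hgm.real_toNNReal]
    rw [integral_withDensity_eq_integral_smul hgn, ← integral_sub h1 h2]
    refine integral_congr_ae (Filter.Eventually.of_forall fun x => ?_)
    simp only [NNReal.smul_def, Real.coe_toNNReal', ← sub_smul]
    congr 1
    rcases le_total 0 (g x) with h | h
    · simp [h]
    · simp [h]
  · rw [VectorMeasure.Integrable, Measure.variation_toSignedMeasure]
    simp only [ENNReal.ofReal]
    exact (integrable_withDensity_iff_integrable_smul hgm.real_toNNReal).2 h1
  · rw [VectorMeasure.Integrable, Measure.variation_toSignedMeasure]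
    simp only [ENNReal.ofReal]
    exact (integrable_withDensity_iff_integrable_smul hgm.neg.real_toNNReal).2 h2

/-! ### Transition probabilities -/

section transition

variable {Ω : Type*} [MeasurableSpace Ω] {l m : ℤ → ℝ} {Pr : ℤ → Measure Ω} {X : ℝ≥0 → Ω → ℤ}

theorem transProb_nonneg (i j : ℤ) (t : ℝ≥0) : 0 ≤ transProb Pr X i j t := measureReal_nonneg

namespace IsBirthDeathProcess

theorem measurableSet_eq (hX : IsBirthDeathProcess l m Pr X) (t : ℝ≥0) (j : ℤ) : MeasurableSet
    {ω | X t ω = j} :=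
  hX.measurable t (measurableSet_singleton j)

theorem transProb_le_one (hX : IsBirthDeathProcess l m Pr X) (i j : ℤ) (t : ℝ≥0)
    : transProb Pr X i j t ≤ 1 :=
  have := hX.isProb i
  measureReal_le_one

theorem transProb_zero (hX : IsBirthDeathProcess l m Pr X) (i j : ℤ)
    : transProb Pr X i j 0 = if i = j then 1 else 0 := by
  have := hX.isProb i
  have h : {ω | X 0 ω = j} =ᵐ[Pr i] (if i = j then Set.univ else ∅ : Set Ω) := by
    filter_upwards [hX.start i] with ω hω
    split_ifs with hij
    · exact propext ⟨fun _ => trivial, fun _ => hω.trans hij⟩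
    · exact propext ⟨fun h : X 0 ω = j => hij (hω.symm.trans h), fun h => h.elim⟩
  rw [transProb, measureReal_congr h]
  split_ifs <;> simp

theorem hasSum_measureReal (hX : IsBirthDeathProcess l m Pr X) (i : ℤ) (t : ℝ≥0) {E : Set Ω}
    (hE : MeasurableSet E) :
    HasSum (fun j => (Pr i).real (E ∩ {ω | X t ω = j})) ((Pr i).real E) := by
  have := hX.isProb i
  have hU : E = ⋃ j, E ∩ {ω | X t ω = j} := by
    ext ω; simp
  have h := measure_iUnion (μ := Pr i) (f := fun j => E ∩ {ω | X t ω = j}) ?_ ?_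
  · rw [← hU] at h
    have h2 := ENNReal.hasSum_toReal (f := fun j => (Pr i) (E ∩ {ω | X t ω = j})) (by
      rw [← h]; exact measure_ne_top _ _)
    rwa [← ENNReal.tsum_toReal_eq (fun _ => measure_ne_top _ _), ← h] at h2
  · intro a b hab
    refine Set.disjoint_left.2 fun ω h1 h2 => hab ?_
    exact h1.2.symm.trans h2.2
  · exact fun j => hE.inter (hX.measurableSet_eq t j)

theorem hasSum_transProb (hX : IsBirthDeathProcess l m Pr X) (i : ℤ) (t : ℝ≥0) : HasSum
    (fun j => transProb Pr X i j t) 1 := by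
  have := hX.isProb i
  simpa [transProb] using hX.hasSum_measureReal i t MeasurableSet.univ

theorem chapmanKolmogorov (hX : IsBirthDeathProcess l m Pr X) (i j : ℤ) (s t : ℝ≥0) :
    HasSum (fun k => transProb Pr X i k s * transProb Pr X k j t) (transProb Pr X i j (s + t)) := by
  have h := hX.hasSum_measureReal i s (hX.measurableSet_eq (s + t) j)
  refine h.congr_fun fun k => ?_
  have h2 := hX.markov i s t k j Set.univ MeasurableSet.univ
  simp only [Set.univ_inter] at h2
  rw [transProb, transProb, Measure.real, Measure.real, Measure.real, Set.inter_comm, h2,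
    ENNReal.toReal_mul]

theorem mul_transProb_le (hX : IsBirthDeathProcess l m Pr X) (i j k : ℤ) (s t : ℝ≥0) :
    transProb Pr X i k s * transProb Pr X k j t ≤ transProb Pr X i j (s + t) :=
  le_hasSum (hX.chapmanKolmogorov i j s t) k fun _ _ =>
    mul_nonneg (transProb_nonneg _ _ _) (transProb_nonneg _ _ _)

/-- The terms of the Chapman-Kolmogorov series outside `S` have second factor at most one, so their
sum is at most the probability of being outside `S` at time `s`. The choice `S = {i}` gives
continuity, and `S = {i + 1, i - 1, i}` gives the backward equation. -/
theorem abs_sub_sum_le (hX : IsBirthDeathProcess l m Pr X) (S : Finset ℤ) (i j : ℤ) (s t : ℝ≥0) :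
    transProb Pr X i j (s + t) - ∑ k ∈ S, transProb Pr X i k s * transProb Pr X k j t ∈
      Set.Icc 0 (1 - ∑ k ∈ S, transProb Pr X i k s) := by
  have h1 := hX.chapmanKolmogorov i j s t
  have h2 := hX.hasSum_transProb i s
  constructor
  · rw [sub_nonneg]
    exact sum_le_hasSum S (fun _ _ =>
      mul_nonneg (transProb_nonneg _ _ _) (transProb_nonneg _ _ _)) h1
  · have h3 := h2.sub h1
    have h4 := sum_le_hasSum S (fun k _ => ?_) h3
    · rw [Finset.sum_sub_distrib] at h4; linarith
    · have := mul_le_of_le_one_right (transProb_nonneg (Pr := Pr) (X := X) i k s)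
        (hX.transProb_le_one k j t)
      linarith

theorem abs_transProb_sub_le (hX : IsBirthDeathProcess l m Pr X) (i j : ℤ) (s t : ℝ≥0) :
    |transProb Pr X i j (s + t) - transProb Pr X i j t| ≤ 1 - transProb Pr X i i s := by
  have h := hX.abs_sub_sum_le {i} i j s t
  simp only [Finset.sum_singleton] at h
  obtain ⟨h1, h2⟩ := h
  have h3 := hX.transProb_le_one i j t
  have h4 := transProb_nonneg (Pr := Pr) (X := X) i j t
  have h5 := hX.transProb_le_one i i s
  rw [abs_le]
  constructor <;> nlinarith

/-- The increment over a time step is bounded by `1 - P i i` at the length of the step, which tends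
to zero because `rates` makes `P i i` continuous at `0`. -/
theorem continuousOn_transProb (hX : IsBirthDeathProcess l m Pr X) (i j : ℤ) :
    ContinuousOn (fun t : ℝ => transProb Pr X i j t.toNNReal) (Set.Ici 0) := by
  have h0 : Filter.Tendsto (fun s : ℝ => 1 - transProb Pr X i i s.toNNReal)
      (nhdsWithin 0 (Set.Ici 0)) (nhds 0) := by
    have := ((hX.rates i i).continuousWithinAt).tendsto
    simp only [Real.toNNReal_zero, hX.transProb_zero, if_true] at this
    simpa using this.const_sub 1
  intro t ht
  have ht' : 0 ≤ t := ht
  rw [ContinuousWithinAt, tendsto_iff_norm_sub_tendsto_zero]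
  have habs : Filter.Tendsto (fun s : ℝ => |s - t|) (nhdsWithin t (Set.Ici 0))
      (nhdsWithin 0 (Set.Ici 0)) := by
    refine tendsto_nhdsWithin_iff.2 ⟨?_, Filter.Eventually.of_forall fun s => abs_nonneg (s - t)⟩
    have : Filter.Tendsto (fun s : ℝ => |s - t|) (nhds t) (nhds |t - t|) :=
      Continuous.tendsto (by fun_prop) t
    simp only [sub_self, abs_zero] at this
    exact this.mono_left nhdsWithin_le_nhds
  refine squeeze_zero' (Filter.Eventually.of_forall fun _ => norm_nonneg _) ?_ (h0.comp habs)
  filter_upwards [self_mem_nhdsWithin] with s hs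
  have hs' : 0 ≤ s := hs
  rw [Real.norm_eq_abs, Function.comp_apply]
  rcases le_total s t with h | h
  · have := hX.abs_transProb_sub_le i j (t - s).toNNReal s.toNNReal
    rw [← Real.toNNReal_add (by linarith) hs', sub_add_cancel] at this
    rw [abs_sub_comm, abs_sub_comm s t, abs_of_nonneg (by linarith : 0 ≤ t - s)]
    exact this
  · have := hX.abs_transProb_sub_le i j (s - t).toNNReal t.toNNReal
    rw [← Real.toNNReal_add (by linarith) ht', sub_add_cancel] at this
    rw [abs_of_nonneg (by linarith : 0 ≤ s - t)]
    exact this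

/-- `rates` gives derivatives state by state, and no interchange with the infinite sum is needed:
row `i` of the generator sums to zero over `i + 1`, `i - 1`, `i`, so the probability of being
elsewhere after time `h` is `o(h)`, and it dominates the rest of the Chapman-Kolmogorov series. -/
theorem hasDerivWithinAt_transProb (hX : IsBirthDeathProcess l m Pr X) (i j : ℤ) {t : ℝ}
    (ht : 0 ≤ t) :
    HasDerivWithinAt (fun s : ℝ => transProb Pr X i j s.toNNReal)
      (l i * transProb Pr X (i + 1) j t.toNNReal
        - (l i + m i) * transProb Pr X i j t.toNNReal
        + m i * transProb Pr X (i - 1) j t.toNNReal) (Set.Ici t) t := by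
  let S : Finset ℤ := {i + 1, i - 1, i}
  have hsum : ∀ f : ℤ → ℝ, ∑ k ∈ S, f k = f (i + 1) + f (i - 1) + f i := by
    intro f
    rw [Finset.sum_insert, Finset.sum_insert, Finset.sum_singleton, add_assoc]
    · simp only [Finset.mem_singleton]; omega
    · simp only [Finset.mem_insert, Finset.mem_singleton]; omega
  have hrate : ∀ k, HasDerivWithinAt (fun s : ℝ => transProb Pr X i k (s - t).toNNReal)
      (generator l m i k) (Set.Ici t) t := by
    intro k
    have h1 := hX.rates i k
    have h2 : HasDerivWithinAt (fun s : ℝ => s - t) 1 (Set.Ici t) t :=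
      (hasDerivWithinAt_id t _).sub_const t
    have h3 : HasDerivWithinAt (fun h : ℝ => transProb Pr X i k h.toNNReal)
      (generator l m i k) (Set.Ici 0) (t - t) := by simpa using h1
    have := HasDerivWithinAt.comp (h := fun s : ℝ => s - t) t h3 h2
      (fun s (hs : t ≤ s) => Set.mem_Ici.2 (sub_nonneg.2 hs))
    simpa [Function.comp_def] using this
  have hg1 : generator l m i (i + 1) = l i := by simp [generator]
  have hg2 : generator l m i (i - 1) = m i := by
    rw [generator, if_neg (by omega), if_pos rfl]
  have hg3 : generator l m i i = -(l i + m i) := by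
    rw [generator, if_neg (by omega), if_neg (by omega), if_pos rfl]
  have hmain : HasDerivWithinAt (fun s : ℝ => ∑ k ∈ S,
      transProb Pr X i k (s - t).toNNReal * transProb Pr X k j t.toNNReal)
      (∑ k ∈ S, generator l m i k * transProb Pr X k j t.toNNReal) (Set.Ici t) t := by
    refine HasDerivWithinAt.fun_sum fun k _ => (hrate k).mul_const _
  have hR : HasDerivWithinAt (fun s : ℝ => 1 - ∑ k ∈ S, transProb Pr X i k (s - t).toNNReal)
      0 (Set.Ici t) t := by
    have h := (HasDerivWithinAt.fun_sum (u := S) fun k _ => hrate k).const_sub 1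
    rw [hsum, hg1, hg2, hg3] at h
    refine h.congr_deriv ?_
    ring
  have hbd : ∀ s ∈ Set.Ici t, transProb Pr X i j s.toNNReal - ∑ k ∈ S,
      transProb Pr X i k (s - t).toNNReal * transProb Pr X k j t.toNNReal ∈
        Set.Icc 0 (1 - ∑ k ∈ S, transProb Pr X i k (s - t).toNNReal) := by
    intro s hs
    have hs' : t ≤ s := hs
    have := hX.abs_sub_sum_le S i j (s - t).toNNReal t.toNNReal
    rwa [← Real.toNNReal_add (by linarith) ht, sub_add_cancel] at this
  have hR0 : 1 - ∑ k ∈ S, transProb Pr X i k (t - t).toNNReal = 0 := by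
    rw [hsum]; simp [hX.transProb_zero, show ¬ i = i - 1 by omega]
  have hrest : HasDerivWithinAt (fun s : ℝ => transProb Pr X i j s.toNNReal - ∑ k ∈ S,
      transProb Pr X i k (s - t).toNNReal * transProb Pr X k j t.toNNReal) 0 (Set.Ici t) t := by
    have h0 := hbd t Set.self_mem_Ici
    rw [hR0, Set.Icc_self, Set.mem_singleton_iff] at h0
    rw [hasDerivWithinAt_iff_isLittleO] at hR ⊢
    rw [h0]
    rw [hR0] at hR
    simp only [smul_zero, sub_zero] at hR ⊢
    refine Asymptotics.IsBigO.trans_isLittleO ?_ hR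
    refine Asymptotics.IsBigO.of_bound 1 ?_
    filter_upwards [self_mem_nhdsWithin] with s hs
    obtain ⟨h1, h2⟩ := hbd s hs
    rw [one_mul, Real.norm_of_nonneg h1, Real.norm_of_nonneg (h1.trans h2)]
    exact h2
  have := hrest.add hmain
  rw [hsum, hg1, hg2, hg3] at this
  refine (this.congr_deriv (by ring)).congr (fun s _ => ?_) ?_ <;>
  · simp only [Pi.add_apply, sub_add_cancel]

end IsBirthDeathProcess

end transition

/-- Solutions of the backward equation that grow at most exponentially in the initial state are
determined by their initial values. -/
theorem backward_unique {l m : ℤ → ℝ} {c M ρ : ℝ} (hl : ∀ i, |l i| ≤ c) (hm : ∀ i, |m i| ≤ c)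
    (hρ : 1 ≤ ρ) {u : ℤ → ℝ → ℝ} (hcont : ∀ i, ContinuousOn (u i) (Set.Ici 0))
    (hderiv : ∀ i t, 0 ≤ t → HasDerivWithinAt (u i)
      (l i * u (i + 1) t - (l i + m i) * u i t + m i * u (i - 1) t) (Set.Ici t) t)
    (h0 : ∀ i, u i 0 = 0) (hb : ∀ i t, 0 ≤ t → |u i t| ≤ M * ρ ^ i.natAbs)
    (i : ℤ) {t : ℝ} (ht : 0 ≤ t) : u i t = 0 := by
  have hc : 0 ≤ c := (abs_nonneg _).trans (hl 0)
  have hM : 0 ≤ M := by simpa using (abs_nonneg _).trans (hb 0 0 le_rfl)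
  have hρ0 : 0 < ρ := by linarith
  -- The coefficients of the backward operator have absolute sum at most `4 * c`, and passing to a
  -- neighbouring state costs a factor `ρ`. Each integration in time thus produces the next term of
  -- the exponential series in `L * t`, whose terms tend to zero.
  set L := 4 * c * ρ with hL
  have key : ∀ n : ℕ, ∀ i t, 0 ≤ t → |u i t| ≤ M * ρ ^ i.natAbs * ((L * t) ^ n / n.factorial) := by
    intro n
    induction n with
    | zero => intro i t ht; simpa using hb i t ht
    | succ n ih =>
      intro i t ht
      have hB : ∀ x, HasDerivAt (fun t => M * ρ ^ i.natAbs * ((L * t) ^ (n + 1) / (n + 1).factorial))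
          (M * ρ ^ i.natAbs * (L * ((L * x) ^ n / n.factorial))) x := by
        intro x
        have h1 : HasDerivAt (fun t => (L * t) ^ (n + 1))
            ((n + 1 : ℕ) * (L * x) ^ n * (L * 1)) x := by
          simpa using (((hasDerivAt_id x).const_mul L).fun_pow (n + 1))
        refine ((h1.div_const _).const_mul _).congr_deriv ?_
        rw [Nat.factorial_succ]
        push_cast
        field_simp
      have := image_norm_le_of_norm_deriv_right_le_deriv_boundary (f := u i) (a := 0) (b := t)
        (f' := fun t => l i * u (i + 1) t - (l i + m i) * u i t + m i * u (i - 1) t)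
        (B := fun t => M * ρ ^ i.natAbs * ((L * t) ^ (n + 1) / (n + 1).factorial))
        (B' := fun x => M * ρ ^ i.natAbs * (L * ((L * x) ^ n / n.factorial)))
        ((hcont i).mono Set.Icc_subset_Ici_self) (fun x hx => hderiv i x hx.1)
        (by simp [h0]) hB ?_ ⟨ht, le_rfl⟩
      · exact this
      · intro x hx
        set A := (L * x) ^ n / n.factorial with hA
        have hx0 : 0 ≤ x := hx.1
        have hA0 : 0 ≤ A := by positivity
        set W := M * ρ ^ i.natAbs with hW
        have hW0 : 0 ≤ W := by positivity
        have hnb : ∀ k : ℤ, k.natAbs ≤ i.natAbs + 1 → |u k x| ≤ W * ρ * A := by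
          intro k hk
          refine (ih k x hx0).trans ?_
          refine mul_le_mul_of_nonneg_right ?_ hA0
          rw [hW, mul_assoc, ← pow_succ]
          exact mul_le_mul_of_nonneg_left (pow_le_pow_right₀ hρ hk) hM
        have e1 := hnb (i + 1) (by omega)
        have e2 := hnb (i - 1) (by omega)
        have e3 := hnb i (by omega)
        have hWA : 0 ≤ W * ρ * A := by positivity
        rw [Real.norm_eq_abs]
        calc |l i * u (i + 1) x - (l i + m i) * u i x + m i * u (i - 1) x|
            ≤ |l i| * |u (i + 1) x| + (|l i| + |m i|) * |u i x| + |m i| * |u (i - 1) x| := by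
              refine (abs_add_le _ _).trans ?_
              refine add_le_add ((abs_sub _ _).trans ?_) (abs_mul _ _).le
              rw [abs_mul, abs_mul]
              exact add_le_add le_rfl (mul_le_mul_of_nonneg_right (abs_add_le _ _) (abs_nonneg _))
          _ ≤ c * (W * ρ * A) + (c + c) * (W * ρ * A) + c * (W * ρ * A) := by
              gcongr
              exacts [hl i, hl i, hm i, hm i]
          _ = W * (L * A) := by rw [hL]; ring
  have hlim : Filter.Tendsto (fun n : ℕ => M * ρ ^ i.natAbs * ((L * t) ^ n / n.factorial))
      Filter.atTop (nhds 0) := by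
    simpa using (FloorSemiring.tendsto_pow_div_factorial_atTop (L * t)).const_mul
      (M * ρ ^ i.natAbs)
  have := ge_of_tendsto' hlim fun n => key n i t ht
  exact abs_nonpos_iff.1 this

/-! ### Returns to a state -/

section returns

variable {Ω : Type*} {l m : ℤ → ℝ} {X : ℝ≥0 → Ω → ℤ}

/-- No visit of `i` at the times `s + h, …, s + n h`. -/
def noVisit (X : ℝ≥0 → Ω → ℤ) (i : ℤ) (h s : ℝ≥0) (n : ℕ) : Set Ω :=
  {ω | ∀ k < n, X (s + (k + 1) * h) ω ≠ i}

/-- No return to `i` along the times `0, h, …, n h`. -/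
def noReturn (X : ℝ≥0 → Ω → ℤ) (i : ℤ) (h : ℝ≥0) (n : ℕ) : Set Ω :=
  {ω | ∀ b ≤ n, ∀ a < b, X (a * h) ω ≠ i → X (b * h) ω ≠ i}

/-- The path is in `i` at the times `0, h, …, n h`. -/
def stays (X : ℝ≥0 → Ω → ℤ) (i : ℤ) (h : ℝ≥0) (n : ℕ) : Set Ω :=
  {ω | ∀ k ≤ n, X (k * h) ω = i}

theorem noVisit_succ (i : ℤ) (h s : ℝ≥0) (n : ℕ) :
    noVisit X i h s (n + 1) = {ω | X (s + h) ω ≠ i} ∩ noVisit X i h (s + h) n := by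
  have e : ∀ k : ℕ, s + h + ((k : ℝ≥0) + 1) * h = s + (((k + 1 : ℕ) : ℝ≥0) + 1) * h := by
    intro k; push_cast; ring
  ext ω
  simp only [noVisit, Set.mem_ofPred_eq, Set.mem_inter_iff, e]
  constructor
  · intro H
    exact ⟨by simpa using H 0 (by omega), fun k hk => H (k + 1) (by omega)⟩
  · rintro ⟨H0, H⟩ k hk
    rcases k with _ | k
    · simpa using H0
    · exact H k (by omega)

theorem measurableSet_past {s u : ℝ≥0} (h : u ≤ s) (j : ℤ) :
    MeasurableSet[⨆ (u : ℝ≥0) (_ : u ≤ s), MeasurableSpace.comap (X u) ⊤] {ω | X u ω = j} :=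
  le_iSup₂ (f := fun (u : ℝ≥0) (_ : u ≤ s) => MeasurableSpace.comap (X u) ⊤) u h _
    ⟨{j}, trivial, rfl⟩

theorem past_mono {s t : ℝ≥0} (h : s ≤ t) :
    (⨆ (u : ℝ≥0) (_ : u ≤ s), MeasurableSpace.comap (X u) ⊤) ≤
      ⨆ (u : ℝ≥0) (_ : u ≤ t), MeasurableSpace.comap (X u) ⊤ :=
  iSup₂_le fun u hu =>
    le_iSup₂ (f := fun (u : ℝ≥0) (_ : u ≤ t) => MeasurableSpace.comap (X u) ⊤) u (hu.trans h)

theorem measurableSet_past_stays (i : ℤ) (h : ℝ≥0) (n : ℕ) :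
    MeasurableSet[⨆ (u : ℝ≥0) (_ : u ≤ n * h), MeasurableSpace.comap (X u) ⊤] (stays X i h n) := by
  have : stays X i h n = ⋂ k : ℕ, ⋂ (_ : k ≤ n), {ω | X ((k : ℝ≥0) * h) ω = i} := by
    ext ω; simp [stays]
  rw [this]
  refine MeasurableSet.iInter fun k => MeasurableSet.iInter fun hk => measurableSet_past ?_ i
  gcongr

variable [MeasurableSpace Ω] {Pr : ℤ → Measure Ω}

open scoped Classical in
/-- Probability, from `j`, of no visit of `i` at the times `h, …, n h`. -/
noncomputable def taboo (Pr : ℤ → Measure Ω) (X : ℝ≥0 → Ω → ℤ) (i : ℤ) (h : ℝ≥0) : ℕ → ℤ → ℝ≥0∞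
  | 0, _ => 1
  | n + 1, j => ∑' k, (Pr j) {ω | X h ω = k} * (if k = i then 0 else taboo Pr X i h n k)

theorem ennreal_tsum_mul_tsum (f g : ℕ → ℝ≥0∞) :
    (∑' n, f n) * ∑' n, g n = ∑' n, ∑ p ∈ Finset.HasAntidiagonal.antidiagonal n, f p.1 * g p.2 := by
  calc (∑' n, f n) * ∑' n, g n = ∑' p : ℕ × ℕ, f p.1 * g p.2 := by
        rw [ENNReal.tsum_prod (f := fun a b => f a * g b), ← ENNReal.tsum_mul_right]
        exact tsum_congr fun a => ENNReal.tsum_mul_left.symm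
    _ = ∑' p : Σ n, Finset.HasAntidiagonal.antidiagonal n, f p.2.1.1 * g p.2.1.2 :=
        (Finset.HasAntidiagonal.sigmaAntidiagonalEquivProd.tsum_eq fun p : ℕ × ℕ => f p.1 * g p.2).symm
    _ = _ := by
        rw [ENNReal.tsum_sigma']
        refine tsum_congr fun n => ?_
        rw [tsum_fintype, ← Finset.sum_coe_sort (Finset.HasAntidiagonal.antidiagonal n)]

/-- On an antidiagonal the first index determines the pair, so disjointness needs to be known only
for increasing first index. -/
theorem measure_antidiagonal_le (μ : Measure Ω) (N : ℕ) (A : ℕ × ℕ → Set Ω) (B : Set Ω)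
    (hA : ∀ p ∈ Finset.HasAntidiagonal.antidiagonal N, MeasurableSet (A p))
    (hd : ∀ p ∈ Finset.HasAntidiagonal.antidiagonal N, ∀ q ∈ Finset.HasAntidiagonal.antidiagonal N, p.1 < q.1 →
      Disjoint (A p) (A q))
    (hB : ∀ p ∈ Finset.HasAntidiagonal.antidiagonal N, A p ⊆ B) :
    ∑ p ∈ Finset.HasAntidiagonal.antidiagonal N, μ (A p) ≤ μ B := by
  rw [← measure_biUnion_finset _ hA]
  · exact measure_mono (Set.iUnion₂_subset hB)
  · intro p hp q hq hpq
    rcases lt_trichotomy p.1 q.1 with h | h | h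
    · exact hd p hp q hq h
    · exfalso
      have h1 := Finset.HasAntidiagonal.mem_antidiagonal.1 (Finset.mem_coe.1 hp)
      have h2 := Finset.HasAntidiagonal.mem_antidiagonal.1 (Finset.mem_coe.1 hq)
      exact hpq (Prod.ext h (by omega))
    · exact (hd q hq p hp h).symm

namespace IsBirthDeathProcess

theorem measurableSet_noVisit (hX : IsBirthDeathProcess l m Pr X) (i : ℤ) (h s : ℝ≥0) (n : ℕ) :
    MeasurableSet (noVisit X i h s n) := by
  have : noVisit X i h s n = ⋂ k, ⋂ (_ : k < n), {ω | X (s + ((k : ℕ) + 1) * h) ω = i}ᶜ := by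
    ext ω; simp [noVisit]
  rw [this]
  exact MeasurableSet.iInter fun k => MeasurableSet.iInter fun _ => (hX.measurableSet_eq _ _).compl

theorem measurableSet_noReturn (hX : IsBirthDeathProcess l m Pr X) (i : ℤ) (h : ℝ≥0) (n : ℕ) :
    MeasurableSet (noReturn X i h n) := by
  have : noReturn X i h n = ⋂ b : ℕ, ⋂ (_ : b ≤ n), ⋂ a : ℕ, ⋂ (_ : a < b),
      ({ω | X ((a : ℝ≥0) * h) ω = i} ∪ {ω | X ((b : ℝ≥0) * h) ω = i}ᶜ) := by
    ext ω
    simp only [noReturn, Set.mem_ofPred_eq, Set.mem_iInter, Set.mem_union, Set.mem_compl_iff]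
    refine forall_congr' fun b => forall_congr' fun _ => forall_congr' fun a =>
      forall_congr' fun _ => ?_
    tauto
  rw [this]
  exact MeasurableSet.iInter fun b => MeasurableSet.iInter fun _ => MeasurableSet.iInter fun a =>
    MeasurableSet.iInter fun _ => (hX.measurableSet_eq _ _).union (hX.measurableSet_eq _ _).compl

theorem tsum_measure_inter (hX : IsBirthDeathProcess l m Pr X) (i : ℤ) (t : ℝ≥0) {E : Set Ω}
    (hE : MeasurableSet E) : ∑' j, (Pr i) (E ∩ {ω | X t ω = j}) = (Pr i) E := by
  have hU : E = ⋃ j, E ∩ {ω | X t ω = j} := by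
    ext ω; simp
  conv_rhs => rw [hU]
  refine (measure_iUnion ?_ fun j => hE.inter (hX.measurableSet_eq t j)).symm
  intro a b hab
  exact Set.disjoint_left.2 fun ω h1 h2 => hab (h1.2.symm.trans h2.2)

theorem past_le (hX : IsBirthDeathProcess l m Pr X) (s : ℝ≥0) :
    (⨆ (u : ℝ≥0) (_ : u ≤ s), MeasurableSpace.comap (X u) ⊤) ≤ (inferInstance : MeasurableSpace Ω) :=
  iSup₂_le fun u _ => (hX.measurable u).comap_le

/-- The Markov property iterated along the grid by conditioning on the position after one step.
Since `taboo` is defined by the same recursion, the Markov property is needed only for pairs of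
times. -/
theorem measure_inter_noVisit (hX : IsBirthDeathProcess l m Pr X) (i i₀ : ℤ) (h : ℝ≥0) (n : ℕ) :
    ∀ (s : ℝ≥0) (j : ℤ) (E : Set Ω),
      MeasurableSet[⨆ (u : ℝ≥0) (_ : u ≤ s), MeasurableSpace.comap (X u) ⊤] E →
      (Pr i₀) (E ∩ {ω | X s ω = j} ∩ noVisit X i h s n) =
        (Pr i₀) (E ∩ {ω | X s ω = j}) * taboo Pr X i h n j := by
  induction n with
  | zero => intro s j E _; simp [noVisit, taboo]
  | succ n ih =>
    intro s j E hE
    have hE' : MeasurableSet[⨆ (u : ℝ≥0) (_ : u ≤ s + h), MeasurableSpace.comap (X u) ⊤]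
        (E ∩ {ω | X s ω = j}) :=
      (past_mono (le_add_of_nonneg_right h.2) _ hE).inter
        (measurableSet_past (le_add_of_nonneg_right h.2) j)
    rw [← hX.tsum_measure_inter i₀ (s + h) (((hX.past_le s _ hE).inter
      (hX.measurableSet_eq s j)).inter (hX.measurableSet_noVisit i h s (n + 1))), taboo,
      ← ENNReal.tsum_mul_left]
    refine tsum_congr fun k => ?_
    split_ifs with hk
    · have : E ∩ {ω | X s ω = j} ∩ noVisit X i h s (n + 1) ∩ {ω | X (s + h) ω = k} = ∅ := by
        rw [noVisit_succ, hk]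
        ext ω
        simp only [Set.mem_inter_iff, Set.mem_ofPred_eq, Set.mem_empty_iff_false, iff_false]
        tauto
      rw [this]; simp
    · have : E ∩ {ω | X s ω = j} ∩ noVisit X i h s (n + 1) ∩ {ω | X (s + h) ω = k} =
          E ∩ {ω | X s ω = j} ∩ {ω | X (s + h) ω = k} ∩ noVisit X i h (s + h) n := by
        rw [noVisit_succ]
        ext ω
        simp only [Set.mem_inter_iff, Set.mem_ofPred_eq]
        constructor
        · tauto
        · rintro ⟨⟨⟨h1, h2⟩, h3⟩, h4⟩
          exact ⟨⟨⟨h1, h2⟩, by rw [h3]; exact hk, h4⟩, h3⟩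
      rw [this, ih (s + h) k _ hE', hX.markov i₀ s h j k E hE, mul_assoc]

theorem measure_stays (hX : IsBirthDeathProcess l m Pr X) (i : ℤ) (h : ℝ≥0) (n : ℕ) :
    (Pr i) (stays X i h n) = (Pr i) {ω | X h ω = i} ^ n := by
  have := hX.isProb i
  induction n with
  | zero =>
    have : ∀ᵐ ω ∂(Pr i), ω ∈ stays X i h 0 := by
      filter_upwards [hX.start i] with ω hω
      simpa [stays] using hω
    rw [pow_zero]
    exact (prob_compl_eq_zero_iff (hX.past_le _ _ (measurableSet_past_stays i h 0))).1
      (ae_iff.1 this)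
  | succ n ih =>
    have e : stays X i h (n + 1) =
        stays X i h n ∩ {ω | X (n * h) ω = i} ∩ {ω | X (n * h + h) ω = i} := by
      have e1 : (n : ℝ≥0) * h + h = ((n + 1 : ℕ) : ℝ≥0) * h := by push_cast; ring
      ext ω
      simp only [stays, Set.mem_inter_iff, Set.mem_ofPred_eq, e1]
      constructor
      · intro H
        exact ⟨⟨fun k hk => H k (by omega), H n (by omega)⟩, H (n + 1) le_rfl⟩
      · rintro ⟨⟨H, _⟩, H1⟩ k hk
        rcases Nat.lt_or_ge n k with h1 | h1
        · rwa [show k = n + 1 by omega]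
        · exact H k h1
    have e2 : stays X i h n ∩ {ω | X (n * h) ω = i} = stays X i h n :=
      Set.inter_eq_left.2 fun ω hω => hω n le_rfl
    rw [e, hX.markov i (n * h) h i i _ (measurableSet_past_stays i h n), e2, ih, pow_succ]

/-- Decomposition according to the last grid visit to `i` among the indices `0, …, N`; such a visit
exists almost surely because the path starts in `i`. -/
theorem sum_renewal (hX : IsBirthDeathProcess l m Pr X) (i : ℤ) (h : ℝ≥0) (N : ℕ) :
    ∑ p ∈ Finset.HasAntidiagonal.antidiagonal N, (Pr i) {ω | X ((p.1 : ℝ≥0) * h) ω = i} * taboo Pr X i h p.2 i =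
      1 := by
  have := hX.isProb i
  have h1 : ∀ p : ℕ × ℕ, (Pr i) {ω | X ((p.1 : ℝ≥0) * h) ω = i} * taboo Pr X i h p.2 i =
      (Pr i) ({ω | X ((p.1 : ℝ≥0) * h) ω = i} ∩ noVisit X i h (p.1 * h) p.2) := by
    intro p
    have := hX.measure_inter_noVisit i i h p.2 (p.1 * h) i Set.univ MeasurableSet.univ
    simpa using this.symm
  simp only [h1]
  refine le_antisymm ?_ ?_
  · refine (measure_antidiagonal_le (Pr i) N _ Set.univ (fun p _ => ?_) (fun p hp q hq hpq => ?_)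
      fun _ _ => Set.subset_univ _).trans_eq measure_univ
    · exact (hX.measurableSet_eq _ _).inter (hX.measurableSet_noVisit _ _ _ _)
    · have h2 := Finset.HasAntidiagonal.mem_antidiagonal.1 hp
      have h3 := Finset.HasAntidiagonal.mem_antidiagonal.1 hq
      refine Set.disjoint_left.2 fun ω hω hω' => ?_
      -- `noVisit` counts from the first time strictly after `p.1 * h`, so the grid time with index
      -- `q.1` is number `q.1 - p.1 - 1`.
      have h4 := hω.2 (q.1 - p.1 - 1) (by omega)
      have e : (p.1 : ℝ≥0) * h + (((q.1 - p.1 - 1 : ℕ) : ℝ≥0) + 1) * h = q.1 * h := by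
        rw [← add_mul]
        congr 1
        have : p.1 + (q.1 - p.1 - 1 + 1) = q.1 := by omega
        exact_mod_cast this
      rw [e] at h4
      exact h4 hω'.1
  · have hcover : ∀ᵐ ω ∂(Pr i), ω ∈ ⋃ p ∈ Finset.HasAntidiagonal.antidiagonal N,
        ({ω | X ((p.1 : ℝ≥0) * h) ω = i} ∩ noVisit X i h (p.1 * h) p.2) := by
      filter_upwards [hX.start i] with ω hω
      classical
      have hne : ((Finset.range (N + 1)).filter fun n : ℕ => X ((n : ℝ≥0) * h) ω = i).Nonempty :=
        ⟨0, by simp [hω]⟩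
      obtain ⟨n, hn, hmax⟩ := Finset.exists_max_image _ id hne
      simp only [Finset.mem_filter, Finset.mem_range, id] at hn hmax
      refine Set.mem_iUnion₂.2 ⟨(n, N - n), Finset.HasAntidiagonal.mem_antidiagonal.2 (by simp; omega), hn.2, ?_⟩
      intro k hk hkX
      have e : (n : ℝ≥0) * h + ((k : ℝ≥0) + 1) * h = ((n + k + 1 : ℕ) : ℝ≥0) * h := by
        push_cast; ring
      simp only [e] at hkX hk
      have := hmax (n + k + 1) ⟨by omega, hkX⟩
      omega
    have h5 : (Pr i) Set.univ ≤ (Pr i) (⋃ p ∈ Finset.HasAntidiagonal.antidiagonal N,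
        ({ω | X ((p.1 : ℝ≥0) * h) ω = i} ∩ noVisit X i h (p.1 * h) p.2)) :=
      measure_mono_ae (by filter_upwards [hcover] with ω hω _ using hω)
    rw [measure_univ] at h5
    exact h5.trans (measure_biUnion_finset_le _ _)

/-- A grid path that sits in `i` up to some index and avoids `i` afterwards has not returned.
Different last indices give disjoint events, and only this inclusion into the event of no return is
needed. -/
theorem sum_stays_le (hX : IsBirthDeathProcess l m Pr X) (i : ℤ) (h : ℝ≥0) (N : ℕ) :
    ∑ p ∈ Finset.HasAntidiagonal.antidiagonal N, (Pr i) {ω | X h ω = i} ^ p.1 * taboo Pr X i h p.2 i ≤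
      (Pr i) (noReturn X i h N) := by
  have h1 : ∀ p : ℕ × ℕ, (Pr i) {ω | X h ω = i} ^ p.1 * taboo Pr X i h p.2 i =
      (Pr i) (stays X i h p.1 ∩ noVisit X i h (p.1 * h) p.2) := by
    intro p
    have e2 : stays X i h p.1 ∩ {ω | X (p.1 * h) ω = i} = stays X i h p.1 :=
      Set.inter_eq_left.2 fun ω hω => hω p.1 le_rfl
    have := hX.measure_inter_noVisit i i h p.2 (p.1 * h) i _ (measurableSet_past_stays i h p.1)
    rw [e2, hX.measure_stays] at this
    exact this.symm
  simp only [h1]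
  have key : ∀ p ∈ Finset.HasAntidiagonal.antidiagonal N, ∀ ω ∈ noVisit X i h ((p.1 : ℝ≥0) * h) p.2,
      ∀ b, p.1 < b → b ≤ N → X ((b : ℝ≥0) * h) ω ≠ i := by
    intro p hp ω hω b hb hbN
    have h2 := Finset.HasAntidiagonal.mem_antidiagonal.1 hp
    have h4 := hω (b - p.1 - 1) (by omega)
    have e : (p.1 : ℝ≥0) * h + (((b - p.1 - 1 : ℕ) : ℝ≥0) + 1) * h = b * h := by
      rw [← add_mul]
      congr 1
      have : p.1 + (b - p.1 - 1 + 1) = b := by omega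
      exact_mod_cast this
    rwa [e] at h4
  refine measure_antidiagonal_le (Pr i) N _ _ (fun p _ => ?_) (fun p hp q hq hpq => ?_)
    fun p hp ω hω b hb a hab hXa => ?_
  · exact (hX.past_le _ _ (measurableSet_past_stays i h _)).inter
      (hX.measurableSet_noVisit _ _ _ _)
  · refine Set.disjoint_left.2 fun ω hω hω' => ?_
    have h3 := Finset.HasAntidiagonal.mem_antidiagonal.1 hq
    exact key p hp ω hω.2 q.1 hpq (by omega) (hω'.1 q.1 le_rfl)
  · refine key p hp ω hω.2 b ?_ hb
    by_contra hcon
    exact hXa (hω.1 a (by omega))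

/-- Generating function inequality for the probabilities of no return. -/
theorem le_tsum_mul_tsum_noReturn (hX : IsBirthDeathProcess l m Pr X) (i : ℤ) (h : ℝ≥0)
    (s : ℝ≥0∞) :
    (1 - (Pr i) {ω | X h ω = i} * s)⁻¹ * (1 - s)⁻¹ ≤
      (∑' n : ℕ, (Pr i) {ω | X ((n : ℝ≥0) * h) ω = i} * s ^ n) *
        ∑' n, (Pr i) (noReturn X i h n) * s ^ n := by
  -- The renewal identity says that the convolution of visits with taboo probabilities is the
  -- constant sequence one. Together with the convolution inequality below, it eliminates the taboo
  -- probabilities.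
  have h1 : (∑' n : ℕ, (Pr i) {ω | X ((n : ℝ≥0) * h) ω = i} * s ^ n) *
      ∑' n, taboo Pr X i h n i * s ^ n = (1 - s)⁻¹ := by
    rw [ennreal_tsum_mul_tsum, ← ENNReal.tsum_geometric]
    refine tsum_congr fun N => ?_
    rw [← one_mul (s ^ N), ← hX.sum_renewal i h N, Finset.sum_mul]
    refine Finset.sum_congr rfl fun p hp => ?_
    rw [← Finset.HasAntidiagonal.mem_antidiagonal.1 hp, pow_add]; ring
  have h2 : (∑' n : ℕ, ((Pr i) {ω | X h ω = i} * s) ^ n) *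
      ∑' n, taboo Pr X i h n i * s ^ n ≤ ∑' n, (Pr i) (noReturn X i h n) * s ^ n := by
    rw [ennreal_tsum_mul_tsum]
    refine ENNReal.tsum_le_tsum fun N => ?_
    refine le_trans (le_of_eq ?_) (mul_le_mul_left (hX.sum_stays_le i h N) _)
    rw [Finset.sum_mul]
    refine Finset.sum_congr rfl fun p hp => ?_
    rw [← Finset.HasAntidiagonal.mem_antidiagonal.1 hp, pow_add, mul_pow]; ring
  rw [← h1, ← ENNReal.tsum_geometric]
  calc _ = (∑' n : ℕ, (Pr i) {ω | X ((n : ℝ≥0) * h) ω = i} * s ^ n) *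
        ((∑' n : ℕ, ((Pr i) {ω | X h ω = i} * s) ^ n) * ∑' n, taboo Pr X i h n i * s ^ n) := by
        ring
    _ ≤ _ := by gcongr

end IsBirthDeathProcess

end returns

/-! ### The Laplace transform of the recurrence time, by grid approximation. -/

section returns

variable {Ω : Type*} {l m : ℤ → ℝ} {X : ℝ≥0 → Ω → ℤ}

/-- `1 - exp (-θ T)`, for `T ∈ [0, ∞]`. -/
noncomputable def oneSubExp (θ : ℝ) (T : ℝ≥0∞) : ℝ≥0∞ :=
  if T = ⊤ then 1 else ENNReal.ofReal (1 - Real.exp (-θ * T.toReal))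

theorem oneSubExp_le_one {θ : ℝ} (T : ℝ≥0∞) : oneSubExp θ T ≤ 1 := by
  rw [oneSubExp]
  split_ifs
  · exact le_rfl
  · rw [← ENNReal.ofReal_one]
    exact ENNReal.ofReal_le_ofReal (by linarith [Real.exp_pos (-θ * T.toReal)])

theorem oneSubExp_le_mul {θ : ℝ} (hθ : 0 < θ) (T : ℝ≥0∞) :
    oneSubExp θ T ≤ ENNReal.ofReal θ * T := by
  rw [oneSubExp]
  split_ifs with h
  · rw [h, ENNReal.mul_top]
    · exact le_top
    · simpa using hθ
  · nth_rewrite 2 [← ENNReal.ofReal_toReal h]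
    rw [← ENNReal.ofReal_mul hθ.le]
    refine ENNReal.ofReal_le_ofReal ?_
    have := Real.add_one_le_exp (-θ * T.toReal)
    linarith

/-- A grid approximation of `oneSubExp θ (returnTime X i ω)`. -/
noncomputable def gridReturn (X : ℝ≥0 → Ω → ℤ) (i : ℤ) (h : ℝ≥0) (s : ℝ≥0∞) (ω : Ω) : ℝ≥0∞ :=
  (1 - s) * ∑' n, (noReturn X i h n).indicator 1 ω * s ^ n

theorem gridReturn_le_one {i : ℤ} {h : ℝ≥0} {s : ℝ≥0∞} (hs : s < 1) (ω : Ω) :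
    gridReturn X i h s ω ≤ 1 := by
  have h0 : 1 - s ≠ 0 := (tsub_pos_of_lt hs).ne'
  have h1 : 1 - s ≠ ⊤ := ne_top_of_le_ne_top ENNReal.one_ne_top tsub_le_self
  calc gridReturn X i h s ω ≤ (1 - s) * ∑' n : ℕ, s ^ n := by
        rw [gridReturn]
        gcongr with n
        refine mul_le_of_le_one_left (by positivity) ?_
        exact Set.indicator_le_self' (fun _ _ => zero_le) ω
    _ = 1 := by rw [ENNReal.tsum_geometric, ENNReal.mul_inv_cancel h0 h1]

/-- A geometric sum stopped at `K`. For `s = exp (-θ * h)` and `K * h` close to the return time `T`,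
the bound is close to `1 - exp (-θ * T)`. -/
theorem gridReturn_le {i : ℤ} {h : ℝ≥0} {s : ℝ} (hs0 : 0 < s) (hs : s < 1) {ω : Ω} {K : ℕ}
    (hK : ∀ n ≥ K, ω ∉ noReturn X i h n) :
    gridReturn X i h (ENNReal.ofReal s) ω ≤ ENNReal.ofReal (1 - s ^ K) := by
  have h1 : ∑' n, (noReturn X i h n).indicator 1 ω * ENNReal.ofReal s ^ n ≤
      ∑ n ∈ Finset.range K, ENNReal.ofReal s ^ n := by
    rw [tsum_eq_sum (s := Finset.range K)]
    · refine Finset.sum_le_sum fun n _ => mul_le_of_le_one_left (by positivity) ?_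
      exact Set.indicator_le_self' (fun _ _ => zero_le) ω
    · intro n hn
      rw [Set.indicator_of_notMem (hK n (by simpa using hn)), zero_mul]
  have h2 : ∑ n ∈ Finset.range K, ENNReal.ofReal s ^ n =
      ENNReal.ofReal (∑ n ∈ Finset.range K, s ^ n) := by
    rw [ENNReal.ofReal_sum_of_nonneg fun n _ => by positivity]
    exact Finset.sum_congr rfl fun n _ => (ENNReal.ofReal_pow hs0.le n).symm
  calc gridReturn X i h (ENNReal.ofReal s) ω
      ≤ (1 - ENNReal.ofReal s) * ENNReal.ofReal (∑ n ∈ Finset.range K, s ^ n) := by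
        rw [gridReturn, ← h2]; gcongr
    _ = ENNReal.ofReal (1 - s ^ K) := by
        rw [← ENNReal.ofReal_one, ← ENNReal.ofReal_sub _ hs0.le, ← ENNReal.ofReal_mul (by linarith),
          mul_neg_geom_sum]

variable [MeasurableSpace Ω] {Pr : ℤ → Measure Ω}

namespace IsBirthDeathProcess

theorem exists_right_const (hX : IsBirthDeathProcess l m Pr X) (ω : Ω) (t : ℝ≥0) :
    ∃ u > t, ∀ v, t ≤ v → v < u → X v ω = X t ω := by
  have h1 : {v | X v ω = X t ω} ∈ nhdsWithin t (Set.Ici t) := by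
    have := (hX.rightCont ω t).tendsto (IsOpen.mem_nhds (isOpen_discrete {X t ω}) rfl)
    exact this
  obtain ⟨u, hu, hsub⟩ := (mem_nhdsGE_iff_exists_Ico_subset).1 h1
  exact ⟨u, hu, fun v hv hv' => hsub ⟨hv, hv'⟩⟩

/-- A right-continuous path with discrete values is constant for a while after `t`, so any time can
be replaced by a slightly later rational one. This reduces events about the return time to countable
unions. -/
theorem exists_rat (hX : IsBirthDeathProcess l m Pr X) (ω : Ω) (t w : ℝ≥0) (htw : t < w) :
    ∃ r : ℚ, t ≤ Real.toNNReal r ∧ Real.toNNReal r < w ∧ X (Real.toNNReal r) ω = X t ω := by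
  obtain ⟨u, hu, hc⟩ := hX.exists_right_const ω t
  obtain ⟨r, hr1, hr2⟩ := exists_rat_btwn (K := ℝ) (x := t) (y := (min u w : ℝ≥0))
    (by exact_mod_cast lt_min hu htw)
  have h1 : t ≤ Real.toNNReal r := (Real.le_toNNReal_iff_coe_le (t.2.trans hr1.le)).2 hr1.le
  have h2 : Real.toNNReal r < min u w := by
    rw [← NNReal.coe_lt_coe, Real.coe_toNNReal _ (t.2.trans hr1.le)]; exact hr2
  exact ⟨r, h1, h2.trans_le (min_le_right _ _), hc _ h1 (h2.trans_le (min_le_left _ _))⟩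

theorem measurable_returnTime (hX : IsBirthDeathProcess l m Pr X) (i : ℤ) :
    Measurable (returnTime X i) := by
  refine measurable_of_Iio fun c => ?_
  have : returnTime X i ⁻¹' Set.Iio c = ⋃ (a : ℚ), ⋃ (b : ℚ),
      ⋃ (_ : Real.toNNReal a < Real.toNNReal b ∧ ((Real.toNNReal b : ℝ≥0) : ℝ≥0∞) < c),
      ({ω | X (Real.toNNReal a) ω = i}ᶜ ∩ {ω | X (Real.toNNReal b) ω = i}) := by
    ext ω
    simp only [returnTime, Set.mem_preimage, Set.mem_Iio, iInf_lt_iff, Set.mem_iUnion,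
      Set.mem_inter_iff, Set.mem_compl_iff, Set.mem_ofPred_eq]
    constructor
    · rintro ⟨t, ⟨ht, s, hst, hs⟩, htc⟩
      obtain ⟨a, ha1, ha2, ha3⟩ := hX.exists_rat ω s t hst
      obtain ⟨c', hc1, hc2⟩ := ENNReal.lt_iff_exists_nnreal_btwn.1 htc
      obtain ⟨b, hb1, hb2, hb3⟩ := hX.exists_rat ω t c' (by exact_mod_cast hc1)
      refine ⟨a, b, ⟨ha2.trans_le hb1, lt_trans ?_ hc2⟩, by rwa [ha3], by rwa [hb3]⟩
      exact_mod_cast hb2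
    · rintro ⟨a, b, ⟨hab, hbc⟩, ha, hb⟩
      exact ⟨_, ⟨hb, _, hab, ha⟩, hbc⟩
  rw [this]
  exact MeasurableSet.iUnion fun a => MeasurableSet.iUnion fun b => MeasurableSet.iUnion fun _ =>
    (hX.measurableSet_eq _ _).compl.inter (hX.measurableSet_eq _ _)

theorem exists_grid_return (hX : IsBirthDeathProcess l m Pr X) (i : ℤ) (ω : Ω) {c : ℝ≥0}
    (hc : returnTime X i ω < c) :
    ∃ ε > 0, ∀ h : ℝ≥0, 0 < h → h < ε → ∃ K : ℕ, (K : ℝ≥0) * h ≤ c ∧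
      ∀ n ≥ K, ω ∉ noReturn X i h n := by
  simp only [returnTime, iInf_lt_iff] at hc
  obtain ⟨t, ⟨ht, s, hst, hs⟩, htc⟩ := hc
  have htc' : t < c := by exact_mod_cast htc
  obtain ⟨u, hu, hcu⟩ := hX.exists_right_const ω t
  obtain ⟨v, hv, hcv⟩ := hX.exists_right_const ω s
  -- Rounding `s` and `t` up to the grid moves them by less than `h`. The four terms keep the
  -- rounded `t` inside its holding interval and before `c`, and the rounded `s` inside its holding
  -- interval and before `t`.
  refine ⟨min (min (u - t) (c - t)) (min (v - s) (t - s)), ?_, fun h hh hlt => ?_⟩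
  · simp only [gt_iff_lt, lt_min_iff, tsub_pos_iff_lt]
    exact ⟨⟨hu, htc'⟩, hv, hst⟩
  · simp only [lt_min_iff, lt_tsub_iff_left] at hlt
    obtain ⟨⟨h1, h2⟩, h3, h4⟩ := hlt
    have hgrid : ∀ x : ℝ≥0, x ≤ (⌈x / h⌉₊ : ℝ≥0) * h ∧ (⌈x / h⌉₊ : ℝ≥0) * h < x + h := by
      intro x
      constructor
      · rw [← div_le_iff₀ hh]; exact Nat.le_ceil _
      · have := Nat.ceil_lt_add_one ((zero_le : 0 ≤ x / h))
        have h5 := mul_lt_mul_of_pos_right this hh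
        rwa [add_mul, div_mul_cancel₀ _ hh.ne', one_mul] at h5
    obtain ⟨g1, g2⟩ := hgrid s
    obtain ⟨g3, g4⟩ := hgrid t
    refine ⟨⌈t / h⌉₊, (g4.trans h2).le, fun n hn hω => ?_⟩
    refine hω ⌈t / h⌉₊ hn ⌈s / h⌉₊ ?_ ?_ ?_
    · have := (g2.trans h4).trans_le g3
      have := lt_of_mul_lt_mul_right this hh.le
      exact_mod_cast this
    · rw [hcv _ g1 (g2.trans h3)]; exact hs
    · rw [hcu _ g3 (g4.trans h1)]; exact ht

theorem measurable_gridReturn (hX : IsBirthDeathProcess l m Pr X) (i : ℤ) (h : ℝ≥0) (s : ℝ≥0∞) :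
    Measurable (gridReturn X i h s) := by
  refine Measurable.const_mul (Measurable.tsum fun n => ?_) _
  exact (measurable_const.indicator (hX.measurableSet_noReturn i h n)).mul_const _

theorem lintegral_gridReturn (hX : IsBirthDeathProcess l m Pr X) (i j : ℤ) (h : ℝ≥0) (s : ℝ≥0∞) :
    ∫⁻ ω, gridReturn X i h s ω ∂(Pr j) = (1 - s) * ∑' n, (Pr j) (noReturn X i h n) * s ^ n := by
  have hm : ∀ n, Measurable ((noReturn X i h n).indicator (1 : Ω → ℝ≥0∞)) := fun n =>
    measurable_const.indicator (hX.measurableSet_noReturn i h n)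
  simp only [gridReturn]
  rw [lintegral_const_mul _ (Measurable.tsum fun n => (hm n).mul_const _),
    lintegral_tsum fun n => ((hm n).mul_const _).aemeasurable]
  congr 1
  refine tsum_congr fun n => ?_
  rw [lintegral_mul_const _ (hm n), lintegral_indicator_one (hX.measurableSet_noReturn i h n)]

/-- For every `c` beyond a finite return time, fine grids have seen the return by time `c`; then `c`
decreases to the return time. An upper bound for the upper limit is the form required by the reverse
Fatou lemma. -/
theorem limsup_gridReturn_le (hX : IsBirthDeathProcess l m Pr X) (i : ℤ) {θ : ℝ} (hθ : 0 < θ)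
    {h : ℕ → ℝ≥0} (hpos : ∀ n, 0 < h n) (hlim : Filter.Tendsto h Filter.atTop (nhds 0)) (ω : Ω) :
    Filter.limsup (fun n => gridReturn X i (h n) (ENNReal.ofReal (Real.exp (-θ * h n))) ω)
      Filter.atTop ≤ oneSubExp θ (returnTime X i ω) := by
  have hs : ∀ n, Real.exp (-θ * h n) < 1 := fun n => by
    rw [Real.exp_lt_one_iff]
    have : (0 : ℝ) < h n := hpos n
    nlinarith
  by_cases hT : returnTime X i ω = ⊤
  · rw [oneSubExp, if_pos hT]
    refine Filter.limsup_le_of_le (by isBoundedDefault) (Filter.Eventually.of_forall fun n => ?_)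
    refine gridReturn_le_one ?_ ω
    rw [← ENNReal.ofReal_one]
    exact (ENNReal.ofReal_lt_ofReal_iff one_pos).2 (hs n)
  · rw [oneSubExp, if_neg hT]
    set T := (returnTime X i ω).toNNReal with hTdef
    have hTT : ((T : ℝ≥0) : ℝ≥0∞) = returnTime X i ω := ENNReal.coe_toNNReal hT
    have key : ∀ c : ℝ≥0, T < c → Filter.limsup (fun n => gridReturn X i (h n)
        (ENNReal.ofReal (Real.exp (-θ * h n))) ω) Filter.atTop ≤
          ENNReal.ofReal (1 - Real.exp (-θ * c)) := by
      intro c hc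
      obtain ⟨ε, hε, hgr⟩ := hX.exists_grid_return i ω (c := c) (by rw [← hTT]; exact_mod_cast hc)
      refine Filter.limsup_le_of_le (by isBoundedDefault) ?_
      filter_upwards [hlim.eventually (gt_mem_nhds hε)] with n hn
      obtain ⟨K, hK1, hK2⟩ := hgr (h n) (hpos n) hn
      refine (gridReturn_le (Real.exp_pos _) (hs n) hK2).trans (ENNReal.ofReal_le_ofReal ?_)
      rw [← Real.exp_nat_mul]
      have h6 : ((K : ℝ) * h n) ≤ c := by exact_mod_cast hK1
      have : Real.exp (-θ * c) ≤ Real.exp (K * (-θ * h n)) := Real.exp_le_exp.2 (by nlinarith)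
      linarith
    have hcont : Filter.Tendsto (fun n : ℕ => ENNReal.ofReal (1 - Real.exp (-θ * ((T : ℝ) +
        1 / ((n : ℝ) + 1))))) Filter.atTop (nhds (ENNReal.ofReal (1 - Real.exp (-θ * T)))) := by
      refine ENNReal.tendsto_ofReal ?_
      have h7 : Filter.Tendsto (fun n : ℕ => (T : ℝ) + 1 / ((n : ℝ) + 1)) Filter.atTop
          (nhds (T : ℝ)) := by
        simpa using tendsto_one_div_add_atTop_nhds_zero_nat.const_add (T : ℝ)
      have h8 : Continuous fun x : ℝ => 1 - Real.exp (-θ * x) := by fun_prop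
      exact (h8.tendsto _).comp h7
    refine ge_of_tendsto' hcont fun n => ?_
    have := key (T + 1 / ((n : ℝ≥0) + 1)) (lt_add_of_pos_right _ (by positivity))
    simpa using this

/-- Lower bound for the Laplace transform of the recurrence time. -/
theorem le_lintegral_oneSubExp (hX : IsBirthDeathProcess l m Pr X) (i : ℤ) {θ G c : ℝ}
    (hθ : 0 < θ) (hG : 0 < G) (hc : 0 ≤ c) (hq : 0 < l i + m i)
    (hsum : ∀ h : ℝ≥0, 0 < h → (h : ℝ≥0∞) * ∑' n : ℕ, (Pr i) {ω | X ((n : ℝ≥0) * h) ω = i} *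
      ENNReal.ofReal (Real.exp (-θ * h)) ^ n ≤ ENNReal.ofReal (G + c * h)) :
    ENNReal.ofReal (1 / ((θ + (l i + m i)) * G)) ≤
      ∫⁻ ω, oneSubExp θ (returnTime X i ω) ∂(Pr i) := by
  have := hX.isProb i
  -- The left side of `hsum` is a Riemann sum of mesh `h` for the integral of `exp (-θ * t) * P i i
  -- t`. The term `c * h` allows for the discretisation error and disappears along these meshes.
  let h : ℕ → ℝ≥0 := fun n => 1 / ((n : ℝ≥0) + 1)
  have hpos : ∀ n, 0 < h n := fun n => by positivity
  have hlimR : Filter.Tendsto (fun n => (h n : ℝ)) Filter.atTop (nhds 0) := by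
    simpa [h] using tendsto_one_div_add_atTop_nhds_zero_nat (𝕜 := ℝ)
  have hlim : Filter.Tendsto h Filter.atTop (nhds 0) 
    := NNReal.tendsto_coe.1 (by simpa using hlimR)
  have hs : ∀ n, Real.exp (-θ * h n) < 1 := fun n => by
    rw [Real.exp_lt_one_iff]
    have : (0 : ℝ) < h n := hpos n
    nlinarith
  set q := l i + m i with hqdef
  -- the rescaled probability of moving
  let a : ℕ → ℝ := fun n =>
    (1 - transProb Pr X i i (h n) * Real.exp (-θ * h n)) / h n * (G + c * h n)
  -- The derivative at `0` of `1 - P i i h * exp (-θ * h)` is `θ + q`, by the diagonal rate `-q`.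
  have ha : Filter.Tendsto a Filter.atTop (nhds ((θ + q) * G)) := by
    have h1 : HasDerivWithinAt (fun x : ℝ => 1 - transProb Pr X i i x.toNNReal * Real.exp (-θ * x))
        (θ + q) (Set.Ici 0) 0 := by
      have e1 := hX.rates i i
      have e2 : HasDerivWithinAt (fun x : ℝ => Real.exp (-θ * x)) (-θ) (Set.Ici 0) 0 := by
        have : HasDerivAt (fun x : ℝ => Real.exp (-θ * x)) (Real.exp (-θ * 0) * (-θ * 1)) 0 :=
          ((hasDerivAt_id (0 : ℝ)).const_mul (-θ)).exp
        simpa using this.hasDerivWithinAt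
      have e3 := (e1.mul e2).const_sub 1
      refine e3.congr_deriv ?_
      have hg3 : generator l m i i = -(l i + m i) := by
        rw [generator, if_neg (by omega), if_neg (by omega), if_pos rfl]
      simp [hX.transProb_zero, hg3, hqdef]
    have h2 := (hasDerivWithinAt_iff_tendsto_slope' (s := Set.Ioi (0 : ℝ)) (by simp)).1
      (h1.mono Set.Ioi_subset_Ici_self)
    have h3 : Filter.Tendsto (fun n => (h n : ℝ)) Filter.atTop (nhdsWithin 0 (Set.Ioi 0)) :=
      tendsto_nhdsWithin_iff.2 ⟨hlimR, Filter.Eventually.of_forall fun n => hpos n⟩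
    have h4 := h2.comp h3
    have h5 : Filter.Tendsto (fun n => G + c * (h n : ℝ)) Filter.atTop (nhds (G + c * 0)) :=
      (hlimR.const_mul c).const_add G
    rw [mul_zero, add_zero] at h5
    refine (h4.mul h5).congr fun n => ?_
    simp [a, slope_def_field, hX.transProb_zero]
  have hp : ∀ n, 0 < 1 - transProb Pr X i i (h n) * Real.exp (-θ * h n) := by
    intro n
    have h1 := hX.transProb_le_one i i (h n)
    have h2 := transProb_nonneg (Pr := Pr) (X := X) i i (h n)
    have h3 := Real.exp_pos (-θ * h n)
    nlinarith [hs n]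
  have hGc : ∀ n, 0 < G + c * h n := fun n => by positivity
  have hZ : ∀ n, ENNReal.ofReal (1 / a n) ≤
      ∫⁻ ω, gridReturn X i (h n) (ENNReal.ofReal (Real.exp (-θ * h n))) ω ∂(Pr i) := by
    intro n
    set s := ENNReal.ofReal (Real.exp (-θ * h n)) with hsdef
    have hs1 : s < 1 := by
      rw [← ENNReal.ofReal_one]
      exact (ENNReal.ofReal_lt_ofReal_iff one_pos).2 (hs n)
    have hs0 : 1 - s ≠ 0 := (tsub_pos_of_lt hs1).ne'
    have hst : 1 - s ≠ ⊤ := ne_top_of_le_ne_top ENNReal.one_ne_top tsub_le_self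
    have h1 := hX.le_tsum_mul_tsum_noReturn i (h n) s
    rw [hX.lintegral_gridReturn]
    set A := ∑' k, (Pr i) (noReturn X i (h n) k) * s ^ k
    set B := ∑' k : ℕ, (Pr i) {ω | X ((k : ℝ≥0) * h n) ω = i} * s ^ k with hB
    have h2 : (h n : ℝ≥0∞) * B ≤ ENNReal.ofReal (G + c * h n) := hsum (h n) (hpos n)
    have h3 : (1 - (Pr i) {ω | X (h n) ω = i} * s)⁻¹ ≤ B * ((1 - s) * A) := by
      calc (1 - (Pr i) {ω | X (h n) ω = i} * s)⁻¹
          = (1 - (Pr i) {ω | X (h n) ω = i} * s)⁻¹ * (1 - s)⁻¹ * (1 - s) := by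
            rw [mul_assoc, ENNReal.inv_mul_cancel hs0 hst, mul_one]
        _ ≤ B * A * (1 - s) := by gcongr
        _ = B * ((1 - s) * A) := by ring
    have h4 : (Pr i) {ω | X (h n) ω = i} = ENNReal.ofReal (transProb Pr X i i (h n)) := by
      rw [transProb, ofReal_measureReal]
    rw [h4, hsdef, ← ENNReal.ofReal_mul (transProb_nonneg _ _ _), ← ENNReal.ofReal_one,
      ← ENNReal.ofReal_sub _ (mul_nonneg (transProb_nonneg _ _ _) (Real.exp_pos _).le),
      ← ENNReal.ofReal_inv_of_pos (hp n), ← hsdef, ENNReal.ofReal_one] at h3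
    have h5 : ENNReal.ofReal (h n * (1 - transProb Pr X i i (h n) * Real.exp (-θ * h n))⁻¹) ≤
        ENNReal.ofReal (G + c * h n) * ((1 - s) * A) := by
      rw [ENNReal.ofReal_mul (NNReal.coe_nonneg (h n)), ENNReal.ofReal_coe_nnreal]
      calc _ ≤ (h n : ℝ≥0∞) * (B * ((1 - s) * A)) := by gcongr
        _ = (h n : ℝ≥0∞) * B * ((1 - s) * A) := by ring
        _ ≤ _ := by gcongr
    have h6 : ENNReal.ofReal (1 / a n) =
        ENNReal.ofReal (h n * (1 - transProb Pr X i i (h n) * Real.exp (-θ * h n))⁻¹) /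
          ENNReal.ofReal (G + c * h n) := by
      rw [← ENNReal.ofReal_div_of_pos (hGc n)]
      congr 1
      have e1 := (hp n).ne'
      have e2 := (hGc n).ne'
      have e3 : (h n : ℝ) ≠ 0 := (NNReal.coe_pos.2 (hpos n)).ne'
      simp only [a]
      field_simp
    rw [h6]
    exact ENNReal.div_le_of_le_mul' h5
  have hlim1 : Filter.Tendsto (fun n => ENNReal.ofReal (1 / a n)) Filter.atTop
      (nhds (ENNReal.ofReal (1 / ((θ + q) * G)))) :=
    ENNReal.tendsto_ofReal (tendsto_const_nhds.div ha (by positivity))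
  -- Reverse Fatou: the grid approximations are bounded by one, so the upper limit of their
  -- integrals is at most the integral of their upper limit.
  rw [← hlim1.limsup_eq]
  refine (Filter.limsup_le_limsup (Filter.Eventually.of_forall hZ)).trans ?_
  refine (limsup_lintegral_le 1 (fun n => hX.measurable_gridReturn _ _ _)
    (fun n => Filter.Eventually.of_forall fun ω => ?_) (by simp)).trans ?_
  · refine gridReturn_le_one ?_ ω
    rw [← ENNReal.ofReal_one]
    exact (ENNReal.ofReal_lt_ofReal_iff one_pos).2 (hs n)
  · exact lintegral_mono fun ω => hX.limsup_gridReturn_le i hθ hpos hlim ω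

end IsBirthDeathProcess

end returns

/-! ### Criteria for transience, recurrence and infinite mean recurrence time. -/

section returns

variable {Ω : Type*} [MeasurableSpace Ω] {l m : ℤ → ℝ} {Pr : ℤ → Measure Ω} {X : ℝ≥0 → Ω → ℤ}

/-- The left side is the Riemann sum of mesh `h` for the integral of `exp (-ε * t)`, which is `1 /
ε`; the error is at most one mesh. -/
theorem mul_inv_one_sub_exp_le {ε h : ℝ} (hε : 0 < ε) (hh : 0 < h) :
    h * (1 - Real.exp (-ε * h))⁻¹ ≤ 1 / ε + h := by
  have h1 : Real.exp (-ε * h) * (1 + ε * h) ≤ 1 := by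
    have h2 := Real.add_one_le_exp (ε * h)
    calc Real.exp (-ε * h) * (1 + ε * h) ≤ Real.exp (-ε * h) * Real.exp (ε * h) := by
          gcongr; linarith
      _ = 1 := by rw [← Real.exp_add]; simp
  have h3 : Real.exp (-ε * h) < 1 := Real.exp_lt_one_iff.2 (by nlinarith)
  rw [← div_eq_mul_inv, div_le_iff₀ (by linarith)]
  have h4 : 1 / ε * (1 + ε * h) = 1 / ε + h := by field_simp
  rw [← h4]
  have : 0 < ε * h := by positivity
  have h5 : 1 / ε * (ε * h) ≤ 1 / ε * ((1 + ε * h) * (1 - Real.exp (-ε * h))) := by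
    exact mul_le_mul_of_nonneg_left (by nlinarith) (by positivity)
  calc h = 1 / ε * (ε * h) := by field_simp
    _ ≤ _ := by rw [mul_assoc]; exact h5

theorem mul_tsum_geometric_exp_le {ε : ℝ} (hε : 0 < ε) {h : ℝ≥0} (hh : 0 < h) :
    (h : ℝ≥0∞) * ∑' n : ℕ, ENNReal.ofReal (Real.exp (-ε * h)) ^ n ≤ ENNReal.ofReal (1 / ε + h) := by
  have hh' : (0 : ℝ) < h := hh
  have h3 : Real.exp (-ε * h) < 1 := Real.exp_lt_one_iff.2 (by nlinarith)
  rw [ENNReal.tsum_geometric, ← ENNReal.ofReal_one, ← ENNReal.ofReal_sub _ (Real.exp_pos _).le,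
    ← ENNReal.ofReal_inv_of_pos (by linarith), ← ENNReal.ofReal_coe_nnreal,
    ← ENNReal.ofReal_mul hh'.le]
  exact ENNReal.ofReal_le_ofReal (mul_inv_one_sub_exp_le hε hh')

namespace IsBirthDeathProcess

theorem measure_eq_ofReal (hX : IsBirthDeathProcess l m Pr X) (i j : ℤ) (t : ℝ≥0) :
    (Pr i) {ω | X t ω = j} = ENNReal.ofReal (transProb Pr X i j t) := by
  have := hX.isProb i
  rw [transProb, ofReal_measureReal]

/-- Exponential decay bounds the Laplace transform of `P i i` by `1 / ε` uniformly in `θ`, so `E (1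
- exp (-θ T))` stays bounded below as `θ → 0`. For an almost surely finite `T` it would tend to zero
by dominated convergence. -/
theorem measure_return_lt_one (hX : IsBirthDeathProcess l m Pr X) (i : ℤ) (hq : 0 < l i + m i)
    {ε : ℝ} (hε : 0 < ε) (hP : ∀ t, transProb Pr X i i t ≤ Real.exp (-ε * t)) :
    (Pr i) {ω | returnTime X i ω < ⊤} < 1 := by
  have := hX.isProb i
  have hmeas : ∀ θ, Measurable fun ω => oneSubExp θ (returnTime X i ω) := by
    intro θ
    have h1 := hX.measurable_returnTime i
    simp only [oneSubExp]
    refine Measurable.ite (h1 (measurableSet_singleton ⊤)) measurable_const ?_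
    fun_prop
  have hle : ∀ n : ℕ, ENNReal.ofReal (1 / ((1 / ((n : ℝ) + 1) + (l i + m i)) * (1 / ε))) ≤
      ∫⁻ ω, oneSubExp (1 / ((n : ℝ) + 1)) (returnTime X i ω) ∂(Pr i) := by
    intro n
    refine hX.le_lintegral_oneSubExp (c := 1) i (by positivity) (by positivity) zero_le_one hq ?_
    intro h hh
    have hh' : (0 : ℝ) < h := hh
    rw [one_mul]
    refine le_trans ?_ (mul_tsum_geometric_exp_le hε hh)
    gcongr with k
    rw [hX.measure_eq_ofReal]
    refine (mul_le_mul' ?_ ?_).trans_eq (mul_one _)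
    · rw [← ENNReal.ofReal_pow (Real.exp_pos _).le, ← Real.exp_nat_mul]
      refine ENNReal.ofReal_le_ofReal ((hP _).trans_eq ?_)
      push_cast; ring_nf
    · refine pow_le_one' ?_ k
      rw [← ENNReal.ofReal_one]
      refine ENNReal.ofReal_le_ofReal (Real.exp_le_one_iff.2 ?_)
      have : 0 < 1 / ((n : ℝ) + 1) := by positivity
      nlinarith
  refine lt_of_le_of_ne prob_le_one fun hone => ?_
  have hfin : ∀ᵐ ω ∂(Pr i), returnTime X i ω < ⊤ :=
    ae_iff.2 ((prob_compl_eq_zero_iff (hX.measurable_returnTime i measurableSet_Iio)).2 hone)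
  have hlim : Filter.Tendsto (fun n : ℕ => ∫⁻ ω, oneSubExp (1 / ((n : ℝ) + 1))
      (returnTime X i ω) ∂(Pr i)) Filter.atTop (nhds (∫⁻ _, 0 ∂(Pr i))) := by
    refine tendsto_lintegral_of_dominated_convergence 1 (fun n => hmeas _)
      (fun n => Filter.Eventually.of_forall fun ω => oneSubExp_le_one _) (by simp) ?_
    filter_upwards [hfin] with ω hω
    simp only [oneSubExp, if_neg hω.ne]
    have h1 : Filter.Tendsto (fun n : ℕ => 1 - Real.exp (-(1 / ((n : ℝ) + 1)) *
        (returnTime X i ω).toReal)) Filter.atTop (nhds (1 - Real.exp (-0 *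
          (returnTime X i ω).toReal))) := by
      have h2 : Continuous fun x : ℝ => 1 - Real.exp (-x * (returnTime X i ω).toReal) := by
        fun_prop
      exact (h2.tendsto 0).comp tendsto_one_div_add_atTop_nhds_zero_nat
    have h3 := ENNReal.tendsto_ofReal h1
    simpa using h3
  have hlim2 : Filter.Tendsto (fun n : ℕ => ENNReal.ofReal (1 / ((1 / ((n : ℝ) + 1) +
      (l i + m i)) * (1 / ε)))) Filter.atTop
        (nhds (ENNReal.ofReal (1 / ((0 + (l i + m i)) * (1 / ε))))) := by
    refine ENNReal.tendsto_ofReal (tendsto_const_nhds.div ?_ (by positivity))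
    exact (tendsto_one_div_add_atTop_nhds_zero_nat.add_const _).mul_const _
  have hcon := le_of_tendsto_of_tendsto' hlim2 hlim hle
  rw [lintegral_zero, nonpos_iff_eq_zero, ENNReal.ofReal_eq_zero] at hcon
  have : 0 < 1 / ((0 + (l i + m i)) * (1 / ε)) := by positivity
  linarith

/-- A finite mean `v` would give `E (1 - exp (-θ T)) ≤ θ * v`. Splitting time at `t₀` bounds the
Laplace transform of `P i i` by `t₀ + η / θ`, so the lower bound becomes `1 ≤ v * (θ + q) * (θ * t₀
+ η)`, which fails for small `η` and then small `θ`. -/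
theorem lintegral_returnTime_eq_top (hX : IsBirthDeathProcess l m Pr X) (i : ℤ)
    (hq : 0 < l i + m i)
    (hP : ∀ η > 0, ∃ t₀ : ℝ≥0, ∀ t ≥ t₀, transProb Pr X i i t ≤ η) :
    ∫⁻ ω, returnTime X i ω ∂(Pr i) = ⊤ := by
  have := hX.isProb i
  by_contra hne
  set v := (∫⁻ ω, returnTime X i ω ∂(Pr i)).toReal with hv
  have hv0 : 0 ≤ v := ENNReal.toReal_nonneg
  set q := l i + m i with hqdef
  have key : ∀ (η θ : ℝ) (t₀ : ℝ≥0), 0 < η → 0 < θ →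
      (∀ t ≥ t₀, transProb Pr X i i t ≤ η) → 1 / ((θ + q) * (t₀ + η / θ)) ≤ θ * v := by
    intro η θ t₀ hη hθ ht₀
    have h1 : ENNReal.ofReal (1 / ((θ + q) * (t₀ + η / θ))) ≤
        ∫⁻ ω, oneSubExp θ (returnTime X i ω) ∂(Pr i) := by
      refine hX.le_lintegral_oneSubExp (c := 1 + η) i hθ (by positivity) (by positivity) hq ?_
      intro h hh
      have hh' : (0 : ℝ) < h := hh
      set s := ENNReal.ofReal (Real.exp (-θ * h)) with hs
      have hs1 : s ≤ 1 := by
        rw [← ENNReal.ofReal_one]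
        exact ENNReal.ofReal_le_ofReal (Real.exp_le_one_iff.2 (by nlinarith))
      set K := ⌈t₀ / h⌉₊ with hK
      have hKh : (K : ℝ) * h ≤ t₀ + h := by
        have := Nat.ceil_lt_add_one (zero_le : 0 ≤ t₀ / h)
        have h5 := mul_lt_mul_of_pos_right this hh
        rw [add_mul, div_mul_cancel₀ _ hh.ne', one_mul] at h5
        exact_mod_cast h5.le
      have hterm : ∀ n : ℕ, (Pr i) {ω | X ((n : ℝ≥0) * h) ω = i} * s ^ n ≤
          (if n < K then 1 else 0) + ENNReal.ofReal η * s ^ n := by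
        intro n
        split_ifs with hn
        · refine le_add_right ?_
          exact mul_le_one' prob_le_one (pow_le_one' hs1 n)
        · rw [zero_add, hX.measure_eq_ofReal]
          gcongr
          refine ht₀ _ ?_
          have : t₀ / h ≤ n := (Nat.le_ceil _).trans (by exact_mod_cast not_lt.1 hn)
          rwa [div_le_iff₀ hh] at this
      have hsumK : ∑' n : ℕ, (if n < K then (1 : ℝ≥0∞) else 0) = K := by
        rw [tsum_eq_sum (s := Finset.range K)]
        · rw [Finset.sum_congr rfl fun n hn => if_pos (Finset.mem_range.1 hn)]
          simp
        · intro n hn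
          rw [if_neg (by simpa using hn)]
      calc (h : ℝ≥0∞) * ∑' n : ℕ, (Pr i) {ω | X ((n : ℝ≥0) * h) ω = i} * s ^ n
          ≤ h * ∑' n : ℕ, ((if n < K then 1 else 0) + ENNReal.ofReal η * s ^ n) := by
            gcongr with n; exact hterm n
        _ = K * h + ENNReal.ofReal η * (h * ∑' n : ℕ, s ^ n) := by
            rw [ENNReal.tsum_add, hsumK, ENNReal.tsum_mul_left]; ring
        _ ≤ ENNReal.ofReal (t₀ + h) + ENNReal.ofReal η * ENNReal.ofReal (1 / θ + h) := by
            gcongr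
            · rw [← ENNReal.ofReal_coe_nnreal (p := h), ← ENNReal.ofReal_natCast,
                ← ENNReal.ofReal_mul (by positivity)]
              exact ENNReal.ofReal_le_ofReal hKh
            · exact mul_tsum_geometric_exp_le hθ hh
        _ = ENNReal.ofReal (t₀ + η / θ + (1 + η) * h) := by
            rw [← ENNReal.ofReal_mul hη.le, ← ENNReal.ofReal_add (by positivity) (by positivity)]
            congr 1; ring
    have h2 : ∫⁻ ω, oneSubExp θ (returnTime X i ω) ∂(Pr i) ≤ ENNReal.ofReal (θ * v) := by
      rw [ENNReal.ofReal_mul hθ.le, hv, ENNReal.ofReal_toReal hne,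
        ← lintegral_const_mul _ (hX.measurable_returnTime i)]
      exact lintegral_mono fun ω => oneSubExp_le_mul hθ _
    exact (ENNReal.ofReal_le_ofReal_iff (by positivity)).1 (h1.trans h2)
  -- Chosen so that, once `θ ≤ 1` and `θ * t₀ ≤ η`, the product `v * (θ + q) * (θ * t₀ + η)` is at
  -- most `v / (2 * (v + 1)) < 1`.
  set η := 1 / (4 * (1 + q) * (v + 1)) with hη
  have hη0 : 0 < η := by positivity
  obtain ⟨t₀, ht₀⟩ := hP η hη0
  set θ := min 1 (η / (t₀ + 1)) with hθ
  have hθ0 : 0 < θ := by positivity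
  have hθ1 : θ ≤ 1 := min_le_left _ _
  have hθ2 : θ * t₀ ≤ η := by
    have h1 : θ ≤ η / (t₀ + 1) := min_le_right _ _
    rw [le_div_iff₀ (by positivity)] at h1
    nlinarith
  have h1 := key η θ t₀ hη0 hθ0 ht₀
  have h2 : (t₀ : ℝ) + η / θ = (θ * t₀ + η) / θ := by field_simp
  rw [h2, div_le_iff₀ (by positivity)] at h1
  have h3 : θ * v * ((θ + q) * ((θ * t₀ + η) / θ)) = v * ((θ + q) * (θ * t₀ + η)) := by
    field_simp
  rw [h3] at h1
  have h4 : v * ((θ + q) * (θ * t₀ + η)) ≤ v * ((1 + q) * (2 * η)) := by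
    gcongr; linarith
  have h5 : v * ((1 + q) * (2 * η)) = v / (2 * (v + 1)) := by
    rw [hη]; field_simp; norm_num
  have h6 : v / (2 * (v + 1)) < 1 := by
    rw [div_lt_one (by positivity)]; linarith
  linarith

theorem measure_inter_noVisit_le (hX : IsBirthDeathProcess l m Pr X) (i : ℤ) (n N : ℕ) :
    (Pr i) ({ω | X (n : ℝ≥0) ω = i} ∩ noVisit X i 1 n N) ≤ taboo Pr X i 1 N i := by
  have := hX.isProb i
  have h1 := hX.measure_inter_noVisit i i 1 N n i Set.univ MeasurableSet.univ
  rw [Set.univ_inter] at h1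
  rw [h1]
  exact mul_le_of_le_one_left' prob_le_one

theorem taboo_eq (hX : IsBirthDeathProcess l m Pr X) (i : ℤ) (h : ℝ≥0) (N : ℕ) :
    taboo Pr X i h N i = (Pr i) ({ω | X 0 ω = i} ∩ noVisit X i h 0 N) := by
  have h1 := hX.measure_inter_noVisit i i h N 0 i Set.univ MeasurableSet.univ
  rw [Set.univ_inter] at h1
  rw [h1, hX.measure_eq_ofReal, hX.transProb_zero]
  simp

/-- Infinitely many expected visits at integer times force the taboo probabilities to zero, so
almost surely no integer time is the last visit to `i`. A path without return either has such a last
visit or stays in `i` at all integer times, and the latter is a null event because `P i i` tends to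
zero. -/
theorem measure_return_eq_one (hX : IsBirthDeathProcess l m Pr X) (i : ℤ)
    (hP : ∀ η > 0, ∃ t₀ : ℝ≥0, ∀ t ≥ t₀, transProb Pr X i i t ≤ η)
    (hsum : ∑' n : ℕ, ENNReal.ofReal (transProb Pr X i i n) = ⊤) :
    (Pr i) {ω | returnTime X i ω < ⊤} = 1 := by
  have := hX.isProb i
  -- In the renewal identity every taboo probability is at least the one with the largest number of
  -- steps.
  have htab : ∀ N, taboo Pr X i 1 N i *
      ∑ n ∈ Finset.range (N + 1), ENNReal.ofReal (transProb Pr X i i n) ≤ 1 := by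
    intro N
    rw [← hX.sum_renewal i 1 N, Finset.Nat.sum_antidiagonal_eq_sum_range_succ
      (fun a b => (Pr i) {ω | X ((a : ℝ≥0) * 1) ω = i} * taboo Pr X i 1 b i), Finset.mul_sum]
    refine Finset.sum_le_sum fun n hn => ?_
    rw [mul_comm, mul_one, hX.measure_eq_ofReal]
    gcongr
    rw [hX.taboo_eq, hX.taboo_eq]
    refine measure_mono (Set.inter_subset_inter_right _ fun ω hω k hk => hω k ?_)
    omega
  have hlim : Filter.Tendsto (fun N => taboo Pr X i 1 N i) Filter.atTop (nhds 0) := by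
    have h1 : Filter.Tendsto (fun N => (∑ n ∈ Finset.range (N + 1),
        ENNReal.ofReal (transProb Pr X i i n))⁻¹) Filter.atTop (nhds 0) := by
      rw [← ENNReal.inv_top, ← hsum]
      exact (ENNReal.tendsto_nat_tsum _).comp (Filter.tendsto_add_atTop_nat 1) |>.inv
    refine tendsto_of_tendsto_of_tendsto_of_le_of_le tendsto_const_nhds h1 (fun _ => zero_le)
      fun N => ?_
    exact ENNReal.le_inv_iff_mul_le.2 (htab N)
  have hlast : ∀ n : ℕ, (Pr i) ({ω | X (n : ℝ≥0) ω = i} ∩ ⋂ N, noVisit X i 1 n N) = 0 := by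
    intro n
    refine le_antisymm (ge_of_tendsto' hlim fun N => ?_) zero_le
    refine (measure_mono ?_).trans (hX.measure_inter_noVisit_le i n N)
    exact Set.inter_subset_inter_right _ (Set.iInter_subset _ N)
  have hall : (Pr i) {ω | ∀ n : ℕ, X (n : ℝ≥0) ω = i} = 0 := by
    refine le_antisymm (ENNReal.le_of_forall_pos_le_add fun η hη _ => ?_) zero_le
    obtain ⟨t₀, ht₀⟩ := hP η (by exact_mod_cast hη)
    obtain ⟨n, hn⟩ := exists_nat_ge t₀
    rw [zero_add]
    calc (Pr i) {ω | ∀ n : ℕ, X (n : ℝ≥0) ω = i} ≤ (Pr i) {ω | X (n : ℝ≥0) ω = i} :=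
          measure_mono fun ω hω => hω n
      _ ≤ η := by
          rw [hX.measure_eq_ofReal, ← ENNReal.ofReal_coe_nnreal]
          exact ENNReal.ofReal_le_ofReal (ht₀ n hn)
  refine (prob_compl_eq_zero_iff (hX.measurable_returnTime i measurableSet_Iio)).1 ?_
  have hnull : (Pr i) ((⋃ n : ℕ, {ω | X (n : ℝ≥0) ω = i} ∩ ⋂ N, noVisit X i 1 n N) ∪
      {ω | ∀ n : ℕ, X (n : ℝ≥0) ω = i}) = 0 :=
    measure_union_null (measure_iUnion_null hlast) hall
  refine le_antisymm (le_trans (measure_mono_ae ?_) hnull.le) zero_le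
  filter_upwards [hX.start i] with ω hω hT
  have hT' : returnTime X i ω = ⊤ := not_lt_top_iff.1 hT
  have hno : ∀ s t : ℝ≥0, s < t → X s ω ≠ i → X t ω ≠ i := by
    intro s t hst hs ht
    have : returnTime X i ω ≤ t := iInf₂_le t ⟨ht, s, hst, hs⟩
    rw [hT', top_le_iff] at this
    exact ENNReal.coe_ne_top this
  by_cases hex : ∀ n : ℕ, X (n : ℝ≥0) ω = i
  · exact Or.inr hex
  · left
    push Not at hex
    classical
    have hk := Nat.find_spec hex
    set k := Nat.find hex with hkdef
    -- The first integer time outside `i` is not `0`, so its predecessor is an integer visit,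
    -- necessarily the last one if the path never returns.
    have hk0 : k ≠ 0 := by
      intro h0
      rw [h0] at hk
      exact hk (by simpa using hω)
    have hk1 : X ((k - 1 : ℕ) : ℝ≥0) ω = i := not_not.1 (Nat.find_min hex (m := k - 1) (by omega))
    refine Set.mem_iUnion.2 ⟨k - 1, hk1, Set.mem_iInter.2 fun N j _ => ?_⟩
    have e : ((k - 1 : ℕ) : ℝ≥0) + ((j : ℝ≥0) + 1) * 1 = ((k + j : ℕ) : ℝ≥0) := by
      have : k - 1 + (j + 1) = k + j := by omega
      rw [mul_one]; exact_mod_cast this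
    rw [e]
    rcases Nat.eq_zero_or_pos j with h0 | h0
    · rw [h0]; exact hk
    · exact hno k _ (by exact_mod_cast (by omega : k < k + j)) hk

/-- A jump with positive rate has a transition probability with nonzero derivative at `0`, which
therefore cannot vanish identically; Chapman-Kolmogorov chains such jumps. -/
theorem exists_transProb_pos (hX : IsBirthDeathProcess l m Pr X) (hl : ∀ i, 0 < l i)
    (hm : ∀ i, 0 < m i) (i j : ℤ) : ∃ t, 0 < transProb Pr X i j t := by
  have htrans : ∀ i j k, (∃ t, 0 < transProb Pr X i j t) → (∃ t, 0 < transProb Pr X j k t) →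
      ∃ t, 0 < transProb Pr X i k t := by
    rintro i j k ⟨s, hs⟩ ⟨t, ht⟩
    exact ⟨s + t, (mul_pos hs ht).trans_le (hX.mul_transProb_le i k j s t)⟩
  have hstep : ∀ i j, i ≠ j → 0 < generator l m i j → ∃ t, 0 < transProb Pr X i j t := by
    intro i j hij hg
    by_contra hcon
    push Not at hcon
    have h0 : (fun h : ℝ => transProb Pr X i j h.toNNReal) = fun _ => 0 :=
      funext fun h => le_antisymm (hcon _) (transProb_nonneg _ _ _)
    have h1 := hX.rates i j
    rw [h0] at h1
    have h2 := (uniqueDiffWithinAt_Ici (0 : ℝ)).eq_deriv _ h1 (hasDerivWithinAt_const 0 _ _)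
    linarith
  have hup : ∀ i, ∃ t, 0 < transProb Pr X i (i + 1) t := fun i =>
    hstep _ _ (by omega) (by simpa [generator] using hl i)
  have hdown : ∀ i, ∃ t, 0 < transProb Pr X i (i - 1) t := fun i =>
    hstep _ _ (by omega) (by rw [generator, if_neg (by omega), if_pos rfl]; exact hm i)
  induction j using Int.inductionOn' (b := i) with
  | zero => exact ⟨0, by simp [hX.transProb_zero]⟩
  | succ k _ ih => exact htrans _ _ _ ih (hup k)
  | pred k _ ih => exact htrans _ _ _ ih (hdown k)

/-- Comparison through the path `i → j → j → i`: the fixed times `s` and `t` need not be integers,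
and monotonicity of `P i i` absorbs them. -/
theorem tsum_transProb_eq_top (hX : IsBirthDeathProcess l m Pr X) (hl : ∀ i, 0 < l i)
    (hm : ∀ i, 0 < m i) (i j : ℤ) (hanti : Antitone (transProb Pr X i i))
    (hsum : ∑' n : ℕ, ENNReal.ofReal (transProb Pr X j j n) = ⊤) :
    ∑' n : ℕ, ENNReal.ofReal (transProb Pr X i i n) = ⊤ := by
  obtain ⟨s, hs⟩ := hX.exists_transProb_pos hl hm i j
  obtain ⟨t, ht⟩ := hX.exists_transProb_pos hl hm j i
  have hle : ∀ n : ℕ, ENNReal.ofReal (transProb Pr X i j s * transProb Pr X j i t) *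
      ENNReal.ofReal (transProb Pr X j j n) ≤ ENNReal.ofReal (transProb Pr X i i n) := by
    intro n
    rw [← ENNReal.ofReal_mul (by positivity)]
    refine ENNReal.ofReal_le_ofReal ?_
    have h1 := hX.mul_transProb_le i j j s n
    have h2 := hX.mul_transProb_le i i j (s + n) t
    have h3 : transProb Pr X i i (s + n + t) ≤ transProb Pr X i i n :=
      hanti (by rw [add_comm s]; exact le_add_right (le_add_right le_rfl))
    nlinarith
  rw [eq_top_iff]
  calc (⊤ : ℝ≥0∞) = ENNReal.ofReal (transProb Pr X i j s * transProb Pr X j i t) *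
        ∑' n : ℕ, ENNReal.ofReal (transProb Pr X j j n) := by
        rw [hsum, ENNReal.mul_top]
        simpa using mul_pos hs ht
    _ ≤ _ := by
        rw [← ENNReal.tsum_mul_left]
        exact ENNReal.tsum_le_tsum hle

end IsBirthDeathProcess

end returns

/-! ### The polynomials in terms of Chebyshev polynomials -/

theorem rpow_natCast_div_two {x : ℝ} (hx : 0 ≤ x) (n : ℕ) : x ^ ((n : ℝ) / 2) = √x ^ n := by
  rw [Real.sqrt_eq_rpow, ← Real.rpow_natCast, ← Real.rpow_mul hx]
  congr 1; ring

theorem sqrt_div_mul_sqrt_mul {l m : ℝ} (hl : 0 < l) (hm : 0 < m) : √(m / l) * √(l * m) = m := by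
  rw [← Real.sqrt_mul (by positivity), show m / l * (l * m) = m ^ 2 by field_simp,
    Real.sqrt_sq hm.le]

/-- A solution of the three-term recurrence with constant coefficients is a rescaled solution of
the Chebyshev recurrence. -/
theorem eq_pow_mul_of_recurrence {l m x : ℝ} (hl : 0 < l) (hm : 0 < m) {g f : ℕ → ℝ}
    (hg : ∀ n, g (n + 2) = l⁻¹ * ((l + m - x) * g (n + 1) - m * g n))
    (hf : ∀ n, f (n + 2) = 2 * yVar l m x * f (n + 1) - f n)
    (h0 : g 0 = f 0) (h1 : g 1 = √(m / l) * f 1) (n : ℕ) : g n = √(m / l) ^ n * f n := by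
  have key : ∀ n, g n = √(m / l) ^ n * f n ∧ g (n + 1) = √(m / l) ^ (n + 1) * f (n + 1) := by
    intro n
    induction n with
    | zero => exact ⟨by simpa using h0, by simpa using h1⟩
    | succ n ih =>
      refine ⟨ih.2, ?_⟩
      rw [show n + 1 + 1 = n + 2 from rfl, hg, hf, ih.1, ih.2]
      have hs : √(m / l) ^ 2 = m / l := Real.sq_sqrt (by positivity)
      have hr := sqrt_div_mul_sqrt_mul hl hm
      have hlm : √(l * m) ≠ 0 := (Real.sqrt_pos.2 (by positivity)).ne'
      have hy : 2 * yVar l m x * √(l * m) = l + m - x := by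
        rw [yVar]; field_simp
      rw [← hy]
      set ρ := √(m / l)
      have e1 : ρ ^ (n + 2) = ρ ^ n * (m / l) := by rw [pow_add, hs]
      have e2 : l⁻¹ * (2 * yVar l m x * √(l * m) * (ρ ^ (n + 1) * f (n + 1)) - m * (ρ ^ n * f n)) =
        l⁻¹ * (2 * yVar l m x * (ρ * √(l * m)) * ρ ^ n * f (n + 1) - m * (ρ ^ n * f n)) := by ring
      rw [e2, e1, hr]
      field_simp
  exact (key n).1

variable {l m l0 m0 : ℝ}

theorem eval_polyUp (a b : ℝ[X]) (x : ℝ) (n : ℕ) :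
    (polyUp (defectRate l l0) (defectRate m m0) a b (n + 2)).eval x =
      l⁻¹ * ((l + m - x) * (polyUp (defectRate l l0) (defectRate m m0) a b (n + 1)).eval x -
        m * (polyUp (defectRate l l0) (defectRate m m0) a b n).eval x) := by
  have h : ((n : ℤ) + 1) ≠ 0 := by omega
  simp [polyUp, defectRate, h]

theorem eval_polyDown (a b : ℝ[X]) (x : ℝ) (n : ℕ) :
    (polyDown (defectRate l l0) (defectRate m m0) a b (n + 2)).eval x =
      m⁻¹ * ((m + l - x) * (polyDown (defectRate l l0) (defectRate m m0) a b (n + 1)).eval x -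
        l * (polyDown (defectRate l l0) (defectRate m m0) a b n).eval x) := by
  have h : (-(n : ℤ) - 2) ≠ 0 := by omega
  simp [polyDown, defectRate, h, add_comm l m]

theorem chebyshevU_eval_step (y : ℝ) (n : ℤ) : (Chebyshev.U ℝ (n + 2)).eval y =
    2 * y * (Chebyshev.U ℝ (n + 1)).eval y - (Chebyshev.U ℝ n).eval y := by
  rw [Chebyshev.U_add_two]; simp

theorem chebyshevT_eval_step (y : ℝ) (n : ℤ) : (Chebyshev.T ℝ (n + 2)).eval y =
    2 * y * (Chebyshev.T ℝ (n + 1)).eval y - (Chebyshev.T ℝ n).eval y := by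
  rw [Chebyshev.T_add_two]; simp

theorem chebyshevU_eval_pred_step (y : ℝ) (n : ℕ) :
    (Chebyshev.U ℝ (((n + 2 : ℕ) : ℤ) - 1)).eval y =
      2 * y * (Chebyshev.U ℝ (((n + 1 : ℕ) : ℤ) - 1)).eval y -
        (Chebyshev.U ℝ ((n : ℤ) - 1)).eval y := by
  rw [show ((n + 2 : ℕ) : ℤ) - 1 = ((n : ℤ) - 1) + 2 by push_cast; ring, chebyshevU_eval_step,
    show ((n + 1 : ℕ) : ℤ) - 1 = ((n : ℤ) - 1) + 1 by push_cast; ring]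

theorem yVar_comm (l m x : ℝ) : yVar m l x = yVar l m x := by
  rw [yVar, yVar, add_comm, mul_comm m l]

/-- Only the step from `0` to `1` uses the rates at the defect; all other steps have constant
coefficients. Going down exchanges `l` and `m`, which leaves `yVar` unchanged. So each formula
reduces to its first two values. -/
theorem Q_eq_chebyshev (hl : 0 < l) (hm : 0 < m) (hl0 : 0 < l0) (n : ℕ) (x : ℝ) :
    (Q (defectRate l l0) (defectRate m m0) 0 n).eval x = (m / l) ^ ((n : ℝ) / 2) *
      (2 * (l0 - l) / l0 * (Chebyshev.T ℝ n).eval (yVar l m x) +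
        (2 * l - l0) / l0 * (Chebyshev.U ℝ n).eval (yVar l m x) +
        √(l / m) * ((l0 + m0 - l - m) / l0) * (Chebyshev.U ℝ (n - 1)).eval (yVar l m x)) ∧
    (Q (defectRate l l0) (defectRate m m0) 0 (-n - 1)).eval x =
      -(l / m) ^ (((n : ℝ) + 1) / 2) * (Chebyshev.U ℝ (n - 1)).eval (yVar l m x) ∧
    (Q (defectRate l l0) (defectRate m m0) 1 n).eval x =
      -(m0 / l0) * (m / l) ^ (((n : ℝ) - 1) / 2) *
        (Chebyshev.U ℝ (n - 1)).eval (yVar l m x) ∧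
    (Q (defectRate l l0) (defectRate m m0) 1 (-n - 1)).eval x =
      (l / m) ^ ((n : ℝ) / 2) * (Chebyshev.U ℝ n).eval (yVar l m x) := by
  have hneg : (-(n : ℤ) - 1) = Int.negSucc n := by omega
  have hτρ : √(l / m) * √(m / l) = 1 := by
    rw [← Real.sqrt_mul (by positivity), show l / m * (m / l) = 1 by field_simp, Real.sqrt_one]
  have hρ : √(m / l) ≠ 0 := right_ne_zero_of_mul_eq_one hτρ
  have hτ : √(l / m) ≠ 0 := left_ne_zero_of_mul_eq_one hτρ
  have hlm : √(l * m) ≠ 0 := (Real.sqrt_pos.2 (by positivity)).ne'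
  have hy : 2 * yVar l m x * √(l * m) = l + m - x := by rw [yVar]; field_simp
  have hr := sqrt_div_mul_sqrt_mul hl hm
  have hr' := sqrt_div_mul_sqrt_mul hm hl
  rw [mul_comm m l] at hr'
  have hlρ : l * √(m / l) = √(l * m) := by
    rw [← mul_right_inj' hρ, hr, mul_left_comm, ← sq, Real.sq_sqrt (by positivity)]; field_simp
  have hmτ : m * √(l / m) = √(l * m) := by
    rw [← mul_right_inj' hτ, hr', mul_left_comm, ← sq, Real.sq_sqrt (by positivity)]; field_simp
  have hp1 : (m / l) ^ (((n : ℝ) - 1) / 2) = √(m / l) ^ n * √(l / m) := by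
    rw [sub_div, Real.rpow_sub (by positivity), rpow_natCast_div_two (by positivity),
      ← Real.sqrt_eq_rpow, div_eq_iff hρ, mul_assoc, hτρ, mul_one]
  have hp2 : (l / m) ^ (((n : ℝ) + 1) / 2) = √(l / m) ^ (n + 1) := by
    rw [← rpow_natCast_div_two (by positivity)]; push_cast; rfl
  rw [rpow_natCast_div_two (by positivity), rpow_natCast_div_two (by positivity), hp1, hp2, hneg]
  refine ⟨?_, ?_, ?_, ?_⟩
  · refine eq_pow_mul_of_recurrence hl hm
      (g := fun n => (polyUp (defectRate l l0) (defectRate m m0) 1 0 n).eval x)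
      (f := fun n => 2 * (l0 - l) / l0 * (Chebyshev.T ℝ n).eval (yVar l m x) +
        (2 * l - l0) / l0 * (Chebyshev.U ℝ n).eval (yVar l m x) +
        √(l / m) * ((l0 + m0 - l - m) / l0) * (Chebyshev.U ℝ (n - 1)).eval (yVar l m x))
      (eval_polyUp 1 0 x) (fun n => ?_) ?_ ?_ n
    · rw [chebyshevU_eval_pred_step]
      push_cast
      rw [chebyshevT_eval_step, chebyshevU_eval_step]
      ring
    · simp [polyUp]
      field_simp
      ring
    · simp [polyUp, defectRate]
      have e : √(m / l) * ((2 * (l0 - l) / l0 * yVar l m x + (2 * l - l0) / l0 * (2 * yVar l m x) +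
          √(l / m) * ((l0 + m0 - l - m) / l0))) = (l * √(m / l) * (2 * yVar l m x)) / l0 +
          √(l / m) * √(m / l) * ((l0 + m0 - l - m) / l0) := by
        field_simp; ring
      rw [e, hτρ, hlρ, mul_comm (√(l * m)), hy]
      field_simp; ring
  · have := eq_pow_mul_of_recurrence hm hl
      (g := fun n => (polyDown (defectRate l l0) (defectRate m m0) 1 0 n).eval x)
      (f := fun n => -√(l / m) * (Chebyshev.U ℝ (n - 1)).eval (yVar l m x))
      (eval_polyDown 1 0 x) (fun n => ?_) ?_ ?_ n
    · change (polyDown (defectRate l l0) (defectRate m m0) 1 0 n).eval x = _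
      rw [this]; ring
    · rw [chebyshevU_eval_pred_step, yVar_comm l m]; ring
    · simp [polyDown]
    · simp [polyDown, defectRate]
      rw [← sq, Real.sq_sqrt (by positivity)]
      field_simp
  · have := eq_pow_mul_of_recurrence hl hm
      (g := fun n => (polyUp (defectRate l l0) (defectRate m m0) 0 1 n).eval x)
      (f := fun n => -(m0 / l0) * √(l / m) * (Chebyshev.U ℝ (n - 1)).eval (yVar l m x))
      (eval_polyUp 0 1 x) (fun n => ?_) ?_ ?_ n
    · change (polyUp (defectRate l l0) (defectRate m m0) 0 1 n).eval x = _
      rw [this]; ring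
    · rw [chebyshevU_eval_pred_step]; ring
    · simp [polyUp]
    · simp [polyUp, defectRate]
      have e : √(m / l) * (m0 / l0 * √(l / m)) = √(l / m) * √(m / l) * (m0 / l0) := by ring
      rw [e, hτρ]
      field_simp
  · refine eq_pow_mul_of_recurrence hm hl
      (g := fun n => (polyDown (defectRate l l0) (defectRate m m0) 0 1 n).eval x)
      (f := fun n => (Chebyshev.U ℝ n).eval (yVar l m x))
      (eval_polyDown 0 1 x) (fun n => ?_) ?_ ?_ n
    · push_cast
      rw [chebyshevU_eval_step, yVar_comm l m]
    · simp [polyDown]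
    · simp [polyDown, defectRate]
      rw [← hy, ← hmτ]
      field_simp

/-! ### The Stieltjes transform of the semicircle law -/

-- The generating function of the Chebyshev polynomials of the second kind in trigonometric form: a
-- difference of geometric series with ratios `ζ * exp (±i θ)`.
open Complex in
theorem hasSum_pow_mul_sin {ζ : ℂ} (hζ : ‖ζ‖ < 1) (θ : ℝ) :
    HasSum (fun n : ℕ => ζ ^ n * (Real.sin ((n + 1) * θ) : ℂ))
      (Real.sin θ / (1 - 2 * ζ * Real.cos θ + ζ ^ 2)) := by
  have hn : ∀ s : ℝ, ‖cexp (s * I)‖ = 1 := fun s => Complex.norm_exp_ofReal_mul_I s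
  set e := cexp (θ * I) with he
  set e' := cexp ((-θ : ℝ) * I) with he'
  have hee : e * e' = 1 := by rw [he, he', ← Complex.exp_add]; simp
  have h1 : ‖ζ * e‖ < 1 := by rw [norm_mul, hn, mul_one]; exact hζ
  have h2 : ‖ζ * e'‖ < 1 := by rw [norm_mul, hn, mul_one]; exact hζ
  have d1 : 1 - ζ * e ≠ 0 := fun h => by
    rw [← sub_eq_zero.1 h, norm_one] at h1; exact lt_irrefl _ h1
  have d2 : 1 - ζ * e' ≠ 0 := fun h => by
    rw [← sub_eq_zero.1 h, norm_one] at h2; exact lt_irrefl _ h2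
  have hs := (((hasSum_geometric_of_norm_lt_one h1).mul_left e).sub
    ((hasSum_geometric_of_norm_lt_one h2).mul_left e')).div_const (2 * I)
  have hcos : (Real.cos θ : ℂ) = (e + e') / 2 := by
    rw [Complex.ofReal_cos, Complex.cos, he, he']; push_cast; ring_nf
  have hsin : ∀ n : ℕ, (Real.sin ((n + 1) * θ) : ℂ) = (e ^ (n + 1) - e' ^ (n + 1)) / (2 * I) := by
    intro n
    rw [Complex.ofReal_sin, Complex.sin, he, he', ← Complex.exp_nat_mul, ← Complex.exp_nat_mul,
      eq_div_iff (by simp)]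
    have hI : I * I = -1 := I_mul_I
    push_cast
    calc _ = (cexp (-((n + 1) * θ) * I) - cexp ((n + 1) * θ * I)) * (I * I) := by ring
      _ = _ := by rw [hI]; ring_nf
  have hval : (e * (1 - ζ * e)⁻¹ - e' * (1 - ζ * e')⁻¹) / (2 * I) =
      Real.sin θ / (1 - 2 * ζ * Real.cos θ + ζ ^ 2) := by
    have h0 := hsin 0
    simp only [Nat.cast_zero, zero_add, one_mul, pow_one] at h0
    have hden : 1 - 2 * ζ * Real.cos θ + ζ ^ 2 = (1 - ζ * e) * (1 - ζ * e') := by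
      rw [hcos]; linear_combination (-ζ ^ 2) * hee
    have hab : ∀ A B : ℂ, A ≠ 0 → B ≠ 0 → e * A⁻¹ - e' * B⁻¹ = (e * B - e' * A) / (A * B) := by
      intro A B hA hB
      field_simp
    rw [h0, hden, hab _ _ d1 d2, div_div, div_div]
    congr 1 <;> ring
  rw [hval] at hs
  refine hs.congr_fun fun n => ?_
  rw [hsin, mul_pow, mul_pow]
  ring

theorem integral_sin_mul_sin (n : ℕ) :
    ∫ θ in Set.Ioo 0 Real.pi, Real.sin ((n + 1) * θ) * Real.sin θ =
      if n = 0 then Real.pi / 2 else 0 := by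
  have hcos : ∀ k : ℕ, k ≠ 0 → ∫ θ in (0 : ℝ)..Real.pi, Real.cos (k * θ) = 0 := by
    intro k hk
    have hk' : (k : ℝ) ≠ 0 := by exact_mod_cast hk
    rw [intervalIntegral.integral_comp_mul_left (fun x => Real.cos x) hk', integral_cos]
    simp [Real.sin_nat_mul_pi]
  have hsum : ∀ θ : ℝ, Real.sin ((n + 1) * θ) * Real.sin θ =
      (Real.cos (n * θ) - Real.cos ((n + 2 : ℕ) * θ)) / 2 := by
    intro θ
    have h1 : (n : ℝ) * θ = (n + 1) * θ - θ := by ring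
    have h2 : ((n + 2 : ℕ) : ℝ) * θ = (n + 1) * θ + θ := by push_cast; ring
    rw [h1, h2, Real.cos_sub, Real.cos_add]; ring
  rw [← integral_Ioc_eq_integral_Ioo, ← intervalIntegral.integral_of_le Real.pi_pos.le]
  simp_rw [hsum]
  rw [intervalIntegral.integral_div, intervalIntegral.integral_sub, hcos (n + 2) (by omega)]
  · split_ifs with h
    · simp [h]
    · rw [hcos n h]; simp
  · exact Continuous.intervalIntegrable (by fun_prop) _ _
  · exact Continuous.intervalIntegrable (by fun_prop) _ _

/-- The kernel is expanded in powers of `ζ` and integrated termwise; orthogonality of the sines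
leaves only the term `n = 0`. -/
theorem integral_sin_sq_div_of_norm_lt {ζ : ℂ} (hζ : ‖ζ‖ < 1) :
    IntegrableOn (fun θ : ℝ => (Real.sin θ : ℂ) ^ 2 / (1 - 2 * ζ * Real.cos θ + ζ ^ 2))
      (Set.Ioo 0 Real.pi) ∧
    ∫ θ in Set.Ioo 0 Real.pi, (Real.sin θ : ℂ) ^ 2 / (1 - 2 * ζ * Real.cos θ + ζ ^ 2) =
      (Real.pi : ℂ) / 2 := by
  let F : ℕ → ℝ → ℂ := fun n θ => ζ ^ n * ((Real.sin ((n + 1) * θ) * Real.sin θ : ℝ) : ℂ)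
  have hF : ∀ θ : ℝ, HasSum (fun n => F n θ)
      ((Real.sin θ : ℂ) ^ 2 / (1 - 2 * ζ * Real.cos θ + ζ ^ 2)) := by
    intro θ
    have h := (hasSum_pow_mul_sin hζ θ).mul_right (Real.sin θ : ℂ)
    rw [div_mul_eq_mul_div, ← sq] at h
    refine h.congr_fun fun n => ?_
    simp only [F]; push_cast; ring
  have hFn : ∀ n θ, ‖F n θ‖ ≤ ‖ζ‖ ^ n := by
    intro n θ
    simp only [F]
    rw [norm_mul, norm_pow, Complex.norm_real, norm_mul]
    refine mul_le_of_le_one_right (by positivity) (mul_le_one₀ ?_ (norm_nonneg _) ?_)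
    · exact Real.abs_sin_le_one _
    · exact Real.abs_sin_le_one _
  have hFc : ∀ n, Continuous (F n) := fun n => by fun_prop
  have hFi : ∀ n, IntegrableOn (F n) (Set.Ioo 0 Real.pi) := fun n =>
    ((hFc n).integrableOn_Icc (a := 0) (b := Real.pi)).mono_set Set.Ioo_subset_Icc_self
  have hgeo := hasSum_geometric_of_norm_lt_one (K := ℝ) (ξ := ‖ζ‖) (by simpa using hζ)
  constructor
  · refine Measure.integrableOn_of_bounded (M := (1 - ‖ζ‖)⁻¹) (by simp) ?_ ?_
    · exact (by fun_prop : Measurable _).aestronglyMeasurable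
    · refine Filter.Eventually.of_forall fun θ => ?_
      rw [← (hF θ).tsum_eq]
      exact tsum_of_norm_bounded hgeo fun n => hFn n θ
  · have hsum := hasSum_integral_of_summable_integral_norm (μ := volume.restrict (Set.Ioo 0 Real.pi))
      hFi ?_
    · simp_rw [(hF _).tsum_eq] at hsum
      have hterm : ∀ n, ∫ θ in Set.Ioo 0 Real.pi, F n θ =
          if n = 0 then (Real.pi / 2 : ℂ) else 0 := by
        intro n
        simp only [F]
        rw [integral_const_mul, integral_complex_ofReal, integral_sin_mul_sin]
        split_ifs with h
        · rw [h]; simp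
        · simp
      simp_rw [hterm] at hsum
      exact hsum.unique (hasSum_ite_eq 0 _)
    · refine Summable.of_nonneg_of_le (fun n => integral_nonneg fun _ => norm_nonneg _)
        (fun n => ?_) (hgeo.summable.mul_left Real.pi)
      calc ∫ θ in Set.Ioo 0 Real.pi, ‖F n θ‖ ≤ ∫ θ in Set.Ioo 0 Real.pi, ‖ζ‖ ^ n :=
            integral_mono (hFi n).norm (by simp) fun θ => hFn n θ
        _ = Real.pi * ‖ζ‖ ^ n := by
            simp [Real.pi_pos.le]

/-- The values `ζ = ±1` are needed because a root of `D` may sit at an edge of the continuous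
spectrum. There `sin θ ^ 2` cancels the denominator and the integrand is `(1 + ζ * cos θ) / 2`. -/
theorem integral_sin_sq_div {ζ : ℂ} (hζ : ‖ζ‖ < 1 ∨ ζ = 1 ∨ ζ = -1) :
    IntegrableOn (fun θ : ℝ => (Real.sin θ : ℂ) ^ 2 / (1 - 2 * ζ * Real.cos θ + ζ ^ 2))
      (Set.Ioo 0 Real.pi) ∧
    ∫ θ in Set.Ioo 0 Real.pi, (Real.sin θ : ℂ) ^ 2 / (1 - 2 * ζ * Real.cos θ + ζ ^ 2) =
      (Real.pi : ℂ) / 2 := by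
  have key : ∀ σ : ℝ, σ ^ 2 = 1 →
    IntegrableOn (fun θ : ℝ => (Real.sin θ : ℂ) ^ 2 / (1 - 2 * (σ : ℂ) * Real.cos θ + (σ : ℂ) ^ 2))
      (Set.Ioo 0 Real.pi) ∧
    ∫ θ in Set.Ioo 0 Real.pi, (Real.sin θ : ℂ) ^ 2 /
      (1 - 2 * (σ : ℂ) * Real.cos θ + (σ : ℂ) ^ 2) = (Real.pi : ℂ) / 2 := by
    intro σ hσ
    have hcongr : Set.EqOn (fun θ : ℝ => (Real.sin θ : ℂ) ^ 2 /
        (1 - 2 * (σ : ℂ) * Real.cos θ + (σ : ℂ) ^ 2))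
        (fun θ => (((1 + σ * Real.cos θ) / 2 : ℝ) : ℂ)) (Set.Ioo 0 Real.pi) := by
      intro θ hθ
      have hs : 0 < Real.sin θ := Real.sin_pos_of_pos_of_lt_pi hθ.1 hθ.2
      have hsc := Real.sin_sq_add_cos_sq θ
      have hne : 1 - 2 * σ * Real.cos θ + σ ^ 2 ≠ 0 := by
        intro h
        have h1 : σ * Real.cos θ = 1 := by rw [hσ] at h; linarith
        have h2 : (σ * Real.cos θ) ^ 2 = 1 := by rw [h1]; norm_num
        rw [mul_pow, hσ, one_mul] at h2
        nlinarith
      have : Real.sin θ ^ 2 / (1 - 2 * σ * Real.cos θ + σ ^ 2) = (1 + σ * Real.cos θ) / 2 := by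
        rw [div_eq_iff hne]
        linear_combination hsc + (-1 / 2 - σ * Real.cos θ / 2 + Real.cos θ ^ 2) * hσ
      simp only
      rw [← this]; push_cast; rfl
    constructor
    · refine IntegrableOn.congr_fun ?_ hcongr.symm measurableSet_Ioo
      exact (Continuous.integrableOn_Icc (by fun_prop)).mono_set Set.Ioo_subset_Icc_self
    · rw [setIntegral_congr_fun measurableSet_Ioo hcongr, integral_complex_ofReal,
        ← integral_Ioc_eq_integral_Ioo, ← intervalIntegral.integral_of_le Real.pi_pos.le,
        intervalIntegral.integral_div, intervalIntegral.integral_add,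
        intervalIntegral.integral_const_mul, integral_cos]
      · simp
      · exact Continuous.intervalIntegrable (by fun_prop) _ _
      · exact Continuous.intervalIntegrable (by fun_prop) _ _
  rcases hζ with h | h | h
  · exact integral_sin_sq_div_of_norm_lt h
  · rw [h]; simpa using key 1 (by norm_num)
  · rw [h]; simpa using key (-1) (by norm_num)

/-! ### Semicircle integrals by trigonometric substitution. -/

section substitution

variable {a b : ℝ} {E : Type*} [NormedAddCommGroup E] [NormedSpace ℝ E]

theorem image_cos_Ioo (hab : a < b) :
    (fun θ => (a + b) / 2 - (b - a) / 2 * Real.cos θ) '' Set.Ioo 0 Real.pi = Set.Ioo a b := by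
  have hd : 0 < (b - a) / 2 := by linarith
  ext x
  constructor
  · rintro ⟨θ, hθ, rfl⟩
    have h1 : Real.cos θ < 1 := by
      have := Real.cos_lt_cos_of_nonneg_of_le_pi le_rfl hθ.2.le hθ.1
      simpa using this
    have h2 : -1 < Real.cos θ := by
      have := Real.cos_lt_cos_of_nonneg_of_le_pi hθ.1.le le_rfl hθ.2
      simpa using this
    constructor <;> simp only <;> nlinarith
  · intro hx
    refine ⟨Real.arccos (((a + b) / 2 - x) / ((b - a) / 2)), ⟨?_, ?_⟩, ?_⟩
    · rw [Real.arccos_pos, div_lt_one hd]; linarith [hx.1]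
    · refine lt_of_le_of_ne (Real.arccos_le_pi _) fun h => ?_
      rw [Real.arccos_eq_pi, div_le_iff₀ hd] at h
      linarith [hx.2]
    · simp only
      rw [Real.cos_arccos, mul_div_cancel₀ _ hd.ne']
      · ring
      · rw [le_div_iff₀ hd]; linarith [hx.2]
      · rw [div_le_one hd]; linarith [hx.1]

theorem injOn_cos_Ioo (hab : a < b) :
    Set.InjOn (fun θ => (a + b) / 2 - (b - a) / 2 * Real.cos θ) (Set.Ioo 0 Real.pi) := by
  intro x hx y hy hxy
  have hd : (b - a) / 2 ≠ 0 := by linarith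
  have : Real.cos x = Real.cos y := by
    have := sub_right_injective hxy
    exact mul_left_cancel₀ hd this
  exact Real.injOn_cos ⟨hx.1.le, hx.2.le⟩ ⟨hy.1.le, hy.2.le⟩ this

theorem semicircle_cos (hab : a < b) {θ : ℝ} (hθ : θ ∈ Set.Ioo 0 Real.pi) (F : ℝ → E) :
    |(b - a) / 2 * Real.sin θ| • (√(((a + b) / 2 - (b - a) / 2 * Real.cos θ - a) *
      (b - ((a + b) / 2 - (b - a) / 2 * Real.cos θ))) •
        F ((a + b) / 2 - (b - a) / 2 * Real.cos θ)) =
    (((b - a) / 2) ^ 2 * Real.sin θ ^ 2) • F ((a + b) / 2 - (b - a) / 2 * Real.cos θ) := by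
  have hd : 0 < (b - a) / 2 := by linarith
  have hs : 0 < Real.sin θ := Real.sin_pos_of_pos_of_lt_pi hθ.1 hθ.2
  have h1 : ((a + b) / 2 - (b - a) / 2 * Real.cos θ - a) *
      (b - ((a + b) / 2 - (b - a) / 2 * Real.cos θ)) = ((b - a) / 2 * Real.sin θ) ^ 2 := by
    have := Real.sin_sq_add_cos_sq θ
    linear_combination (-((b - a) / 2) ^ 2) * this
  rw [h1, Real.sqrt_sq (by positivity), abs_of_pos (by positivity), smul_smul]
  congr 1; ring

theorem hasDerivWithinAt_cos_subst (θ : ℝ) (s : Set ℝ) :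
    HasDerivWithinAt (fun θ => (a + b) / 2 - (b - a) / 2 * Real.cos θ)
      ((b - a) / 2 * Real.sin θ) s θ := by
  have := ((Real.hasDerivAt_cos θ).const_mul ((b - a) / 2)).const_sub ((a + b) / 2)
  refine (this.congr_deriv ?_).hasDerivWithinAt
  ring

theorem integral_semicircle_eq (hab : a < b) (F : ℝ → E) :
    ∫ x in Set.Ioo a b, √((x - a) * (b - x)) • F x =
      ∫ θ in Set.Ioo 0 Real.pi, (((b - a) / 2) ^ 2 * Real.sin θ ^ 2) •
        F ((a + b) / 2 - (b - a) / 2 * Real.cos θ) := by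
  rw [← image_cos_Ioo hab, integral_image_eq_integral_abs_deriv_smul measurableSet_Ioo
    (fun θ _ => hasDerivWithinAt_cos_subst θ _) (injOn_cos_Ioo hab)]
  exact setIntegral_congr_fun measurableSet_Ioo fun θ hθ => semicircle_cos hab hθ F

theorem integrableOn_semicircle_iff (hab : a < b) (F : ℝ → E) :
    IntegrableOn (fun x => √((x - a) * (b - x)) • F x) (Set.Ioo a b) ↔
      IntegrableOn (fun θ => (((b - a) / 2) ^ 2 * Real.sin θ ^ 2) •
        F ((a + b) / 2 - (b - a) / 2 * Real.cos θ)) (Set.Ioo 0 Real.pi) := by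
  conv_lhs => rw [← image_cos_Ioo hab]
  rw [integrableOn_image_iff_integrableOn_abs_deriv_smul measurableSet_Ioo
    (fun θ _ => hasDerivWithinAt_cos_subst θ _) (injOn_cos_Ioo hab)]
  exact integrableOn_congr_fun (fun θ hθ => semicircle_cos hab hθ F) measurableSet_Ioo

/-- `hw` is the Joukowski parametrisation of `w`. Under the substitution, `x - w` becomes `(b - a) /
(4 * ζ)` times `1 - 2 * ζ * cos θ + ζ ^ 2`, so the integral is the one evaluated above. -/
theorem stieltjes_semicircle (hab : a < b) {w ζ : ℂ} (h0 : ζ ≠ 0)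
    (hζ : ‖ζ‖ < 1 ∨ ζ = 1 ∨ ζ = -1)
    (hw : (a + b) / 2 - w = (b - a) / 4 * (ζ + ζ⁻¹)) :
    IntegrableOn (fun x : ℝ => √((x - a) * (b - x)) • ((x : ℂ) - w)⁻¹) (Set.Ioo a b) ∧
    ∫ x in Set.Ioo a b, √((x - a) * (b - x)) • ((x : ℂ) - w)⁻¹ =
      Real.pi * ((b - a) / 2) * ζ := by
  have hd : ((b : ℂ) - a) ≠ 0 := by exact_mod_cast (sub_pos.2 hab).ne'
  obtain ⟨hi, hv⟩ := integral_sin_sq_div hζ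
  have hcongr : ∀ θ : ℝ, (((b - a) / 2) ^ 2 * Real.sin θ ^ 2) •
      ((((a + b) / 2 - (b - a) / 2 * Real.cos θ : ℝ) : ℂ) - w)⁻¹ =
      ((b - a) * ζ) * ((Real.sin θ : ℂ) ^ 2 / (1 - 2 * ζ * Real.cos θ + ζ ^ 2)) := by
    intro θ
    have h1 : (((a + b) / 2 - (b - a) / 2 * Real.cos θ : ℝ) : ℂ) - w =
        (b - a) / (4 * ζ) * (1 - 2 * ζ * Real.cos θ + ζ ^ 2) := by
      have : (((a + b) / 2 - (b - a) / 2 * Real.cos θ : ℝ) : ℂ) - w =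
          ((a + b) / 2 - w) - (b - a) / 2 * Real.cos θ := by push_cast; ring
      rw [this, hw]
      field_simp
      ring
    rw [h1, mul_inv, Complex.real_smul, inv_div]
    push_cast
    field_simp
    ring
  constructor
  · rw [integrableOn_semicircle_iff hab (fun x : ℝ => ((x : ℂ) - w)⁻¹)]
    simp_rw [hcongr]
    exact hi.const_mul _
  · rw [integral_semicircle_eq hab (fun x : ℝ => ((x : ℂ) - w)⁻¹)]
    simp_rw [hcongr]
    rw [integral_const_mul, hv]
    ring

end substitution

/-! ### The edges of the continuous spectrum and the polynomial `D` -/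

section edges

variable {l m : ℝ}

theorem sigmaMinus_eq (hl : 0 ≤ l) (hm : 0 ≤ m) : sigmaMinus l m = l + m - 2 * √(l * m) := by
  rw [sigmaMinus, sub_sq, Real.sq_sqrt hl, Real.sq_sqrt hm, Real.sqrt_mul hl]; ring

theorem sigmaPlus_eq (hl : 0 ≤ l) (hm : 0 ≤ m) : sigmaPlus l m = l + m + 2 * √(l * m) := by
  rw [sigmaPlus, add_sq, Real.sq_sqrt hl, Real.sq_sqrt hm, Real.sqrt_mul hl]; ring

theorem sigmaMinus_nonneg : 0 ≤ sigmaMinus l m := sq_nonneg _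

theorem sigmaMinus_lt_sigmaPlus (hl : 0 < l) (hm : 0 < m) : sigmaMinus l m < sigmaPlus l m := by
  rw [sigmaMinus_eq hl.le hm.le, sigmaPlus_eq hl.le hm.le]
  have : 0 < √(l * m) := Real.sqrt_pos.2 (by positivity)
  linarith

theorem sigma_add (hl : 0 ≤ l) (hm : 0 ≤ m) : sigmaMinus l m + sigmaPlus l m = 2 * (l + m) := by
  rw [sigmaMinus_eq hl hm, sigmaPlus_eq hl hm]; ring

theorem sigma_mul (hl : 0 ≤ l) (hm : 0 ≤ m) (x : ℝ) :
    (sigmaMinus l m - x) * (sigmaPlus l m - x) = (l + m - x) ^ 2 - 4 * (l * m) := by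
  rw [sigmaMinus_eq hl hm, sigmaPlus_eq hl hm]
  have := Real.sq_sqrt (mul_nonneg hl hm)
  linear_combination (-4) * this

theorem sigmaMinus_pos (hl : 0 < l) (hm : 0 < m) (h : l ≠ m) : 0 < sigmaMinus l m := by
  refine lt_of_le_of_ne sigmaMinus_nonneg fun h0 => h ?_
  have := pow_eq_zero_iff (two_ne_zero) |>.1 h0.symm
  exact (Real.sqrt_inj hl.le hm.le).1 (sub_eq_zero.1 this)

theorem sigmaMinus_self : sigmaMinus l l = 0 := by simp [sigmaMinus]

/-- The boundary value at a real point outside `(σ₋, σ₊)` of the square root branch. -/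
noncomputable def sqrtReal (l m γ : ℝ) : ℝ :=
  if γ ≤ sigmaMinus l m then √((sigmaMinus l m - γ) * (sigmaPlus l m - γ))
  else -√((sigmaMinus l m - γ) * (sigmaPlus l m - γ))

theorem sqrtReal_nonneg {γ : ℝ} (h : γ ≤ sigmaMinus l m) : 0 ≤ sqrtReal l m γ := by
  rw [sqrtReal, if_pos h]; positivity

theorem sqrtReal_nonpos (hl : 0 < l) (hm : 0 < m) {γ : ℝ} (h : sigmaPlus l m ≤ γ) :
    sqrtReal l m γ ≤ 0 := by
  rw [sqrtReal, if_neg (by linarith [sigmaMinus_lt_sigmaPlus hl hm])]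
  exact neg_nonpos.2 (Real.sqrt_nonneg _)

theorem sqrtReal_sq (hl : 0 < l) (hm : 0 < m) {γ : ℝ}
    (h : γ ≤ sigmaMinus l m ∨ sigmaPlus l m ≤ γ) :
    sqrtReal l m γ ^ 2 = (l + m - γ) ^ 2 - 4 * (l * m) := by
  have hab := sigmaMinus_lt_sigmaPlus hl hm
  have h0 : 0 ≤ (sigmaMinus l m - γ) * (sigmaPlus l m - γ) := by
    rcases h with h | h <;> nlinarith
  rw [← sigma_mul hl.le hm.le, sqrtReal]
  split_ifs
  · exact Real.sq_sqrt h0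
  · rw [neg_sq]; exact Real.sq_sqrt h0

/-- With `A`, `B` the square roots of the distances from `γ` to the nearer and the farther edge, the
Joukowski parameter is `(B - A) / (B + A)` to the left and its negative to the right. It has modulus
one exactly at an edge. -/
theorem semicircle_stieltjes_real (hl : 0 < l) (hm : 0 < m) {γ : ℝ}
    (h : γ ≤ sigmaMinus l m ∨ sigmaPlus l m ≤ γ) :
    IntegrableOn (fun x => √((x - sigmaMinus l m) * (sigmaPlus l m - x)) * (x - γ)⁻¹)
      (Set.Ioo (sigmaMinus l m) (sigmaPlus l m)) ∧
    ∫ x in Set.Ioo (sigmaMinus l m) (sigmaPlus l m),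
      √((x - sigmaMinus l m) * (sigmaPlus l m - x)) * (x - γ)⁻¹ =
        Real.pi * (l + m - γ - sqrtReal l m γ) := by
  have hab := sigmaMinus_lt_sigmaPlus hl hm
  have hsum := sigma_add hl.le hm.le
  set a := sigmaMinus l m with ha
  set b := sigmaPlus l m with hb
  have key : ∀ ζ : ℝ, ζ ≠ 0 → |ζ| ≤ 1 → (a + b) / 2 - γ = (b - a) / 4 * (ζ + ζ⁻¹) →
      (b - a) / 2 * ζ = l + m - γ - sqrtReal l m γ →
      IntegrableOn (fun x => √((x - a) * (b - x)) * (x - γ)⁻¹) (Set.Ioo a b) ∧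
      ∫ x in Set.Ioo a b, √((x - a) * (b - x)) * (x - γ)⁻¹ =
        Real.pi * (l + m - γ - sqrtReal l m γ) := by
    intro ζ h0 h1 h2 h3
    have h4 := stieltjes_semicircle hab (w := (γ : ℂ)) (ζ := (ζ : ℂ)) (by exact_mod_cast h0) ?_
      (by exact_mod_cast congrArg (fun x : ℝ => (x : ℂ)) h2)
    · have hcast : ∀ x : ℝ, √((x - a) * (b - x)) • ((x : ℂ) - γ)⁻¹ =
          ((√((x - a) * (b - x)) * (x - γ)⁻¹ : ℝ) : ℂ) := by
        intro x; rw [Complex.real_smul]; push_cast; rfl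
      simp_rw [hcast] at h4
      refine ⟨?_, ?_⟩
      · exact h4.1.re
      · have h5 := h4.2
        rw [integral_complex_ofReal] at h5
        rw [← h3]
        have h6 : (Real.pi : ℂ) * ((b - a) / 2) * ζ =
            ((Real.pi * ((b - a) / 2 * ζ) : ℝ) : ℂ) := by push_cast; ring
        rw [h6] at h5
        exact_mod_cast h5
    · rcases h1.lt_or_eq with h | h
      · left; rw [Complex.norm_real]; exact h
      · right
        rcases (abs_eq zero_le_one).1 h with h | h
        · left; rw [h]; simp
        · right; rw [h]; simp
  rcases h with h | h
  · have hA : √(a - γ) ^ 2 = a - γ := Real.sq_sqrt (by linarith)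
    have hB : √(b - γ) ^ 2 = b - γ := Real.sq_sqrt (by linarith)
    have hAB : √(a - γ) < √(b - γ) := Real.sqrt_lt_sqrt (by linarith) (by linarith)
    have hA0 : 0 ≤ √(a - γ) := Real.sqrt_nonneg _
    have hs : sqrtReal l m γ = √(a - γ) * √(b - γ) := by
      rw [sqrtReal, if_pos h, Real.sqrt_mul (by linarith)]
    set A := √(a - γ)
    set B := √(b - γ)
    have e1 : b - a = (B - A) * (B + A) := by linear_combination -hB + hA
    refine key ((B - A) / (B + A)) ?_ ?_ ?_ ?_
    · exact (div_pos (by linarith) (by linarith)).ne'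
    · rw [abs_of_nonneg (div_nonneg (by linarith) (by linarith)), div_le_one (by linarith)]
      linarith
    · have n1 : B - A ≠ 0 := by linarith
      have n2 : B + A ≠ 0 := by linarith
      rw [e1, inv_div]
      field_simp
      linear_combination -4 * hA - 4 * hB
    · have n2 : B + A ≠ 0 := by linarith
      rw [e1, hs]
      field_simp
      linear_combination hA + hB + hsum
  · have hA : √(γ - b) ^ 2 = γ - b := Real.sq_sqrt (by linarith)
    have hB : √(γ - a) ^ 2 = γ - a := Real.sq_sqrt (by linarith)
    have hAB : √(γ - b) < √(γ - a) := Real.sqrt_lt_sqrt (by linarith) (by linarith)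
    have hA0 : 0 ≤ √(γ - b) := Real.sqrt_nonneg _
    have hs : sqrtReal l m γ = -(√(γ - b) * √(γ - a)) := by
      rw [sqrtReal, if_neg (by linarith), ← Real.sqrt_mul (by linarith)]
      congr 2; ring
    set A := √(γ - b)
    set B := √(γ - a)
    have e1 : b - a = (B - A) * (B + A) := by linear_combination -hB + hA
    refine key (-((B - A) / (B + A))) ?_ ?_ ?_ ?_
    · exact neg_ne_zero.2 (div_pos (by linarith) (by linarith)).ne'
    · rw [abs_neg, abs_of_nonneg (div_nonneg (by linarith) (by linarith)),
        div_le_one (by linarith)]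
      linarith
    · have n1 : B - A ≠ 0 := by linarith
      have n2 : B + A ≠ 0 := by linarith
      rw [e1, inv_neg, inv_div]
      field_simp
      linear_combination 4 * hA + 4 * hB
    · have n2 : B + A ≠ 0 := by linarith
      rw [e1, hs]
      field_simp
      linear_combination -hA - hB + hsum

/-- The principal square root halves the argument, which then lies strictly between `-π / 2` and `π
/ 2`. -/
theorem cpow_half_re_pos {z : ℂ} (hz : z ∈ Complex.slitPlane) : 0 < (z ^ (1 / 2 : ℂ)).re := by
  have h0 : z ≠ 0 := Complex.slitPlane_ne_zero hz
  have h1 : (Complex.log z * (1 / 2 : ℂ)).im = Complex.arg z / 2 := by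
    rw [show (1 / 2 : ℂ) = ((1 / 2 : ℝ) : ℂ) by push_cast; rfl, Complex.im_mul_ofReal,
      Complex.log_im]; ring
  rw [Complex.cpow_def_of_ne_zero h0, Complex.exp_re, h1]
  refine mul_pos (Real.exp_pos _) (Real.cos_pos_of_mem_Ioo ⟨?_, ?_⟩)
  · have := Complex.neg_pi_lt_arg z; linarith
  · have := (Complex.arg_le_pi z).lt_of_ne (Complex.mem_slitPlane_iff_arg.1 hz).1
    linarith

/-- With `A`, `B` the square roots of `σ₋ - z` and `σ₊ - z`, the Joukowski parameter is `(B - A) /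
(B + A)`. It has modulus less than one because `A` and `B` have positive real parts and imaginary
parts of the same sign. -/
theorem semicircle_stieltjes (hl : 0 < l) (hm : 0 < m) {z : ℂ} (hz : ¬ (0 ≤ z.re ∧ z.im = 0)) :
    IntegrableOn (fun x : ℝ => √((x - sigmaMinus l m) * (sigmaPlus l m - x)) • ((x : ℂ) - z)⁻¹)
      (Set.Ioo (sigmaMinus l m) (sigmaPlus l m)) ∧
    ∫ x in Set.Ioo (sigmaMinus l m) (sigmaPlus l m),
      √((x - sigmaMinus l m) * (sigmaPlus l m - x)) • ((x : ℂ) - z)⁻¹ =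
        Real.pi * (l + m - z - sqrtBranch l m z) := by
  have hab := sigmaMinus_lt_sigmaPlus hl hm
  have hsum : (sigmaMinus l m : ℂ) + sigmaPlus l m = 2 * (l + m) := by
    exact_mod_cast congrArg (fun x : ℝ => (x : ℂ)) (sigma_add hl.le hm.le)
  have ha0 : 0 ≤ sigmaMinus l m := sigmaMinus_nonneg
  have hsq : ∀ w : ℂ, (w ^ (1 / 2 : ℂ)) ^ 2 = w := fun w => by
    rw [one_div]; exact Complex.cpow_nat_inv_pow w two_ne_zero
  have hslit : ∀ c : ℝ, 0 ≤ c → (c : ℂ) - z ∈ Complex.slitPlane := by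
    intro c hc
    rw [Complex.mem_slitPlane_iff]
    by_contra hcon
    push Not at hcon
    simp only [Complex.sub_re, Complex.ofReal_re, Complex.sub_im, Complex.ofReal_im, zero_sub,
      neg_eq_zero] at hcon
    exact hz ⟨by linarith [hcon.1], hcon.2⟩
  have hA := hsq ((sigmaMinus l m : ℂ) - z)
  have hB := hsq ((sigmaPlus l m : ℂ) - z)
  have hAre := cpow_half_re_pos (hslit _ ha0)
  have hBre := cpow_half_re_pos (hslit _ (ha0.trans hab.le))
  rw [sqrtBranch]
  set a := sigmaMinus l m
  set b := sigmaPlus l m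
  set A := ((a : ℂ) - z) ^ (1 / 2 : ℂ)
  set B := ((b : ℂ) - z) ^ (1 / 2 : ℂ)
  have e1 : (b : ℂ) - a = (B - A) * (B + A) := by linear_combination -hB + hA
  have hba : (b : ℂ) - a ≠ 0 := by exact_mod_cast (sub_pos.2 hab).ne'
  have n1 : B - A ≠ 0 := fun h => hba (by rw [e1, h, zero_mul])
  have n2 : B + A ≠ 0 := fun h => hba (by rw [e1, h, mul_zero])
  -- `A ^ 2` and `B ^ 2` differ by a real number, so their imaginary parts agree; this is what fixes
  -- the sign of `A.im * B.im`.
  have him : A.re * A.im = B.re * B.im := by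
    have h1 := congrArg Complex.im hA
    have h2 := congrArg Complex.im hB
    simp only [sq, Complex.mul_im, Complex.sub_im, Complex.ofReal_im] at h1 h2
    linarith
  have himim : 0 ≤ A.im * B.im := by
    have : 0 ≤ (A.re * B.re) * (A.im * B.im) := by
      have e : (A.re * B.re) * (A.im * B.im) = (B.re * B.im) ^ 2 := by
        rw [sq]; nth_rewrite 1 [← him]; ring
      rw [e]; positivity
    exact nonneg_of_mul_nonneg_right this (mul_pos hAre hBre)
  have hnorm : ‖B - A‖ < ‖B + A‖ := by
    refine lt_of_pow_lt_pow_left₀ 2 (norm_nonneg _) ?_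
    rw [← Complex.normSq_eq_norm_sq, ← Complex.normSq_eq_norm_sq, Complex.normSq_apply,
      Complex.normSq_apply]
    simp only [Complex.sub_re, Complex.sub_im, Complex.add_re, Complex.add_im]
    nlinarith [mul_pos hAre hBre]
  have h4 := stieltjes_semicircle hab (w := z) (ζ := (B - A) / (B + A)) (div_ne_zero n1 n2)
    (Or.inl (by rw [norm_div, div_lt_one (norm_pos_iff.2 n2)]; exact hnorm)) ?_
  · refine ⟨h4.1, h4.2.trans ?_⟩
    rw [e1]
    field_simp
    linear_combination hA + hB + hsum
  · rw [e1, inv_div]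
    field_simp
    linear_combination -4 * hA - 4 * hB

end edges

/-! ### Polynomial identities linking `D`, `p11` and `numer`. -/

section algebra

variable {l m l0 m0 : ℝ}

/-- The polynomial matrix `-q`, the common factor of the entries of the spectral matrix. -/
noncomputable def numer (l m l0 m0 x : ℝ) : Matrix (Fin 2) (Fin 2) ℝ :=
  !![l0 * m + l * m0, l * (l0 + m0 - x); l * (l0 + m0 - x), -q22 l m l0 m0 x]

/-- This identity governs the sign and the roots of `D`: a negative discriminant forces `D > 0`, and
at a root `p11` is plus or minus `l0 * m + l * m0` times the square root. -/
theorem p11_sq (x : ℝ) : p11 l m l0 m0 x ^ 2 =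
    (l0 * m + l * m0) ^ 2 * ((l + m - x) ^ 2 - 4 * (l * m)) + 2 * l * m * D l m l0 m0 x := by
  simp only [p11, D]; ring

/-- Hence `numer` is positive semidefinite wherever `D ≥ 0`, and has rank one at the atoms. -/
theorem numer_det (hm0 : m0 ≠ 0) (x : ℝ) :
    (l0 * m + l * m0) * (-q22 l m l0 m0 x) - (l * (l0 + m0 - x)) ^ 2 =
      l0 / (2 * m0) * D l m l0 m0 x := by
  simp only [q22, D]; field_simp; ring

theorem D_pos (hl : 0 < l) (hm : 0 < m) (hl0 : 0 < l0) (hm0 : 0 < m0) {x : ℝ}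
    (hx : x ∈ Set.Ioo (sigmaMinus l m) (sigmaPlus l m)) : 0 < D l m l0 m0 x := by
  have h1 : (l + m - x) ^ 2 - 4 * (l * m) < 0 := by
    rw [← sigma_mul hl.le hm.le]; nlinarith [hx.1, hx.2]
  have h2 := p11_sq (l := l) (m := m) (l0 := l0) (m0 := m0) x
  have h3 : 0 < (l0 * m + l * m0) ^ 2 := by positivity
  have h4 : 0 < 2 * l * m * D l m l0 m0 x := by nlinarith [sq_nonneg (p11 l m l0 m0 x)]
  exact pos_of_mul_pos_right h4 (by positivity)

theorem eq_of_D_zero (hl0 : 0 < l0) (hm0 : 0 < m0) (h : D l m l0 m0 0 = 0) : l = m := by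
  simp only [D] at h
  have h1 : l0 * m0 * (l - m) ^ 2 = 0 := by linarith
  have h2 : (l - m) ^ 2 = 0 := (mul_eq_zero.1 h1).resolve_left (by positivity)
  exact sub_eq_zero.1 (pow_eq_zero_iff two_ne_zero |>.1 h2)

end algebra

/-! ### The roots of `D` and the weights -/

section roots

variable {l m l0 m0 : ℝ}

theorem R_pos (hl0 : 0 < l0) (hm0 : 0 < m0) : 0 < R l m l0 m0 := by
  have := sq_nonneg (l0 - m0 - l + m)
  unfold R; positivity

theorem two_kappa_mul_gam (hκ : kappa l m l0 m0 ≠ 0) (ε : ℝ) :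
    2 * kappa l m l0 m0 * gam ε l m l0 m0 =
      (l0 * m + m0 * l) * (l0 + m0) + (l0 * m - m0 * l) * (m - l)
        + ε * ((l0 * m + m0 * l) * √(R l m l0 m0)) :=
  mul_div_cancel₀ _ (mul_ne_zero two_ne_zero hκ)

theorem kappa_mul_gam_add (hκ : kappa l m l0 m0 ≠ 0) :
    kappa l m l0 m0 * (gam 1 l m l0 m0 + gam (-1) l m l0 m0) =
      (l0 * m + m0 * l) * (l0 + m0) + (l0 * m - m0 * l) * (m - l) := by
  linear_combination (two_kappa_mul_gam hκ 1 + two_kappa_mul_gam hκ (-1)) / 2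

theorem kappa_mul_gam_sub (hκ : kappa l m l0 m0 ≠ 0) :
    kappa l m l0 m0 * (gam 1 l m l0 m0 - gam (-1) l m l0 m0) =
      (l0 * m + m0 * l) * √(R l m l0 m0) := by
  linear_combination (two_kappa_mul_gam hκ 1 - two_kappa_mul_gam hκ (-1)) / 2

theorem kappa_mul_gam_mul (hκ : kappa l m l0 m0 ≠ 0) (hl0 : 0 < l0) (hm0 : 0 < m0) :
    kappa l m l0 m0 * (gam 1 l m l0 m0 * gam (-1) l m l0 m0) = l0 * m0 * (l - m) ^ 2 := by
  have h1 := kappa_mul_gam_add hκ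
  have h2 := kappa_mul_gam_sub hκ
  have hr := Real.sq_sqrt (R_pos (l := l) (m := m) hl0 hm0).le
  refine mul_left_cancel₀ (mul_ne_zero four_ne_zero hκ) ?_
  have e : 4 * kappa l m l0 m0 * (kappa l m l0 m0 * (gam 1 l m l0 m0 * gam (-1) l m l0 m0)) =
      (kappa l m l0 m0 * (gam 1 l m l0 m0 + gam (-1) l m l0 m0)) ^ 2 -
      (kappa l m l0 m0 * (gam 1 l m l0 m0 - gam (-1) l m l0 m0)) ^ 2 := by ring
  rw [e, h1, h2, mul_pow, hr, R, kappa]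
  ring

theorem D_eq_complex (hκ : kappa l m l0 m0 ≠ 0) (hl0 : 0 < l0) (hm0 : 0 < m0) (z : ℂ) :
    D (l : ℂ) m l0 m0 z =
      -2 * kappa l m l0 m0 * (z - gam 1 l m l0 m0) * (z - gam (-1) l m l0 m0) := by
  have h1 := congrArg (fun x : ℝ => (x : ℂ)) (kappa_mul_gam_add hκ)
  have h2 := congrArg (fun x : ℝ => (x : ℂ)) (kappa_mul_gam_mul hκ hl0 hm0)
  have h3 : (kappa l m l0 m0 : ℂ) = l0 * m + m0 * l - l * m := by
    rw [kappa]; push_cast; ring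
  push_cast at h1 h2
  have e : D (l : ℂ) m l0 m0 z = -2 * (kappa l m l0 m0 : ℂ) * z ^ 2 +
      2 * ((l0 * m + m0 * l) * (l0 + m0) + (l0 * m - m0 * l) * (m - l)) * z -
      2 * (l0 * m0 * (l - m) ^ 2) := by
    rw [D, h3]; ring
  rw [e]
  linear_combination -2 * z * h1 + 2 * h2

theorem D_eq (hκ : kappa l m l0 m0 ≠ 0) (hl0 : 0 < l0) (hm0 : 0 < m0) (x : ℝ) :
    D l m l0 m0 x =
      -2 * kappa l m l0 m0 * (x - gam 1 l m l0 m0) * (x - gam (-1) l m l0 m0) := by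
  have := D_eq_complex hκ hl0 hm0 (x : ℂ)
  have e : D (l : ℂ) m l0 m0 x = ((D l m l0 m0 x : ℝ) : ℂ) := by simp only [D]; push_cast; ring
  rw [e] at this
  exact_mod_cast this

theorem D_eq_zero_iff (hκ : kappa l m l0 m0 ≠ 0) (hl0 : 0 < l0) (hm0 : 0 < m0) (z : ℂ) :
    D (l : ℂ) m l0 m0 z = 0 ↔ z = gam 1 l m l0 m0 ∨ z = gam (-1) l m l0 m0 := by
  have : (kappa l m l0 m0 : ℂ) ≠ 0 := by exact_mod_cast hκ
  rw [D_eq_complex hκ hl0 hm0, mul_eq_zero, mul_eq_zero, sub_eq_zero, sub_eq_zero]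
  simp [this]

theorem D_gam (hκ : kappa l m l0 m0 ≠ 0) (hl0 : 0 < l0) (hm0 : 0 < m0) :
    D l m l0 m0 (gam 1 l m l0 m0) = 0 ∧ D l m l0 m0 (gam (-1) l m l0 m0) = 0 := by
  rw [D_eq hκ hl0 hm0, D_eq hκ hl0 hm0]; simp

section weights

variable {ε : ℝ}

theorem sqrt_R_div (hl0 : 0 < l0) (hm0 : 0 < m0) :
    √(R l m l0 m0) * (√(R l m l0 m0) / R l m l0 m0) = 1 := by
  have h := R_pos (l := l) (m := m) hl0 hm0
  rw [← mul_div_assoc, Real.mul_self_sqrt h.le, div_self h.ne']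

/-- The sign of the weight `A₁₁` is read off from the sign of `p11` at the root, and hence from the
branch of the square root on which the root lies. -/
theorem p11_gam (hκ : kappa l m l0 m0 ≠ 0) (hε : ε ^ 2 = 1) (hl0 : 0 < l0) (hm0 : 0 < m0) :
    p11 l m l0 m0 (gam ε l m l0 m0) =
      ε * (l0 * m + l * m0) * √(R l m l0 m0) * weight (-ε) l m l0 m0 0 0 := by
  have hγ := two_kappa_mul_gam hκ ε
  have hu := sqrt_R_div (l := l) (m := m) hl0 hm0
  have hA : 2 * kappa l m l0 m0 * weight (-ε) l m l0 m0 0 0 = l0 * m + m0 * l - 2 * l * m +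
      -ε * ((l0 * m + m0 * l) * (l + m - l0 - m0) * (√(R l m l0 m0) / R l m l0 m0)) := by
    simp [weight]; field_simp
  set u := √(R l m l0 m0) / R l m l0 m0
  set r := √(R l m l0 m0)
  refine mul_left_cancel₀ (mul_ne_zero two_ne_zero hκ) ?_
  have e1 : 2 * kappa l m l0 m0 * p11 l m l0 m0 (gam ε l m l0 m0) =
      (l0 * m + m0 * l - 2 * l * m) * (2 * kappa l m l0 m0 * gam ε l m l0 m0) +
        2 * kappa l m l0 m0 * ((l - m) * (l0 * m - m0 * l)) := by rw [p11]; ring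
  have e2 : 2 * kappa l m l0 m0 * (ε * (l0 * m + l * m0) * r * weight (-ε) l m l0 m0 0 0) =
      ε * (l0 * m + l * m0) * r * (2 * kappa l m l0 m0 * weight (-ε) l m l0 m0 0 0) := by ring
  rw [e1, e2, hA, hγ, kappa]
  linear_combination (l0 * m + l * m0) ^ 2 * (l + m - l0 - m0) * (hε + ε ^ 2 * hu)

/-- The weight matrix is the rank-one matrix `numer` at the root, scaled by `A₁₁ / (l0 * m + l *
m0)`. So only this one scalar mass has to be found for each atom. -/
theorem weight_mul_eq (hκ : kappa l m l0 m0 ≠ 0) (hε : ε ^ 2 = 1) (hl0 : 0 < l0) (hm0 : 0 < m0)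
    (hroot : D l m l0 m0 (gam ε l m l0 m0) = 0) (α β : Fin 2) :
    weight (-ε) l m l0 m0 α β * (l0 * m + l * m0) =
      weight (-ε) l m l0 m0 0 0 * numer l m l0 m0 (gam ε l m l0 m0) α β := by
  have hγ := two_kappa_mul_gam hκ ε
  have hu := sqrt_R_div (l := l) (m := m) hl0 hm0
  have hr := Real.sq_sqrt (R_pos (l := l) (m := m) hl0 hm0).le
  have hA : 2 * kappa l m l0 m0 * weight (-ε) l m l0 m0 0 0 = l0 * m + m0 * l - 2 * l * m +
      -ε * ((l0 * m + m0 * l) * (l + m - l0 - m0) * (√(R l m l0 m0) / R l m l0 m0)) := by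
    simp [weight]; field_simp
  have hA12 : 2 * kappa l m l0 m0 ^ 2 * weight (-ε) l m l0 m0 0 1 =
      l * (l * m * (l + m - l0 - m0) - (-ε) * ((bigC l m l0 m0 - kappa l m l0 m0 *
        (l0 * m + m0 * l - 2 * l * m)) * (√(R l m l0 m0) / R l m l0 m0))) := by
    simp [weight]; field_simp
  have hA22 : 2 * kappa l m l0 m0 ^ 3 * weight (-ε) l m l0 m0 1 1 =
      l ^ 2 * (-bigC l m l0 m0 + (-ε) * ((l + m - l0 - m0) * (bigC l m l0 m0 + 2 * l * m *
        kappa l m l0 m0) * (√(R l m l0 m0) / R l m l0 m0))) := by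
    simp [weight]; field_simp
  -- Writing the square root as `R * u` leaves `u` as the only irrational quantity; with `ε ^ 2 * R
  -- * u ^ 2 = 1` all claims become polynomial once powers of `κ` are cleared.
  have hrR : √(R l m l0 m0) = R l m l0 m0 * (√(R l m l0 m0) / R l m l0 m0) := by
    rw [mul_div_cancel₀ _ (R_pos hl0 hm0).ne']
  set u := √(R l m l0 m0) / R l m l0 m0
  set γ := gam ε l m l0 m0
  rw [hrR] at hγ hu
  have hsu : ε ^ 2 * (R l m l0 m0 * u ^ 2) = 1 := by rw [hε]; linear_combination hu
  have hD : kappa l m l0 m0 * γ ^ 2 = ((l0 * m + m0 * l) * (l0 + m0) +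
      (l0 * m - m0 * l) * (m - l)) * γ - l0 * m0 * (l - m) ^ 2 := by
    rw [D] at hroot; rw [kappa]; linear_combination -hroot / 2
  have h01 : weight (-ε) l m l0 m0 0 1 * (l0 * m + l * m0) =
      weight (-ε) l m l0 m0 0 0 * (l * (l0 + m0 - γ)) := by
    refine mul_left_cancel₀ (mul_ne_zero four_ne_zero (pow_ne_zero 2 hκ)) ?_
    simp only [bigC, R, kappa] at hA hA12 hγ hsu ⊢
    linear_combination 2 * (l0 * m + l * m0) * hA12 -
      l * (2 * (l0 * m + m0 * l - l * m) * (l0 + m0 - γ)) * hA +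
      (l0 * m + m0 * l - 2 * l * m - ε * ((l0 * m + m0 * l) * (l + m - l0 - m0) * u)) * l * hγ -
      l * (l0 * m + l * m0) ^ 2 * (l + m - l0 - m0) * hsu
  have h11 : weight (-ε) l m l0 m0 1 1 * (l0 * m + l * m0) =
      weight (-ε) l m l0 m0 0 0 * (-q22 l m l0 m0 γ) := by
    have hN : m0 * -q22 l m l0 m0 γ = (l - l0) * γ ^ 2
      + (l0 ^ 2 + l0 * m0 - l0 * l + l0 * m - 2 * m0 * l) * γ
      + m0 * (2 * l0 * l - l0 * m + m0 * l) := by rw [q22]; field_simp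
    refine mul_left_cancel₀ (mul_ne_zero (mul_ne_zero four_ne_zero (pow_ne_zero 3 hκ))
      hm0.ne') ?_
    have hN2 : 2 * kappa l m l0 m0 * (kappa l m l0 m0 * (m0 * -q22 l m l0 m0 γ)) =
        ((l - l0) * ((l0 * m + m0 * l) * (l0 + m0) + (l0 * m - m0 * l) * (m - l)) +
          kappa l m l0 m0 * (l0 ^ 2 + l0 * m0 - l0 * l + l0 * m - 2 * m0 * l)) *
        ((l0 * m + m0 * l) * (l0 + m0) + (l0 * m - m0 * l) * (m - l)
        + ε * ((l0 * m + m0 * l) * (R l m l0 m0 * u))) +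
        2 * kappa l m l0 m0 * (kappa l m l0 m0 * (m0 * (2 * l0 * l - l0 * m + m0 * l)) -
          (l - l0) * (l0 * m0 * (l - m) ^ 2)) := by
      rw [hN, ← hγ]
      linear_combination 2 * kappa l m l0 m0 * (l - l0) * hD
    have e1 : 4 * kappa l m l0 m0 ^ 3 * m0 * (weight (-ε) l m l0 m0 1 1 * (l0 * m + l * m0)) =
        2 * m0 * (l0 * m + l * m0) * (2 * kappa l m l0 m0 ^ 3 * weight (-ε) l m l0 m0 1 1) := by
      ring
    have e2 : 4 * kappa l m l0 m0 ^ 3 * m0 * (weight (-ε) l m l0 m0 0 0 * -q22 l m l0 m0 γ) =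
        (2 * kappa l m l0 m0 * weight (-ε) l m l0 m0 0 0) *
        (2 * kappa l m l0 m0 * (kappa l m l0 m0 * (m0 * -q22 l m l0 m0 γ))) := by
      ring
    rw [e1, e2, hN2, hA, hA22]
    simp only [bigC, R, kappa] at hsu ⊢
    linear_combination
      ((l - l0) * ((l0 * m + m0 * l) * (l0 + m0) + (l0 * m - m0 * l) * (m - l)) +
          (l0 * m + m0 * l - l * m) * (l0 ^ 2 + l0 * m0 - l0 * l + l0 * m - 2 * m0 * l)) *
      (l0 * m + l * m0) ^ 2 * (l + m - l0 - m0) * hsu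
  fin_cases α <;> fin_cases β
  · simp [numer]
  · simpa [numer] using h01
  · have : weight (-ε) l m l0 m0 1 0 = weight (-ε) l m l0 m0 0 1 := rfl
    simpa [numer, this] using h01
  · simpa [numer] using h11

end weights

end roots

/-! ### The scalar spectral measure: density and atoms -/

/-- The density of the continuous part of the scalar spectral measure. -/
noncomputable def scalarDensity (l m l0 m0 x : ℝ) : ℝ :=
  √((x - sigmaMinus l m) * (sigmaPlus l m - x)) / (Real.pi * D l m l0 m0 x)

/-- The location and masses of the atoms of the scalar spectral measure. -/
structure IsAtoms (l m l0 m0 γ₁ w₁ γ₂ w₂ : ℝ) : Prop where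
  root₁ : D l m l0 m0 γ₁ = 0
  root₂ : D l m l0 m0 γ₂ = 0
  nonneg₁ : 0 ≤ w₁
  nonneg₂ : 0 ≤ w₂
  pos₁ : w₁ ≠ 0 → 0 < γ₁
  pos₂ : w₂ ≠ 0 → 0 < γ₂
  integrable : IntegrableOn (scalarDensity l m l0 m0) (Set.Ioo (sigmaMinus l m) (sigmaPlus l m))
  mass : (∫ x in Set.Ioo (sigmaMinus l m) (sigmaPlus l m), scalarDensity l m l0 m0 x) + w₁ + w₂ =
    1 / (l0 * m + l * m0)
  mean : (∫ x in Set.Ioo (sigmaMinus l m) (sigmaPlus l m), x * scalarDensity l m l0 m0 x) +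
    w₁ * γ₁ + w₂ * γ₂ = (l0 + m0) / (l0 * m + l * m0)

section

variable {l m l0 m0 : ℝ}

theorem root_le_or_le (hl : 0 < l) (hm : 0 < m) (hl0 : 0 < l0) (hm0 : 0 < m0) {γ : ℝ}
    (h : D l m l0 m0 γ = 0) : γ ≤ sigmaMinus l m ∨ sigmaPlus l m ≤ γ := by
  by_contra! hcon
  exact (D_pos hl hm hl0 hm0 ⟨hcon.1, hcon.2⟩).ne' h

theorem p11_root (hl : 0 < l) (hm : 0 < m) (hl0 : 0 < l0) (hm0 : 0 < m0) {γ : ℝ}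
    (h : D l m l0 m0 γ = 0) :
    p11 l m l0 m0 γ = (l0 * m + l * m0) * sqrtReal l m γ ∨
      p11 l m l0 m0 γ = -((l0 * m + l * m0) * sqrtReal l m γ) := by
  refine sq_eq_sq_iff_eq_or_eq_neg.1 ?_
  rw [p11_sq, h, mul_pow, sqrtReal_sq hl hm (root_le_or_le hl hm hl0 hm0 h)]
  ring

theorem abs_p11_root (hl : 0 < l) (hm : 0 < m) (hl0 : 0 < l0) (hm0 : 0 < m0) {γ : ℝ}
    (h : D l m l0 m0 γ = 0) :
    |p11 l m l0 m0 γ| = (l0 * m + l * m0) * |sqrtReal l m γ| := by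
  have hq : 0 < l0 * m + l * m0 := by positivity
  rcases p11_root hl hm hl0 hm0 h with h | h
  · rw [h, abs_mul, abs_of_pos hq]
  · rw [h, abs_neg, abs_mul, abs_of_pos hq]

/-- A root at the origin forces `l = m`, and then both terms of the residue vanish. This is why no
atom sits at `0`. -/
theorem root_zero (hl0 : 0 < l0) (hm0 : 0 < m0)
    (h : D l m l0 m0 0 = 0) :
    (l0 * m + l * m0) * sqrtReal l m 0 - p11 l m l0 m0 0 = 0 := by
  have := eq_of_D_zero hl0 hm0 h
  subst this
  simp [p11, sqrtReal, sigmaMinus_self]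

theorem integral_semicircle (hl : 0 < l) (hm : 0 < m) :
    IntegrableOn (fun x => √((x - sigmaMinus l m) * (sigmaPlus l m - x)))
      (Set.Ioo (sigmaMinus l m) (sigmaPlus l m)) ∧
    ∫ x in Set.Ioo (sigmaMinus l m) (sigmaPlus l m),
      √((x - sigmaMinus l m) * (sigmaPlus l m - x)) = Real.pi * (2 * l * m) := by
  have hab := sigmaMinus_lt_sigmaPlus hl hm
  constructor
  · refine (Continuous.integrableOn_Icc (by fun_prop)).mono_set Set.Ioo_subset_Icc_self
  · have h1 := integral_semicircle_eq hab (fun _ => (1 : ℝ))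
    simp only [smul_eq_mul, mul_one] at h1
    have h2 := integral_sin_mul_sin 0
    simp only [CharP.cast_eq_zero, zero_add, one_mul, if_true, ← sq] at h2
    rw [h1, integral_const_mul, h2]
    have h3 := sigma_add hl.le hm.le
    have h4 := sigma_mul hl.le hm.le (l := l) (m := m) 0
    simp only [sub_zero] at h4
    have h5 : (sigmaPlus l m - sigmaMinus l m) ^ 2 = 16 * (l * m) := by
      have : (sigmaPlus l m - sigmaMinus l m) ^ 2 = (sigmaMinus l m + sigmaPlus l m) ^ 2 -
        4 * (sigmaMinus l m * sigmaPlus l m) := by ring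
      rw [this, h3, h4]; ring
    linear_combination (Real.pi / 8) * h5

/-- Here `D` is affine and increasing, so its root lies to the left of `(σ₋, σ₊)`. The mass is minus
the residue at the root of `(p11 / q - √) / D`, with `q = l0 * m + l * m0`; mass and mean then
follow from the semicircle integrals. -/
theorem atoms_of_kappa_eq_zero (hl : 0 < l) (hm : 0 < m) (hl0 : 0 < l0) (hm0 : 0 < m0)
    (hκ : kappa l m l0 m0 = 0) : ∃ γ w : ℝ, IsAtoms l m l0 m0 γ w γ 0 := by
  have hab := sigmaMinus_lt_sigmaPlus hl hm
  have hq : 0 < l0 * m + l * m0 := by positivity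
  set d1 := 2 * ((l0 * m + m0 * l) * (l0 + m0) + (l0 * m - m0 * l) * (m - l)) with hd1
  have hD : ∀ x, D l m l0 m0 x = d1 * x - 2 * l0 * m0 * (l - m) ^ 2 := by
    intro x; rw [kappa] at hκ; rw [D, hd1]; linear_combination -2 * x ^ 2 * hκ
  have hd1pos : 0 < d1 := by
    have h1 := D_pos hl hm hl0 hm0 (x := (sigmaMinus l m + sigmaPlus l m) / 2)
      ⟨by linarith, by linarith⟩
    rw [hD] at h1
    have h2 : 0 ≤ 2 * l0 * m0 * (l - m) ^ 2 := by positivity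
    have h3 : 0 < (sigmaMinus l m + sigmaPlus l m) / 2 := by
      linarith [sigmaMinus_nonneg (l := l) (m := m)]
    by_contra! hcon
    nlinarith
  set γ := 2 * l0 * m0 * (l - m) ^ 2 / d1 with hγ
  have hdγ : d1 * γ = 2 * l0 * m0 * (l - m) ^ 2 := mul_div_cancel₀ _ hd1pos.ne'
  have hγ0 : 0 ≤ γ := by positivity
  have hroot : D l m l0 m0 γ = 0 := by rw [hD, hdγ, sub_self]
  have hDγ : ∀ x, D l m l0 m0 x = d1 * (x - γ) := by intro x; rw [hD, mul_sub, hdγ]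
  have hγa : γ ≤ sigmaMinus l m := by
    refine (root_le_or_le hl hm hl0 hm0 hroot).resolve_right fun h => ?_
    have h1 := D_pos hl hm hl0 hm0 (x := (sigmaMinus l m + sigmaPlus l m) / 2)
      ⟨by linarith, by linarith⟩
    rw [hDγ] at h1
    nlinarith
  obtain ⟨hK1, hK2⟩ := semicircle_stieltjes_real hl hm (Or.inl hγa)
  obtain ⟨hS1, hS2⟩ := integral_semicircle hl hm
  have hg : ∀ x, scalarDensity l m l0 m0 x = (Real.pi * d1)⁻¹ *
      (√((x - sigmaMinus l m) * (sigmaPlus l m - x)) * (x - γ)⁻¹) := by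
    intro x; rw [scalarDensity, hDγ, div_eq_mul_inv, ← mul_assoc, mul_inv]; ring
  have hxg : ∀ x ∈ Set.Ioo (sigmaMinus l m) (sigmaPlus l m), x * scalarDensity l m l0 m0 x =
      (Real.pi * d1)⁻¹ * (√((x - sigmaMinus l m) * (sigmaPlus l m - x)) +
        γ * (√((x - sigmaMinus l m) * (sigmaPlus l m - x)) * (x - γ)⁻¹)) := by
    intro x hx
    have : x - γ ≠ 0 := by linarith [hx.1]
    rw [hg]; field_simp; ring
  have hs := sqrtReal_nonneg hγa
  have hp := (abs_le.1 (abs_p11_root hl hm hl0 hm0 hroot).le).2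
  rw [abs_of_nonneg hs] at hp
  have hpi := Real.pi_pos
  -- The single root also occupies the second slot, with mass zero.
  refine ⟨γ, ((l0 * m + l * m0) * sqrtReal l m γ - p11 l m l0 m0 γ) /
    ((l0 * m + l * m0) * d1), hroot, hroot, ?_, le_rfl, ?_, by simp, ?_, ?_, ?_⟩
  · exact div_nonneg (by linarith) (by positivity)
  · intro hw
    refine lt_of_le_of_ne hγ0 fun h0 => hw ?_
    rw [← h0] at hroot ⊢
    rw [root_zero hl0 hm0 hroot, zero_div]
  · simp_rw [funext hg]
    exact hK1.const_mul _
  · simp_rw [hg]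
    rw [integral_const_mul, hK2, p11]
    rw [kappa] at hκ
    field_simp
    rw [hd1]
    grind
  · rw [setIntegral_congr_fun measurableSet_Ioo hxg, integral_const_mul,
      integral_add hS1 (hK1.const_mul _), integral_const_mul, hK2, hS2, p11]
    rw [kappa] at hκ
    field_simp
    rw [hd1] at hdγ ⊢
    grind

/-- Used for the two roots of `D` and `a = σ₋`, `b = σ₊`. The hypotheses are the order of the roots,
the sign of their product, and the positivity of `D` at the midpoint of the interval. -/
theorem roots_location {κ γ₁ γ₂ a b : ℝ} (hκ : κ ≠ 0) (ha : 0 ≤ a) (hab : a < b)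
    (hsub : 0 < κ * (γ₁ - γ₂)) (hmul : 0 ≤ κ * (γ₁ * γ₂))
    (hmid : 0 < -2 * κ * ((a + b) / 2 - γ₁) * ((a + b) / 2 - γ₂))
    (h₁ : γ₁ ≤ a ∨ b ≤ γ₁) (h₂ : γ₂ ≤ a ∨ b ≤ γ₂) :
    (0 ≤ γ₂ ∧ γ₂ ≤ a) ∧ ((0 < κ ∧ b ≤ γ₁) ∨ (κ < 0 ∧ γ₁ ≤ 0)) := by
  have hmid' : 0 < -κ * (((a + b) / 2 - γ₁) * ((a + b) / 2 - γ₂)) := by linarith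
  rcases lt_or_gt_of_ne hκ with hk | hk
  · have h12 : γ₁ - γ₂ < 0 := by
      by_contra! h; exact absurd (mul_nonpos_of_nonpos_of_nonneg hk.le h) hsub.not_ge
    have hm : γ₁ * γ₂ ≤ 0 := by
      by_contra! h; exact absurd (mul_neg_of_neg_of_pos hk h) hmul.not_gt
    have hc : 0 < ((a + b) / 2 - γ₁) * ((a + b) / 2 - γ₂) :=
      pos_of_mul_pos_right hmid' (by linarith)
    have h0 : 0 ≤ γ₂ := by
      by_contra! h
      exact absurd (mul_pos_of_neg_of_neg (by linarith : γ₁ < 0) h) hm.not_gt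
    have h3 : γ₁ ≤ 0 := by
      by_contra! h
      exact absurd (mul_pos h (by linarith : 0 < γ₂)) hm.not_gt
    have h4 := (pos_iff_pos_of_mul_pos hc).1 (by linarith)
    exact ⟨⟨h0, h₂.resolve_right fun hb => by linarith⟩, Or.inr ⟨hk, h3⟩⟩
  · have h12 : 0 < γ₁ - γ₂ := pos_of_mul_pos_right hsub hk.le
    have hm : 0 ≤ γ₁ * γ₂ := nonneg_of_mul_nonneg_right hmul hk
    have hc : ((a + b) / 2 - γ₁) * ((a + b) / 2 - γ₂) < 0 := by
      by_contra! h
      exact absurd (mul_nonpos_of_nonpos_of_nonneg (by linarith : -κ ≤ 0) h) hmid'.not_ge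
    have hc2 : γ₂ < (a + b) / 2 := by
      by_contra! h
      exact absurd (mul_nonneg_of_nonpos_of_nonpos (by linarith : (a + b) / 2 - γ₁ ≤ 0)
        (by linarith : (a + b) / 2 - γ₂ ≤ 0)) hc.not_ge
    have hc1 : (a + b) / 2 < γ₁ := by
      by_contra! h
      exact absurd (mul_nonneg (by linarith : 0 ≤ (a + b) / 2 - γ₁)
        (by linarith : 0 ≤ (a + b) / 2 - γ₂)) hc.not_ge
    refine ⟨⟨?_, h₂.resolve_right fun hb => by linarith⟩,
      Or.inl ⟨hk, h₁.resolve_left fun h => by linarith⟩⟩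
    by_contra! h
    exact absurd (mul_neg_of_pos_of_neg (by linarith : 0 < γ₁) h) hm.not_gt

-- The masses are minus the residues of `(p11 / q - √) / D`, where `D'` equals `-2 * q * √R` at `γ₊`
-- and `2 * q * √R` at `γ₋`. At a root `p11 = ±q * s`, so the numerator `q * s - p11` is `0` or `-2
-- * p11`, and `p11_gam` turns the second value into the mass `A₁₁ / q`. The sign of `A₁₁` decides
-- between the two.
set_option maxHeartbeats 1000000 in
theorem atoms_of_kappa_ne_zero (hl : 0 < l) (hm : 0 < m) (hl0 : 0 < l0) (hm0 : 0 < m0)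
    (hκ : kappa l m l0 m0 ≠ 0) : ∃ w₁ w₂ : ℝ,
      IsAtoms l m l0 m0 (gam 1 l m l0 m0) w₁ (gam (-1) l m l0 m0) w₂ ∧
      (∀ α β, w₁ * numer l m l0 m0 (gam 1 l m l0 m0) α β =
        if 0 < weight (-1) l m l0 m0 0 0 ∧ 0 < gam 1 l m l0 m0 then
          weight (-1) l m l0 m0 α β else 0) ∧
      (∀ α β, w₂ * numer l m l0 m0 (gam (-1) l m l0 m0) α β =
        if 0 < weight 1 l m l0 m0 0 0 ∧ 0 < gam (-1) l m l0 m0 then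
          weight 1 l m l0 m0 α β else 0) := by
  have hab := sigmaMinus_lt_sigmaPlus hl hm
  have ha0 := sigmaMinus_nonneg (l := l) (m := m)
  have hq : 0 < l0 * m + l * m0 := by positivity
  have hDeq := D_eq hκ hl0 hm0
  obtain ⟨hr1, hr2⟩ := D_gam hκ hl0 hm0
  have hp1 := p11_gam (ε := 1) hκ (by norm_num) hl0 hm0
  have hp2 := p11_gam (ε := -1) hκ (by norm_num) hl0 hm0
  have hW1 := weight_mul_eq (ε := 1) hκ (by norm_num) hl0 hm0 hr1
  have hW2 := weight_mul_eq (ε := -1) hκ (by norm_num) hl0 hm0 hr2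
  rw [neg_neg] at hp2 hW2
  have hadd := kappa_mul_gam_add hκ
  have hsub := kappa_mul_gam_sub hκ
  have hmul := kappa_mul_gam_mul hκ hl0 hm0
  have hr : 0 < √(R l m l0 m0) := Real.sqrt_pos.2 (R_pos hl0 hm0)
  have hmid := D_pos hl hm hl0 hm0 (x := (sigmaMinus l m + sigmaPlus l m) / 2)
      ⟨by linarith, by linarith⟩
  rw [hDeq] at hmid
  have ho1 := root_le_or_le hl hm hl0 hm0 hr1
  have ho2 := root_le_or_le hl hm hl0 hm0 hr2
  have hroots1 := p11_root hl hm hl0 hm0 hr1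
  have hroots2 := p11_root hl hm hl0 hm0 hr2
  have hz1 : gam 1 l m l0 m0 = 0 → (l0 * m + l * m0) * sqrtReal l m (gam 1 l m l0 m0) -
      p11 l m l0 m0 (gam 1 l m l0 m0) = 0 := fun h => by
    rw [h] at hr1 ⊢; exact root_zero hl0 hm0 hr1
  have hz2 : gam (-1) l m l0 m0 = 0 → (l0 * m + l * m0) * sqrtReal l m (gam (-1) l m l0 m0) -
      p11 l m l0 m0 (gam (-1) l m l0 m0) = 0 := fun h => by
    rw [h] at hr2 ⊢; exact root_zero hl0 hm0 hr2
  have hmul0 : 0 ≤ kappa l m l0 m0 * (gam 1 l m l0 m0 * gam (-1) l m l0 m0) := by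
    rw [hmul]; positivity
  -- When `κ < 0` the root `γ₊` is nonpositive and must carry no mass. Positivity of `A₁₁⁻` makes
  -- `p11` positive there, like the square root, so the residue vanishes.
  have hA1neg : kappa l m l0 m0 < 0 → 0 < weight (-1) l m l0 m0 0 0 := by
    intro hk
    have hA : weight (-1) l m l0 m0 0 0 = 1 / (2 * kappa l m l0 m0) *
      (l0 * m + m0 * l - 2 * l * m + -1 * ((l0 * m + m0 * l) * (l + m - l0 - m0) *
        (√(R l m l0 m0) / R l m l0 m0))) := by simp [weight]
    rw [hA]
    have h1 : l0 < l := by rw [kappa] at hk; by_contra!; nlinarith [mul_pos hm0 hl]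
    have h2 : m0 < m := by rw [kappa] at hk; by_contra!; nlinarith [mul_pos hl0 hm]
    have h3 : 0 < (l0 * m + m0 * l) * (l + m - l0 - m0) * (√(R l m l0 m0) / R l m l0 m0) := by
      have := R_pos (l := l) (m := m) hl0 hm0
      have h4 : 0 < l + m - l0 - m0 := by linarith
      positivity
    have h5 : l0 * m + m0 * l - 2 * l * m < 0 := by
      rw [kappa] at hk; nlinarith [mul_pos hl hm]
    exact mul_pos_of_neg_of_neg (one_div_neg.2 (by linarith)) (by linarith)
  set γ₁ := gam 1 l m l0 m0
  set γ₂ := gam (-1) l m l0 m0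
  set κ := kappa l m l0 m0 with hκdef
  set q := l0 * m + l * m0 with hqdef
  set r := √(R l m l0 m0)
  set A := weight (-1) l m l0 m0 0 0
  set A' := weight 1 l m l0 m0 0 0
  set s₁ := sqrtReal l m γ₁ with hs1
  set s₂ := sqrtReal l m γ₂ with hs2
  have hqr : 0 < q * r := mul_pos hq hr
  have hsub' : κ * (γ₁ - γ₂) = q * r := by rw [hsub, hqdef]; ring
  obtain ⟨hγ₂, hγ₁⟩ := roots_location hκ ha0 hab (hqr.trans_eq hsub'.symm) hmul0 hmid ho1 ho2
  have hs₂ : 0 ≤ s₂ := sqrtReal_nonneg hγ₂.2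
  have hat1 : 0 ≤ (q * s₁ - p11 l m l0 m0 γ₁) / (-2 * q * (q * r)) ∧
      (q * s₁ - p11 l m l0 m0 γ₁) / (-2 * q * (q * r)) =
        if 0 < A ∧ 0 < γ₁ then A / q else 0 := by
    rcases hγ₁ with ⟨hk, hb⟩ | ⟨hk, hb⟩
    · have hs : s₁ ≤ 0 := sqrtReal_nonpos hl hm hb
      have hpos : 0 < γ₁ := by linarith
      by_cases hA : 0 < A
      · rw [if_pos ⟨hA, hpos⟩]
        have hpp : 0 < p11 l m l0 m0 γ₁ := by rw [hp1, one_mul]; exact mul_pos hqr hA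
        have hp : p11 l m l0 m0 γ₁ = -(q * s₁) := by
          refine hroots1.resolve_left fun h => ?_
          nlinarith
        have e : (q * s₁ - p11 l m l0 m0 γ₁) / (-2 * q * (q * r)) = A / q := by
          rw [show q * s₁ = -p11 l m l0 m0 γ₁ by rw [hp, neg_neg], hp1]
          field_simp
          ring
        exact ⟨by rw [e]; positivity, e⟩
      · rw [if_neg (fun h => hA h.1)]
        push Not at hA
        have hpp : p11 l m l0 m0 γ₁ ≤ 0 := by
          rw [hp1, one_mul]; exact mul_nonpos_of_nonneg_of_nonpos hqr.le hA
        have hp : q * s₁ - p11 l m l0 m0 γ₁ = 0 := by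
          rcases hroots1 with h | h
          · linarith
          · have : q * s₁ ≤ 0 := mul_nonpos_of_nonneg_of_nonpos hq.le hs
            linarith
        rw [hp, zero_div]; exact ⟨le_rfl, rfl⟩
    · rw [if_neg (fun h => by linarith [h.2])]
      have hs : 0 ≤ s₁ := sqrtReal_nonneg (hb.trans ha0)
      have hpp : 0 < p11 l m l0 m0 γ₁ := by
        rw [hp1, one_mul]; exact mul_pos hqr (hA1neg hk)
      have hp : q * s₁ - p11 l m l0 m0 γ₁ = 0 := by
        rcases hroots1 with h | h
        · linarith
        · have : 0 ≤ q * s₁ := mul_nonneg hq.le hs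
          linarith
      rw [hp, zero_div]; exact ⟨le_rfl, rfl⟩
  have hat2 : 0 ≤ (q * s₂ - p11 l m l0 m0 γ₂) / (2 * q * (q * r)) ∧
      (q * s₂ - p11 l m l0 m0 γ₂) / (2 * q * (q * r)) =
        if 0 < A' ∧ 0 < γ₂ then A' / q else 0 := by
    have hqs : 0 ≤ q * s₂ := mul_nonneg hq.le hs₂
    by_cases hA : 0 < A'
    · have hpp : p11 l m l0 m0 γ₂ < 0 := by
        rw [hp2]; have := mul_pos hqr hA; nlinarith
      by_cases hpos : 0 < γ₂
      · rw [if_pos ⟨hA, hpos⟩]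
        have hp : p11 l m l0 m0 γ₂ = -(q * s₂) := by
          refine hroots2.resolve_left fun h => ?_
          linarith
        have e : (q * s₂ - p11 l m l0 m0 γ₂) / (2 * q * (q * r)) = A' / q := by
          rw [show q * s₂ = -p11 l m l0 m0 γ₂ by rw [hp, neg_neg], hp2]
          field_simp
          ring
        exact ⟨by rw [e]; positivity, e⟩
      · rw [if_neg (fun h => hpos h.2), hz2 (le_antisymm (not_lt.1 hpos) hγ₂.1), zero_div]
        exact ⟨le_rfl, rfl⟩
    · rw [if_neg (fun h => hA h.1)]
      push Not at hA
      have hpp : 0 ≤ p11 l m l0 m0 γ₂ := by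
        rw [hp2]; have := mul_nonpos_of_nonneg_of_nonpos hqr.le hA; nlinarith
      have hp : q * s₂ - p11 l m l0 m0 γ₂ = 0 := by
        rcases hroots2 with h | h <;> linarith
      rw [hp, zero_div]; exact ⟨le_rfl, rfl⟩
  have hpi := Real.pi_pos
  obtain ⟨hK1, hK1'⟩ := semicircle_stieltjes_real hl hm ho1
  obtain ⟨hK2, hK2'⟩ := semicircle_stieltjes_real hl hm ho2
  have hne : γ₁ - γ₂ ≠ 0 := fun h => by rw [h, mul_zero] at hsub'; exact hqr.ne hsub'
  -- Partial fractions for `1 / D`, with `κ * (γ₁ - γ₂) = q * r`; each summand is a semicircle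
  -- transform at a root.
  have hg : ∀ x ∈ Set.Ioo (sigmaMinus l m) (sigmaPlus l m), scalarDensity l m l0 m0 x =
      (Real.pi * (-2 * (q * r)))⁻¹ *
      (√((x - sigmaMinus l m) * (sigmaPlus l m - x)) * (x - γ₁)⁻¹ -
        √((x - sigmaMinus l m) * (sigmaPlus l m - x)) * (x - γ₂)⁻¹) := by
    intro x hx
    have n1 : x - γ₁ ≠ 0 := by rcases ho1 with h | h <;> [linarith [hx.1]; linarith [hx.2]]
    have n2 : x - γ₂ ≠ 0 := by linarith [hx.1]
    rw [scalarDensity, hDeq, ← hsub']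
    field_simp
    ring
  have hxg : ∀ x ∈ Set.Ioo (sigmaMinus l m) (sigmaPlus l m), x * scalarDensity l m l0 m0 x =
      (Real.pi * (-2 * (q * r)))⁻¹ *
      (γ₁ * (√((x - sigmaMinus l m) * (sigmaPlus l m - x)) * (x - γ₁)⁻¹) -
        γ₂ * (√((x - sigmaMinus l m) * (sigmaPlus l m - x)) * (x - γ₂)⁻¹)) := by
    intro x hx
    have n1 : x - γ₁ ≠ 0 := by rcases ho1 with h | h <;> [linarith [hx.1]; linarith [hx.2]]
    have n2 : x - γ₂ ≠ 0 := by linarith [hx.1]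
    rw [hg x hx]
    field_simp
    ring
  refine ⟨(q * s₁ - p11 l m l0 m0 γ₁) / (-2 * q * (q * r)),
    (q * s₂ - p11 l m l0 m0 γ₂) / (2 * q * (q * r)),
    ⟨hr1, hr2, hat1.1, hat2.1, ?_, ?_, ?_, ?_, ?_⟩, ?_, ?_⟩
  · intro h
    rw [hat1.2] at h
    by_contra hcon
    exact h (if_neg fun h => hcon h.2)
  · intro h
    rw [hat2.2] at h
    by_contra hcon
    exact h (if_neg fun h => hcon h.2)
  · exact (integrableOn_congr_fun hg measurableSet_Ioo).2 ((hK1.sub hK2).const_mul _)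
  · rw [setIntegral_congr_fun measurableSet_Ioo hg, integral_const_mul, integral_sub hK1 hK2,
      hK1', hK2', p11, p11]
    have e : κ = q - l * m := by rw [hκdef, hqdef, kappa]; ring
    have hκ' : q - l * m ≠ 0 := e ▸ hκ
    rw [← hsub', e]
    field_simp
    rw [hqdef]
    ring
  · rw [setIntegral_congr_fun measurableSet_Ioo hxg, integral_const_mul,
      integral_sub (hK1.const_mul _) (hK2.const_mul _), integral_const_mul, integral_const_mul,
      hK1', hK2', p11, p11]
    have hL : q * (γ₁ * (l + m - γ₁) - γ₂ * (l + m - γ₂)) -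
        (γ₁ * ((l0 * m + m0 * l - 2 * l * m) * γ₁ + (l - m) * (l0 * m - m0 * l)) -
         γ₂ * ((l0 * m + m0 * l - 2 * l * m) * γ₂ + (l - m) * (l0 * m - m0 * l))) =
        -2 * (l0 + m0) * (q * r) := by
      rw [← hsub']
      have e : q - l * m = κ := by rw [hκdef, hqdef, kappa]; ring
      have e2 : l0 * m + m0 * l = q := by rw [hqdef]; ring
      have : (γ₁ - γ₂) * (q * (l + m) - (l - m) * (l0 * m - m0 * l) - 2 * (κ * (γ₁ + γ₂))) =
          (γ₁ - γ₂) * (-2 * (l0 + m0) * κ) := by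
        rw [hadd, hκdef, hqdef, kappa]; ring
      rw [e2]
      linear_combination this - 2 * (γ₁ ^ 2 - γ₂ ^ 2) * e
    have hr' := hr.ne'
    have hq' := hq.ne'
    have hpi' := hpi.ne'
    have e : (l0 + m0) / q = (-2 * q * (q * r))⁻¹ * (-2 * (l0 + m0) * (q * r)) := by field_simp
    rw [e, ← hL]
    field_simp
    ring
  · intro α β
    rw [hat1.2]
    split_ifs
    · rw [div_mul_eq_mul_div, div_eq_iff hq.ne', ← hW1]
    · rw [zero_mul]
  · intro α β
    rw [hat2.2]
    split_ifs
    · rw [div_mul_eq_mul_div, div_eq_iff hq.ne', ← hW2]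
    · rw [zero_mul]

theorem exists_atoms (hl : 0 < l) (hm : 0 < m) (hl0 : 0 < l0) (hm0 : 0 < m0) :
    ∃ γ₁ w₁ γ₂ w₂, IsAtoms l m l0 m0 γ₁ w₁ γ₂ w₂ ∧ (kappa l m l0 m0 ≠ 0 →
      γ₁ = gam 1 l m l0 m0 ∧ γ₂ = gam (-1) l m l0 m0 ∧
      (∀ α β, w₁ * numer l m l0 m0 γ₁ α β =
        if 0 < weight (-1) l m l0 m0 0 0 ∧ 0 < gam 1 l m l0 m0 then
          weight (-1) l m l0 m0 α β else 0) ∧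
      (∀ α β, w₂ * numer l m l0 m0 γ₂ α β =
        if 0 < weight 1 l m l0 m0 0 0 ∧ 0 < gam (-1) l m l0 m0 then
          weight 1 l m l0 m0 α β else 0)) := by
  by_cases hκ : kappa l m l0 m0 = 0
  · obtain ⟨γ, w, h⟩ := atoms_of_kappa_eq_zero hl hm hl0 hm0 hκ
    exact ⟨γ, w, γ, 0, h, fun h => (h hκ).elim⟩
  · obtain ⟨w₁, w₂, h, h1, h2⟩ := atoms_of_kappa_ne_zero hl hm hl0 hm0 hκ
    exact ⟨_, w₁, _, w₂, h, fun _ => ⟨rfl, rfl, h1, h2⟩⟩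

end

/-! ### The scalar spectral measure -/

/-- A positive measure `ν` such that `numer • ν` is the spectral matrix. -/
structure IsScalarSpectral (l m l0 m0 : ℝ) (ν : Measure ℝ) : Prop where
  finite : IsFiniteMeasure ν
  bounded : ∃ B, ∀ᵐ x ∂ν, 0 < x ∧ x ≤ B
  away : l ≠ m → ∃ ε > 0, ∀ᵐ x ∂ν, ε ≤ x
  D_nonneg : ∀ᵐ x ∂ν, 0 ≤ D l m l0 m0 x
  mass : ∫ _, (1 : ℝ) ∂ν = 1 / (l0 * m + l * m0)
  mean : ∫ x, x ∂ν = (l0 + m0) / (l0 * m + l * m0)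
  D_mul_stieltjes : ∀ z : ℂ, ¬ (0 ≤ z.re ∧ z.im = 0) →
    ∫ x : ℝ, ((D l m l0 m0 x : ℝ) : ℂ) * ((x : ℂ) - z)⁻¹ ∂ν = l + m - z - sqrtBranch l m z
  integrable_acDensity : ∀ α β, Integrable (acDensity l m l0 m0 α β)
  decomposition : ∃ Ψd : Matrix (Fin 2) (Fin 2) (SignedMeasure ℝ),
    (Matrix.of fun α β => ν.withDensityᵥ fun x => numer l m l0 m0 x α β) =
      acPart l m l0 m0 + Ψd ∧
    (∀ α β, (Ψd α β).variation {x | D l m l0 m0 x ≠ 0} = 0) ∧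
    (l0 * m + m0 * l ≠ l * m → Ψd = discretePart l m l0 m0)

noncomputable def scalarMeasure (l m l0 m0 γ₁ w₁ γ₂ w₂ : ℝ) : Measure ℝ :=
  (volume.restrict (Set.Ioo (sigmaMinus l m) (sigmaPlus l m))).withDensity
      (fun x => ENNReal.ofReal (scalarDensity l m l0 m0 x)) +
    (ENNReal.ofReal w₁ • Measure.dirac γ₁ + ENNReal.ofReal w₂ • Measure.dirac γ₂)

section

variable {l m l0 m0 : ℝ}

theorem continuous_numer (α β : Fin 2) : Continuous fun x => numer l m l0 m0 x α β := by
  fin_cases α <;> fin_cases β <;> simp [numer, q22] <;> fun_prop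

theorem continuous_D : Continuous (D l m l0 m0) := by unfold D; fun_prop

theorem measurable_scalarDensity : Measurable (scalarDensity l m l0 m0) := by
  unfold scalarDensity
  have : Measurable (D l m l0 m0) := continuous_D.measurable
  fun_prop

theorem scalarDensity_nonneg (hl : 0 < l) (hm : 0 < m) (hl0 : 0 < l0) (hm0 : 0 < m0) {x : ℝ}
    (hx : x ∈ Set.Ioo (sigmaMinus l m) (sigmaPlus l m)) : 0 ≤ scalarDensity l m l0 m0 x :=
  div_nonneg (Real.sqrt_nonneg _) (mul_nonneg Real.pi_pos.le (D_pos hl hm hl0 hm0 hx).le)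

variable {γ₁ w₁ γ₂ w₂ : ℝ}

/-- A root that carries no mass may be nonpositive; adding `0 < γ` to the description of the atoms
discards it. -/
theorem ae_scalarMeasure (h : IsAtoms l m l0 m0 γ₁ w₁ γ₂ w₂) :
    ∀ᵐ x ∂scalarMeasure l m l0 m0 γ₁ w₁ γ₂ w₂, x ∈ Set.Ioo (sigmaMinus l m) (sigmaPlus l m) ∨
      (x = γ₁ ∧ 0 < γ₁) ∨ (x = γ₂ ∧ 0 < γ₂) := by
  have hd : ∀ γ w : ℝ, (w ≠ 0 → 0 < γ) →
      ∀ᵐ x ∂(ENNReal.ofReal w • Measure.dirac γ), x = γ ∧ 0 < γ := by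
    intro γ w hw
    by_cases h0 : w = 0
    · rw [h0, ENNReal.ofReal_zero, zero_smul]; simp
    · refine Measure.ae_smul_measure ?_ _
      rw [ae_dirac_iff (by measurability)]
      exact ⟨rfl, hw h0⟩
  rw [scalarMeasure, ae_add_measure_iff, ae_add_measure_iff]
  refine ⟨?_, ?_, ?_⟩
  · refine (withDensity_absolutelyContinuous _ _).ae_le ?_
    filter_upwards [ae_restrict_mem measurableSet_Ioo] with x hx using Or.inl hx
  · filter_upwards [hd γ₁ w₁ h.pos₁] with x hx using Or.inr (Or.inl hx)
  · filter_upwards [hd γ₂ w₂ h.pos₂] with x hx using Or.inr (Or.inr hx)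

theorem isFiniteMeasure_scalarMeasure (h : IsAtoms l m l0 m0 γ₁ w₁ γ₂ w₂) :
    IsFiniteMeasure (scalarMeasure l m l0 m0 γ₁ w₁ γ₂ w₂) := by
  have := isFiniteMeasure_withDensity_ofReal h.integrable.2
  have h2 : ∀ γ w : ℝ, IsFiniteMeasure (ENNReal.ofReal w • Measure.dirac γ) := fun γ w =>
    Measure.smul_finite _ ENNReal.ofReal_ne_top
  have := h2 γ₁ w₁
  have := h2 γ₂ w₂
  rw [scalarMeasure]
  infer_instance

theorem integral_scalarMeasure (hl : 0 < l) (hm : 0 < m) (hl0 : 0 < l0) (hm0 : 0 < m0)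
    (h : IsAtoms l m l0 m0 γ₁ w₁ γ₂ w₂) {E : Type*} [NormedAddCommGroup E] [NormedSpace ℝ E]
    [CompleteSpace E] {f : ℝ → E}
    (hf : IntegrableOn (fun x => scalarDensity l m l0 m0 x • f x)
      (Set.Ioo (sigmaMinus l m) (sigmaPlus l m))) :
    ∫ x, f x ∂scalarMeasure l m l0 m0 γ₁ w₁ γ₂ w₂ =
      (∫ x in Set.Ioo (sigmaMinus l m) (sigmaPlus l m), scalarDensity l m l0 m0 x • f x) +
        (w₁ • f γ₁ + w₂ • f γ₂) := by
  have hmeas : Measurable fun x => ENNReal.ofReal (scalarDensity l m l0 m0 x) :=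
    measurable_scalarDensity.ennreal_ofReal
  have hlt : ∀ᵐ x ∂(volume.restrict (Set.Ioo (sigmaMinus l m) (sigmaPlus l m))),
    ENNReal.ofReal (scalarDensity l m l0 m0 x) < ⊤ := by simp
  have hcongr : ∀ x ∈ Set.Ioo (sigmaMinus l m) (sigmaPlus l m),
      (ENNReal.ofReal (scalarDensity l m l0 m0 x)).toReal • f x =
        scalarDensity l m l0 m0 x • f x := fun x hx => by
    rw [ENNReal.toReal_ofReal (scalarDensity_nonneg hl hm hl0 hm0 hx)]
  have hd : ∀ γ w : ℝ, Integrable f (ENNReal.ofReal w • Measure.dirac γ) := fun γ w =>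
    (integrable_dirac (by finiteness)).smul_measure ENNReal.ofReal_ne_top
  have h1 : Integrable f ((volume.restrict (Set.Ioo (sigmaMinus l m)
      (sigmaPlus l m))).withDensity (fun x => ENNReal.ofReal (scalarDensity l m l0 m0 x))) :=
    (integrable_withDensity_iff_integrable_smul' hmeas hlt).2
      ((integrableOn_congr_fun hcongr measurableSet_Ioo).2 hf)
  rw [scalarMeasure, integral_add_measure h1 ((hd _ _).add_measure (hd _ _)),
    integral_add_measure (hd _ _) (hd _ _),
    integral_withDensity_eq_integral_toReal_smul hmeas hlt,
    setIntegral_congr_fun measurableSet_Ioo hcongr, integral_smul_measure, integral_smul_measure,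
    integral_dirac, integral_dirac, ENNReal.toReal_ofReal h.nonneg₁,
    ENNReal.toReal_ofReal h.nonneg₂]

theorem integrableOn_scalarDensity_smul (h : IsAtoms l m l0 m0 γ₁ w₁ γ₂ w₂) {E : Type*}
    [NormedAddCommGroup E] [NormedSpace ℝ E] {f : ℝ → E} (hf : Continuous f) {S : Set ℝ}
    (hS : MeasurableSet S) :
    IntegrableOn (fun x => scalarDensity l m l0 m0 x • S.indicator f x)
      (Set.Ioo (sigmaMinus l m) (sigmaPlus l m)) := by
  obtain ⟨C, hC⟩ := (isCompact_Icc (a := sigmaMinus l m) (b := sigmaPlus l m)).exists_bound_of_continuousOn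
    hf.continuousOn
  refine Integrable.smul_of_top_left h.integrable (memLp_top_of_bound
    (hf.stronglyMeasurable.indicator hS).aestronglyMeasurable C ?_)
  filter_upwards [ae_restrict_mem measurableSet_Ioo] with x hx
  exact (norm_indicator_le_norm_self _ _).trans (hC x ⟨hx.1.le, hx.2.le⟩)

theorem integral_continuous_scalarMeasure (hl : 0 < l) (hm : 0 < m) (hl0 : 0 < l0) (hm0 : 0 < m0)
    (h : IsAtoms l m l0 m0 γ₁ w₁ γ₂ w₂) {f : ℝ → ℝ} (hf : Continuous f) :
    ∫ x, f x ∂scalarMeasure l m l0 m0 γ₁ w₁ γ₂ w₂ =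
      (∫ x in Set.Ioo (sigmaMinus l m) (sigmaPlus l m), f x * scalarDensity l m l0 m0 x) +
        w₁ * f γ₁ + w₂ * f γ₂ := by
  have := integrableOn_scalarDensity_smul h hf MeasurableSet.univ
  simp only [Set.indicator_univ] at this
  rw [integral_scalarMeasure hl hm hl0 hm0 h this]
  simp only [smul_eq_mul, mul_comm (scalarDensity _ _ _ _ _), add_assoc]

theorem acDensity_eq (α β : Fin 2) : acDensity l m l0 m0 α β =
    (Set.Icc (sigmaMinus l m) (sigmaPlus l m)).indicator fun x =>
      scalarDensity l m l0 m0 x * numer l m l0 m0 x α β := rfl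

theorem integrable_acDensity (h : IsAtoms l m l0 m0 γ₁ w₁ γ₂ w₂) (α β : Fin 2) :
    Integrable (acDensity l m l0 m0 α β) := by
  rw [acDensity_eq, integrable_indicator_iff measurableSet_Icc, integrableOn_Icc_iff_integrableOn_Ioo]
  have := integrableOn_scalarDensity_smul h (continuous_numer (l := l) (m := m) (l0 := l0)
    (m0 := m0) α β) MeasurableSet.univ
  simp only [Set.indicator_univ] at this
  exact this

theorem integrable_of_ae_mem_Ioc {ν : Measure ℝ} [IsFiniteMeasure ν] {B : ℝ}
    (hB : ∀ᵐ x ∂ν, 0 < x ∧ x ≤ B) {E : Type*} [NormedAddCommGroup E] {f : ℝ → E}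
    (hf : ContinuousOn f (Set.Icc 0 B)) : Integrable f ν := by
  have h1 : ν.restrict (Set.Icc 0 B) = ν :=
    Measure.restrict_eq_self_of_ae_mem (by filter_upwards [hB] with x hx using ⟨hx.1.le, hx.2⟩)
  have := hf.integrableOn_compact (μ := ν) isCompact_Icc
  rwa [IntegrableOn, h1] at this

/-- The factor `D` cancels the denominator of the density and vanishes at the atoms, leaving the
semicircle law alone. -/
theorem scalarMeasure_stieltjes (hl : 0 < l) (hm : 0 < m) (hl0 : 0 < l0) (hm0 : 0 < m0)
    (h : IsAtoms l m l0 m0 γ₁ w₁ γ₂ w₂) {z : ℂ} (hz : ¬ (0 ≤ z.re ∧ z.im = 0)) :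
    ∫ x : ℝ, ((D l m l0 m0 x : ℝ) : ℂ) * ((x : ℂ) - z)⁻¹ ∂scalarMeasure l m l0 m0 γ₁ w₁ γ₂ w₂ =
      l + m - z - sqrtBranch l m z := by
  obtain ⟨h1, h2⟩ := semicircle_stieltjes hl hm hz
  have hcongr : ∀ x ∈ Set.Ioo (sigmaMinus l m) (sigmaPlus l m),
      scalarDensity l m l0 m0 x • (((D l m l0 m0 x : ℝ) : ℂ) * ((x : ℂ) - z)⁻¹) =
        (Real.pi : ℂ)⁻¹ • (√((x - sigmaMinus l m) * (sigmaPlus l m - x)) • ((x : ℂ) - z)⁻¹) := by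
    intro x hx
    have hD : ((D l m l0 m0 x : ℝ) : ℂ) ≠ 0 := by exact_mod_cast (D_pos hl hm hl0 hm0 hx).ne'
    have hpi : (Real.pi : ℂ) ≠ 0 := by exact_mod_cast Real.pi_ne_zero
    rw [scalarDensity, Complex.real_smul, Complex.real_smul, smul_eq_mul]
    push_cast
    field_simp
  have hi : IntegrableOn (fun x : ℝ => scalarDensity l m l0 m0 x •
      (((D l m l0 m0 x : ℝ) : ℂ) * ((x : ℂ) - z)⁻¹)) (Set.Ioo (sigmaMinus l m) (sigmaPlus l m)) :=
    (integrableOn_congr_fun hcongr measurableSet_Ioo).2 (h1.smul (Real.pi : ℂ)⁻¹)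
  rw [integral_scalarMeasure hl hm hl0 hm0 h hi, setIntegral_congr_fun measurableSet_Ioo hcongr,
    integral_smul, h2, h.root₁, h.root₂]
  have hpi : (Real.pi : ℂ) ≠ 0 := by exact_mod_cast Real.pi_ne_zero
  simp only [Complex.ofReal_zero, zero_mul, smul_zero, add_zero, smul_eq_mul]
  rw [← mul_assoc, inv_mul_cancel₀ hpi, one_mul]

theorem exists_isScalarSpectral (hl : 0 < l) (hm : 0 < m) (hl0 : 0 < l0) (hm0 : 0 < m0) :
    ∃ ν, IsScalarSpectral l m l0 m0 ν := by
  obtain ⟨γ₁, w₁, γ₂, w₂, h, hκ⟩ := exists_atoms hl hm hl0 hm0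
  have hae := ae_scalarMeasure h
  have hfin := isFiniteMeasure_scalarMeasure h
  have ha0 := sigmaMinus_nonneg (l := l) (m := m)
  have hbdd : ∀ᵐ x ∂scalarMeasure l m l0 m0 γ₁ w₁ γ₂ w₂,
      0 < x ∧ x ≤ max (sigmaPlus l m) (max γ₁ γ₂) := by
    filter_upwards [hae] with x hx
    rcases hx with hx | ⟨rfl, hx⟩ | ⟨rfl, hx⟩
    · exact ⟨ha0.trans_lt hx.1, hx.2.le.trans (le_max_left _ _)⟩
    · exact ⟨hx, (le_max_left _ _).trans (le_max_right _ _)⟩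
    · exact ⟨hx, (le_max_right _ _).trans (le_max_right _ _)⟩
  refine ⟨scalarMeasure l m l0 m0 γ₁ w₁ γ₂ w₂, hfin, ⟨_, hbdd⟩, ?_, ?_, ?_, ?_,
    fun z hz => scalarMeasure_stieltjes hl hm hl0 hm0 h hz, integrable_acDensity h, ?_⟩
  · intro hlm
    have ha := sigmaMinus_pos hl hm hlm
    refine ⟨min (sigmaMinus l m) (min (if 0 < γ₁ then γ₁ else 1) (if 0 < γ₂ then γ₂ else 1)),
      lt_min ha (lt_min (by split_ifs <;> linarith) (by split_ifs <;> linarith)), ?_⟩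
    filter_upwards [hae] with x hx
    rcases hx with hx | ⟨rfl, hx⟩ | ⟨rfl, hx⟩
    · exact (min_le_left _ _).trans hx.1.le
    · exact (min_le_right _ _).trans ((min_le_left _ _).trans (by rw [if_pos hx]))
    · exact (min_le_right _ _).trans ((min_le_right _ _).trans (by rw [if_pos hx]))
  · filter_upwards [hae] with x hx
    rcases hx with hx | ⟨rfl, hx⟩ | ⟨rfl, hx⟩
    · exact (D_pos hl hm hl0 hm0 hx).le
    · exact h.root₁.ge
    · exact h.root₂.ge
  · have := integral_continuous_scalarMeasure hl hm hl0 hm0 h (f := fun _ => 1) (by fun_prop)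
    simp only [one_mul, mul_one] at this
    rw [this, h.mass]
  · have := integral_continuous_scalarMeasure hl hm hl0 hm0 h (f := fun x => x) (by fun_prop)
    rw [this, h.mean]
  · refine ⟨Matrix.of fun α β => VectorMeasure.dirac γ₁ (w₁ * numer l m l0 m0 γ₁ α β) +
      VectorMeasure.dirac γ₂ (w₂ * numer l m l0 m0 γ₂ α β), ?_, ?_, ?_⟩
    · ext α β S hS
      have hN : Integrable (fun x => numer l m l0 m0 x α β)
          (scalarMeasure l m l0 m0 γ₁ w₁ γ₂ w₂) :=
        integrable_of_ae_mem_Ioc hbdd (continuous_numer α β).continuousOn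
      have h1 := integrableOn_scalarDensity_smul h (continuous_numer (l := l) (m := m) (l0 := l0)
        (m0 := m0) α β) hS
      have h2 := integral_scalarMeasure hl hm hl0 hm0 h h1
      have hdir : ∀ γ w : ℝ, VectorMeasure.dirac γ (w * numer l m l0 m0 γ α β) S =
          w • S.indicator (fun x => numer l m l0 m0 x α β) γ := by
        intro γ w
        by_cases hγ : γ ∈ S
        · rw [VectorMeasure.dirac_apply_of_mem hS hγ, Set.indicator_of_mem hγ, smul_eq_mul]
        · rw [VectorMeasure.dirac_apply_of_notMem hγ, Set.indicator_of_notMem hγ, smul_zero]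
      have hac : (acPart l m l0 m0 α β) S = ∫ x in Set.Ioo (sigmaMinus l m) (sigmaPlus l m),
          scalarDensity l m l0 m0 x • S.indicator (fun x => numer l m l0 m0 x α β) x := by
        rw [acPart, Matrix.of_apply, withDensityᵥ_apply (integrable_acDensity h α β) hS,
          acDensity_eq, setIntegral_indicator measurableSet_Icc, Set.inter_comm,
          ← setIntegral_indicator hS, integral_Icc_eq_integral_Ioo]
        refine setIntegral_congr_fun measurableSet_Ioo fun x _ => ?_
        by_cases hx : x ∈ S <;> simp [hx]
      rw [Matrix.of_apply, withDensityᵥ_apply hN hS, ← integral_indicator hS, h2, Matrix.add_apply,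
        Matrix.of_apply, _root_.add_apply, _root_.add_apply, hac, hdir, hdir]
    · intro α β
      have hms : MeasurableSet {x | D l m l0 m0 x ≠ 0} :=
        (continuous_D.measurable (measurableSet_singleton (0 : ℝ))).compl
      rw [VectorMeasure.variation_apply_eq_zero hms]
      intro T hT _
      rw [Matrix.of_apply, _root_.add_apply,
        VectorMeasure.dirac_apply_of_notMem (fun h' => hT h' h.root₁),
        VectorMeasure.dirac_apply_of_notMem (fun h' => hT h' h.root₂), add_zero]
    · intro hne
      obtain ⟨e1, e2, e3, e4⟩ := hκ (sub_ne_zero.2 hne)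
      ext1 α β
      rw [Matrix.of_apply, discretePart, Matrix.of_apply, e3, e4, e1, e2]
      congr 1
      · split_ifs with h1 <;> simp
      · split_ifs with h1 <;> simp

end

/-! ### The spectral matrix and its Stieltjes transform -/

noncomputable def spectralMatrix (l m l0 m0 : ℝ) (ν : Measure ℝ) :
    Matrix (Fin 2) (Fin 2) (SignedMeasure ℝ) :=
  Matrix.of fun α β => ν.withDensityᵥ fun x => numer l m l0 m0 x α β

section

variable {l m l0 m0 : ℝ} {ν : Measure ℝ}

/-- `ν` is finite and concentrated on some `(0, B]`, so continuity on the closed half line suffices.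
This covers `(x - z)⁻¹` for `z` off that half line. -/
theorem IsScalarSpectral.integrable_of_continuousOn (h : IsScalarSpectral l m l0 m0 ν)
    {E : Type*} [NormedAddCommGroup E] {f : ℝ → E} (hf : ContinuousOn f (Set.Ici 0)) :
    Integrable f ν := by
  have := h.finite
  obtain ⟨B, hB⟩ := h.bounded
  exact integrable_of_ae_mem_Ioc hB (hf.mono fun x hx => hx.1)

theorem IsScalarSpectral.integrable_of_continuous (h : IsScalarSpectral l m l0 m0 ν)
    {E : Type*} [NormedAddCommGroup E] {f : ℝ → E} (hf : Continuous f) :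
    Integrable f ν := h.integrable_of_continuousOn hf.continuousOn

theorem IsScalarSpectral.ae_pos (h : IsScalarSpectral l m l0 m0 ν) : ∀ᵐ x ∂ν, 0 < x := by
  obtain ⟨B, hB⟩ := h.bounded
  filter_upwards [hB] with x hx using hx.1

theorem IsScalarSpectral.integrable_spectralMatrix (h : IsScalarSpectral l m l0 m0 ν)
    {E : Type*} [NormedAddCommGroup E] [NormedSpace ℝ E] {f : ℝ → E}
    (hfm : StronglyMeasurable f) (hf : ContinuousOn f (Set.Ici 0)) (α β : Fin 2) :
    (spectralMatrix l m l0 m0 ν α β).Integrable f :=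
  integrable_withDensityV (h.integrable_of_continuous (continuous_numer α β))
    (continuous_numer α β).measurable hfm
    (h.integrable_of_continuousOn ((continuous_numer α β).continuousOn.smul hf))

theorem IsScalarSpectral.integral_spectralMatrix (h : IsScalarSpectral l m l0 m0 ν)
    {E : Type*} [NormedAddCommGroup E] [NormedSpace ℝ E] [CompleteSpace E] {f : ℝ → E}
    (hfm : StronglyMeasurable f) (hf : ContinuousOn f (Set.Ici 0)) (α β : Fin 2) :
    ∫ᵛ x, f x ∂<•(spectralMatrix l m l0 m0 ν α β) = ∫ x, numer l m l0 m0 x α β • f x ∂ν :=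
  integral_withDensityV (h.integrable_of_continuous (continuous_numer α β))
    (continuous_numer α β).measurable hfm
    (h.integrable_of_continuousOn ((continuous_numer α β).continuousOn.smul hf))

theorem variation_spectralMatrix (h : IsScalarSpectral l m l0 m0 ν) (α β : Fin 2) :
    (spectralMatrix l m l0 m0 ν α β).variation =
      ν.withDensity fun x => ‖numer l m l0 m0 x α β‖ₑ :=
  Measure.variation_withDensityᵥ (h.integrable_of_continuous (continuous_numer α β))

theorem IsScalarSpectral.variation_Iio (h : IsScalarSpectral l m l0 m0 ν) (α β : Fin 2) :
    (spectralMatrix l m l0 m0 ν α β).variation (Set.Iio 0) = 0 := by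
  rw [variation_spectralMatrix h]
  refine withDensity_absolutelyContinuous _ _ ?_
  refine measure_mono_null (fun x hx => ?_) h.ae_pos
  exact not_lt.2 (le_of_lt (Set.mem_Iio.1 hx))

theorem IsScalarSpectral.apply_zero (h : IsScalarSpectral l m l0 m0 ν) (α β : Fin 2) :
    spectralMatrix l m l0 m0 ν α β {0} = 0 := by
  have h0 : ν {0} = 0 := by
    refine measure_mono_null (fun x hx => ?_) h.ae_pos
    rw [Set.mem_singleton_iff] at hx
    simp [hx]
  rw [spectralMatrix, Matrix.of_apply,
    withDensityᵥ_apply (h.integrable_of_continuous (continuous_numer α β))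
      (measurableSet_singleton _), Measure.restrict_eq_zero.2 h0, integral_zero_measure]

/-- Completing the square: the form times the positive upper left entry is a square plus the
determinant times `v 1 ^ 2`. -/
theorem numer_form_nonneg (hl : 0 < l) (hm : 0 < m) (hl0 : 0 < l0) (hm0 : 0 < m0) {x : ℝ}
    (hx : 0 ≤ D l m l0 m0 x) (v : Fin 2 → ℝ) :
    0 ≤ ∑ α, ∑ β, v α * v β * numer l m l0 m0 x α β := by
  have hq : 0 < l0 * m + l * m0 := by positivity
  have hdet := numer_det (l := l) (m := m) (l0 := l0) hm0.ne' x
  have hD : 0 ≤ l0 / (2 * m0) * D l m l0 m0 x := by positivity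
  simp only [Fin.sum_univ_two, numer, Matrix.of_apply, Matrix.cons_val', Matrix.cons_val_zero,
    Matrix.cons_val_one, Matrix.cons_val_fin_one]
  set A := l0 * m + l * m0
  set B := l * (l0 + m0 - x)
  set C := -q22 l m l0 m0 x
  refine nonneg_of_mul_nonneg_right ?_ hq
  have : A * (v 0 * v 0 * A + v 0 * v 1 * B + (v 1 * v 0 * B + v 1 * v 1 * C)) =
      (v 0 * A + v 1 * B) ^ 2 + v 1 ^ 2 * (A * C - B ^ 2) := by ring
  rw [this, hdet]
  positivity

theorem IsScalarSpectral.posSemidef (h : IsScalarSpectral l m l0 m0 ν)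
    (hl : 0 < l) (hm : 0 < m) (hl0 : 0 < l0) (hm0 : 0 < m0) {S : Set ℝ} (hS : MeasurableSet S) :
    (Matrix.of fun α β => spectralMatrix l m l0 m0 ν α β S : Matrix (Fin 2) (Fin 2) ℝ).PosSemidef := by
  have hi : ∀ α β, Integrable (fun x => numer l m l0 m0 x α β) ν := fun α β =>
    h.integrable_of_continuous (continuous_numer α β)
  have hval : ∀ α β, spectralMatrix l m l0 m0 ν α β S = ∫ x in S, numer l m l0 m0 x α β ∂ν :=
    fun α β => withDensityᵥ_apply (hi α β) hS
  refine Matrix.PosSemidef.of_dotProduct_mulVec_nonneg ?_ fun v => ?_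
  · ext α β
    simp only [Matrix.conjTranspose_apply, Matrix.of_apply, hval, star_trivial]
    congr 1; ext x
    fin_cases α <;> fin_cases β <;> simp [numer]
  · have e : star v ⬝ᵥ ((Matrix.of fun α β => spectralMatrix l m l0 m0 ν α β S :
        Matrix (Fin 2) (Fin 2) ℝ).mulVec v) =
        ∫ x in S, ∑ α, ∑ β, v α * v β * numer l m l0 m0 x α β ∂ν := by
      rw [integral_finsetSum _ fun α _ => integrable_finsetSum _ fun β _ =>
        ((hi α β).integrableOn.const_mul _)]
      refine Finset.sum_congr rfl fun α _ => ?_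
      rw [integral_finsetSum _ fun β _ => ((hi α β).integrableOn.const_mul _)]
      simp only [Matrix.mulVec, dotProduct, Finset.mul_sum]
      refine Finset.sum_congr rfl fun β _ => ?_
      rw [integral_const_mul, Matrix.of_apply, hval, Pi.star_apply, star_trivial]
      ring
    rw [e]
    refine integral_nonneg_of_ae (ae_restrict_of_ae ?_)
    filter_upwards [h.D_nonneg] with x hx using numer_form_nonneg hl hm hl0 hm0 hx v

theorem continuousOn_inv_sub {z : ℂ} (hz : ¬ (0 ≤ z.re ∧ z.im = 0)) :
    ContinuousOn (fun x : ℝ => ((x : ℂ) - z)⁻¹) (Set.Ici 0) := by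
  refine ContinuousOn.inv₀ (by fun_prop) fun x hx h0 => hz ?_
  rw [← sub_eq_zero.1 h0]
  exact ⟨hx, Complex.ofReal_im x⟩

theorem stronglyMeasurable_inv_sub (z : ℂ) :
    StronglyMeasurable fun x : ℝ => ((x : ℂ) - z)⁻¹ :=
  (by fun_prop : Measurable fun x : ℝ => ((x : ℂ) - z)⁻¹).stronglyMeasurable

/-- Division by `x - z` leaves a linear quotient, whose integral needs only the mass and the mean of
`ν`. -/
theorem IsScalarSpectral.integral_quadratic_mul_inv (h : IsScalarSpectral l m l0 m0 ν) {z : ℂ}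
    (hz : ¬ (0 ≤ z.re ∧ z.im = 0)) (c2 c1 c0 : ℝ) :
    ∫ x : ℝ, ((c2 * x ^ 2 + c1 * x + c0 : ℝ) : ℂ) * ((x : ℂ) - z)⁻¹ ∂ν =
      (c2 * z ^ 2 + c1 * z + c0) * ∫ x : ℝ, ((x : ℂ) - z)⁻¹ ∂ν +
        (c2 * ((l0 + m0) / (l0 * m + l * m0)) + (c2 * z + c1) * (1 / (l0 * m + l * m0))) := by
  have h1 : Integrable (fun x : ℝ => ((x : ℂ) - z)⁻¹) ν :=
    h.integrable_of_continuousOn (continuousOn_inv_sub hz)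
  have h2 : Integrable (fun x : ℝ => (x : ℂ)) ν := h.integrable_of_continuous (by fun_prop)
  have h3 : Integrable (fun _ : ℝ => (1 : ℂ)) ν := h.integrable_of_continuous (by fun_prop)
  have e2 : ∫ x : ℝ, (x : ℂ) ∂ν = (l0 + m0) / (l0 * m + l * m0) := by
    rw [integral_complex_ofReal, h.mean]; push_cast; rfl
  have e3 : ∫ _ : ℝ, (1 : ℂ) ∂ν = 1 / (l0 * m + l * m0) := by
    have := integral_complex_ofReal (f := fun _ : ℝ => (1 : ℝ)) (μ := ν)
    rw [h.mass] at this
    simpa using this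
  have e : ∀ᵐ x : ℝ ∂ν, ((c2 * x ^ 2 + c1 * x + c0 : ℝ) : ℂ) * ((x : ℂ) - z)⁻¹ =
      (c2 * z ^ 2 + c1 * z + c0) * ((x : ℂ) - z)⁻¹ + (c2 * (x : ℂ) + (c2 * z + c1) * 1) := by
    filter_upwards [h.ae_pos] with x hx
    have hne : (x : ℂ) - z ≠ 0 := fun h0 => hz (by
      rw [← sub_eq_zero.1 h0]; exact ⟨hx.le, Complex.ofReal_im x⟩)
    push_cast
    field_simp
    ring
  have h23 : Integrable (fun x : ℝ => c2 * (x : ℂ) + (c2 * z + c1) * 1) ν :=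
    (h2.const_mul _).add (h3.const_mul _)
  rw [integral_congr_ae e, integral_add (h1.const_mul _) h23,
    integral_add (h2.const_mul _) (h3.const_mul _), integral_const_mul, integral_const_mul,
    integral_const_mul, e2, e3]

/-- Dividing `D` by `x - z` takes the value `D z` out of the integral; the contribution of the
quotient combines with `l + m - z` into `p11`. -/
theorem IsScalarSpectral.D_mul_integral (h : IsScalarSpectral l m l0 m0 ν)
    (hl : 0 < l) (hm : 0 < m) (hl0 : 0 < l0) (hm0 : 0 < m0) {z : ℂ}
    (hz : ¬ (0 ≤ z.re ∧ z.im = 0)) :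
    D (l : ℂ) m l0 m0 z * ∫ x : ℝ, ((x : ℂ) - z)⁻¹ ∂ν =
      p11 (l : ℂ) m l0 m0 z / (l0 * m + l * m0) - sqrtBranch l m z := by
  have h1 := h.D_mul_stieltjes z hz
  have e : ∀ x : ℝ, D l m l0 m0 x = (-2 * l0 * m - 2 * m0 * l + 2 * l * m) * x ^ 2 +
      (2 * l0 ^ 2 * m + 2 * l0 * m0 * l + 2 * l0 * m0 * m - 2 * l0 * l * m + 2 * l0 * m ^ 2
        + 2 * m0 ^ 2 * l + 2 * m0 * l ^ 2 - 2 * m0 * l * m) * x +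
        (- 2 * l0 * m0 * (l - m) ^ 2) := by intro x; rw [D]; ring
  simp_rw [e] at h1
  rw [h.integral_quadratic_mul_inv hz] at h1
  have hq : (l0 * m + l * m0 : ℂ) ≠ 0 := by
    exact_mod_cast (by positivity : 0 < l0 * m + l * m0).ne'
  have hq' : (l0 * m + m0 * l : ℂ) ≠ 0 := by rwa [mul_comm (m0 : ℂ)]
  push_cast at h1
  have hp : p11 (l : ℂ) m l0 m0 z / (l0 * m + l * m0) = (l + m - z) -
      ((-2 * l0 * m - 2 * m0 * l + 2 * l * m) * ((l0 + m0) / (l0 * m + l * m0)) +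
      ((-2 * l0 * m - 2 * m0 * l + 2 * l * m) * z +
      (2 * l0 ^ 2 * m + 2 * l0 * m0 * l + 2 * l0 * m0 * m - 2 * l0 * l * m + 2 * l0 * m ^ 2
        + 2 * m0 ^ 2 * l + 2 * m0 * l ^ 2 - 2 * m0 * l * m)) * (1 / (l0 * m + l * m0))) := by
    rw [p11]; field_simp; ring
  rw [hp, D]
  linear_combination h1

theorem IsScalarSpectral.integral_numer_mul_inv (h : IsScalarSpectral l m l0 m0 ν)
    (hl : 0 < l) (hm : 0 < m) (hl0 : 0 < l0) (hm0 : 0 < m0) {z : ℂ}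
    (hz : ¬ (0 ≤ z.re ∧ z.im = 0)) (α β : Fin 2) :
    D (l : ℂ) m l0 m0 z * ∫ x : ℝ, numer l m l0 m0 x α β • ((x : ℂ) - z)⁻¹ ∂ν =
      pMat (l : ℂ) m l0 m0 z α β + qMat (l : ℂ) m l0 m0 z α β * sqrtBranch l m z := by
  have hD := h.D_mul_integral hl hm hl0 hm0 hz
  have hq : (l0 * m + l * m0 : ℂ) ≠ 0 := by
    exact_mod_cast (by positivity : 0 < l0 * m + l * m0).ne'
  have hq' : (l0 * m + m0 * l : ℂ) ≠ 0 := by rwa [mul_comm (m0 : ℂ)]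
  have hm0' : (m0 : ℂ) ≠ 0 := by exact_mod_cast hm0.ne'
  set J := ∫ x : ℝ, ((x : ℂ) - z)⁻¹ ∂ν
  set s := sqrtBranch l m z
  -- Eliminating the square root in favour of `J` makes the formula for each entry a rational
  -- identity that is linear in `J`.
  have hs : s = p11 (l : ℂ) m l0 m0 z / (l0 * m + l * m0) - D (l : ℂ) m l0 m0 z * J := by
    rw [hD]; ring
  have key : ∀ c2 c1 c0 : ℝ, (∀ x, numer l m l0 m0 x α β = c2 * x ^ 2 + c1 * x + c0) →
      ∫ x : ℝ, numer l m l0 m0 x α β • ((x : ℂ) - z)⁻¹ ∂ν = (c2 * z ^ 2 + c1 * z + c0) * J +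
        (c2 * ((l0 + m0) / (l0 * m + l * m0)) + (c2 * z + c1) * (1 / (l0 * m + l * m0))) := by
    intro c2 c1 c0 hc
    rw [← h.integral_quadratic_mul_inv hz]
    simp_rw [hc, Complex.real_smul]
  have h12 : (∀ x, numer l m l0 m0 x α β = 0 * x ^ 2 + (-l) * x + l * (l0 + m0)) →
      D (l : ℂ) m l0 m0 z * ∫ x : ℝ, numer l m l0 m0 x α β • ((x : ℂ) - z)⁻¹ ∂ν =
      p12 (l : ℂ) m l0 m0 z + q12 (l : ℂ) l0 m0 z * s := by
    intro hc
    rw [key _ _ _ hc, hs, p12, q12, p11, D]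
    push_cast
    field_simp
    ring
  fin_cases α <;> fin_cases β
  · have := key 0 0 (l0 * m + l * m0) (fun x => by simp [numer])
    simp only [Fin.zero_eta, Fin.isValue, pMat, qMat, Matrix.of_apply, Matrix.cons_val',
      Matrix.cons_val_zero, Matrix.cons_val_fin_one] at this ⊢
    rw [this, hs, q11]
    push_cast
    field_simp
    ring
  · exact h12 (fun x => by simp [numer]; ring)
  · exact h12 (fun x => by simp [numer]; ring)
  · have := key ((l - l0) / m0) ((l0 ^ 2 + l0 * m0 - l0 * l + l0 * m - 2 * m0 * l) / m0)
      (2 * l0 * l - l0 * m + m0 * l) (fun x => by simp [numer, q22]; field_simp)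
    simp only [Fin.mk_one, Fin.isValue, pMat, qMat, Matrix.of_apply, Matrix.cons_val',
      Matrix.cons_val_one, Matrix.cons_val_fin_one] at this ⊢
    rw [this, hs, p22, q22, p11, D]
    push_cast
    field_simp
    ring

theorem IsScalarSpectral.stieltjes_spectralMatrix (h : IsScalarSpectral l m l0 m0 ν)
    (hl : 0 < l) (hm : 0 < m) (hl0 : 0 < l0) (hm0 : 0 < m0) {z : ℂ}
    (hz : ¬ (0 ≤ z.re ∧ z.im = 0)) (α β : Fin 2) :
    (spectralMatrix l m l0 m0 ν α β).Integrable (fun x : ℝ => ((x : ℂ) - z)⁻¹) ∧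
    (D (l : ℂ) m l0 m0 z ≠ 0 → stieltjes (spectralMatrix l m l0 m0 ν α β) z =
      (pMat (l : ℂ) m l0 m0 z α β + qMat (l : ℂ) m l0 m0 z α β * sqrtBranch l m z) /
        D (l : ℂ) m l0 m0 z) := by
  refine ⟨h.integrable_spectralMatrix (stronglyMeasurable_inv_sub z) (continuousOn_inv_sub hz) α β,
    fun hD => ?_⟩
  rw [eq_div_iff hD, mul_comm, stieltjes, h.integral_spectralMatrix (stronglyMeasurable_inv_sub z)
    (continuousOn_inv_sub hz), h.integral_numer_mul_inv hl hm hl0 hm0 hz]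

end

/-! ### The spectral matrix near the origin -/

section

variable {l m l0 m0 : ℝ} {ν : Measure ℝ}

/-- The boundary relation for the Stieltjes transform on the negative half line. -/
theorem IsScalarSpectral.D_mul_integral_real (h : IsScalarSpectral l m l0 m0 ν)
    (hl : 0 < l) (hm : 0 < m) (hl0 : 0 < l0) (hm0 : 0 < m0) {θ : ℝ} (hθ : 0 < θ) :
    ∃ s : ℝ, 0 < s ∧ s ^ 2 = (l + m + θ) ^ 2 - 4 * l * m ∧
      D l m l0 m0 (-θ) * ∫ x, (x + θ)⁻¹ ∂ν = p11 l m l0 m0 (-θ) / (l0 * m + l * m0) - s := by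
  obtain ⟨s, hs0, hs⟩ := sqrtBranch_pos l m (neg_lt_zero.2 hθ)
  have h1 := sqrtBranch_sq hl.le hm.le ((-θ : ℝ) : ℂ)
  have h2 := h.D_mul_integral hl hm hl0 hm0 (z := ((-θ : ℝ) : ℂ))
    (by rw [Complex.ofReal_re]; intro h; linarith [h.1])
  rw [hs] at h1 h2
  refine ⟨s, hs0, ?_, ?_⟩
  · have : ((s ^ 2 : ℝ) : ℂ) = (((l + m + θ) ^ 2 - 4 * l * m : ℝ) : ℂ) := by
      push_cast at h1 ⊢; rw [h1]; ring
    exact_mod_cast this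
  · have e1 : ∫ x : ℝ, ((x : ℂ) - ((-θ : ℝ) : ℂ))⁻¹ ∂ν = ((∫ x, (x + θ)⁻¹ ∂ν : ℝ) : ℂ) := by
      rw [← integral_complex_ofReal]; congr 1; ext x; push_cast; rw [sub_neg_eq_add]
    have e2 : D (l : ℂ) m l0 m0 ((-θ : ℝ) : ℂ) = ((D l m l0 m0 (-θ) : ℝ) : ℂ) := by
      simp only [D]; push_cast; ring
    have e3 : p11 (l : ℂ) m l0 m0 ((-θ : ℝ) : ℂ) = ((p11 l m l0 m0 (-θ) : ℝ) : ℂ) := by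
      simp only [p11]; push_cast; ring
    rw [e1, e2, e3] at h2
    exact_mod_cast h2

/-- For `l = m` both `D (-θ)` and `p11 (-θ)` are `O(θ)`. If `x⁻¹` were integrable, the integrals of
`(x + θ)⁻¹` would stay bounded, and the square root would be `O(θ)`; but its square is `4 * l * θ +
θ ^ 2`. -/
theorem IsScalarSpectral.not_integrable_inv (h : IsScalarSpectral l l l0 m0 ν)
    (hl : 0 < l) (hl0 : 0 < l0) (hm0 : 0 < m0) : ¬ Integrable (fun x => x⁻¹) ν := by
  intro hint
  have hq : 0 < l0 * l + l * m0 := by positivity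
  set M := ∫ x, x⁻¹ ∂ν
  set A := -2 * l0 * l - 2 * m0 * l + 2 * l * l
  set A' := 2 * l0 ^ 2 * l + 2 * l0 * m0 * l + 2 * l0 * m0 * l - 2 * l0 * l * l + 2 * l0 * l ^ 2
    + 2 * m0 ^ 2 * l + 2 * m0 * l ^ 2 - 2 * m0 * l * l
  have hD : ∀ x, D l l l0 m0 x = x * (A * x + A') := by intro x; simp only [D, A, A']; ring
  set c := l0 * l + m0 * l - 2 * l * l
  have hp : ∀ x, p11 l l l0 m0 x = c * x := by intro x; simp only [p11, c]; ring
  set K := |c| / (l0 * l + l * m0) + (|A| + |A'|) * M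
  have hM : 0 ≤ M := integral_nonneg_of_ae (by
    filter_upwards [h.ae_pos] with x hx using inv_nonneg.2 hx.le)
  have hK : 0 ≤ K := by positivity
  have key : ∀ θ : ℝ, 0 < θ → θ ≤ 1 → 4 * l ≤ K ^ 2 * θ := by
    intro θ hθ hθ1
    obtain ⟨s, hs, hs2, hB⟩ := h.D_mul_integral_real hl hl hl0 hm0 hθ
    have hb0 : 0 ≤ ∫ x, (x + θ)⁻¹ ∂ν := integral_nonneg_of_ae (by
      filter_upwards [h.ae_pos] with x hx using inv_nonneg.2 (by linarith))
    have hbM : ∫ x, (x + θ)⁻¹ ∂ν ≤ M := by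
      refine integral_mono_of_nonneg ?_ hint ?_
      · filter_upwards [h.ae_pos] with x hx using inv_nonneg.2 (by linarith)
      · filter_upwards [h.ae_pos] with x hx using inv_anti₀ hx (by linarith)
    set b := ∫ x, (x + θ)⁻¹ ∂ν
    rw [hD, hp] at hB
    have hsK : s ≤ K * θ := by
      have e : s = θ * (-c / (l0 * l + l * m0) + (A * -θ + A') * b) := by
        have : s = c * -θ / (l0 * l + l * m0) - -θ * (A * -θ + A') * b := by linarith
        rw [this]; ring
      rw [e, mul_comm]
      refine mul_le_mul_of_nonneg_right (add_le_add ?_ ?_) hθ.le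
      · exact div_le_div_of_nonneg_right (neg_le_abs c) hq.le
      · refine mul_le_mul ?_ hbM hb0 (by positivity)
        refine add_le_add ?_ (le_abs_self _)
        calc A * -θ = -A * θ := by ring
          _ ≤ |A| * 1 := mul_le_mul (neg_le_abs _) hθ1 hθ.le (abs_nonneg _)
          _ = |A| := mul_one _
    have h1 : s ^ 2 ≤ (K * θ) ^ 2 := pow_le_pow_left₀ hs.le hsK 2
    have h2 : θ * (4 * l) ≤ θ * (K ^ 2 * θ) := by nlinarith [sq_nonneg θ]
    exact le_of_mul_le_mul_left h2 hθ
  have hθ : 0 < min 1 (2 * l / (K ^ 2 + 1)) := lt_min one_pos (by positivity)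
  have h1 := key _ hθ (min_le_left _ _)
  have h2 : K ^ 2 * min 1 (2 * l / (K ^ 2 + 1)) ≤ 2 * l := by
    calc K ^ 2 * min 1 (2 * l / (K ^ 2 + 1)) ≤ (K ^ 2 + 1) * (2 * l / (K ^ 2 + 1)) :=
          mul_le_mul (by linarith) (min_le_right _ _) hθ.le (by positivity)
      _ = 2 * l := by field_simp
  linarith

/-- A diagonal entry differs from its value at `0` by a multiple of `x`. Since that value is
positive when `l = m`, integrability of the entry times `x⁻¹` would imply integrability of `x⁻¹`. -/
theorem numer_diag (α : Fin 2) : ∃ c2 c1 : ℝ, ∀ x, numer l m l0 m0 x α α =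
    numer l m l0 m0 0 α α + x * (c2 * x + c1) := by
  fin_cases α
  · exact ⟨0, 0, fun x => by simp [numer]⟩
  · exact ⟨1 / m0 * (l - l0), 1 / m0 * (l0 ^ 2 + l0 * m0 - l0 * l + l0 * m - 2 * m0 * l),
      fun x => by simp [numer, q22]; ring⟩

theorem numer_diag_zero_pos (hl : 0 < l) (hl0 : 0 < l0) (hm0 : 0 < m0) (α : Fin 2) :
    0 < numer l l l0 m0 0 α α := by
  fin_cases α
  · simp only [numer, Fin.zero_eta, Matrix.of_apply, Matrix.cons_val', Matrix.cons_val_zero,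
      Matrix.cons_val_fin_one]
    positivity
  · have : numer l l l0 m0 0 1 1 = l * (l0 + m0) := by
      simp [numer, q22]; field_simp; ring
    simp only [Fin.mk_one, this]
    positivity

theorem IsScalarSpectral.not_integrable_numer_mul_inv (h : IsScalarSpectral l l l0 m0 ν)
    (hl : 0 < l) (hl0 : 0 < l0) (hm0 : 0 < m0) (α : Fin 2) :
    ¬ Integrable (fun x => numer l l l0 m0 x α α * x⁻¹) ν := by
  intro hint
  obtain ⟨c2, c1, hc⟩ := numer_diag (l := l) (m := l) (l0 := l0) (m0 := m0) α
  have hpos := numer_diag_zero_pos hl hl0 hm0 α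
  refine h.not_integrable_inv hl hl0 hm0 ?_
  have h2 : Integrable (fun x => c2 * x + c1) ν := h.integrable_of_continuous (by fun_prop)
  refine ((hint.sub h2).const_mul (numer l l l0 m0 0 α α)⁻¹).congr ?_
  filter_upwards [h.ae_pos] with x hx
  have h3 := hc x
  rw [Pi.sub_apply]
  field_simp
  linarith

theorem IsScalarSpectral.lintegral_inv_eq (h : IsScalarSpectral l m l0 m0 ν) (α : Fin 2) :
    ∫⁻ x, (ENNReal.ofReal x)⁻¹ ∂(spectralMatrix l m l0 m0 ν α α).variation =
      ∫⁻ x, ‖numer l m l0 m0 x α α * x⁻¹‖ₑ ∂ν := by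
  rw [variation_spectralMatrix h, lintegral_withDensity_eq_lintegral_mul _
    ((continuous_numer α α).measurable.enorm) (by fun_prop)]
  refine lintegral_congr_ae ?_
  filter_upwards [h.ae_pos] with x hx
  rw [Pi.mul_apply, enorm_mul, ← ENNReal.ofReal_inv_of_pos hx,
    Real.enorm_of_nonneg (inv_nonneg.2 hx.le)]

theorem IsScalarSpectral.lintegral_inv_lt_top_iff (h : IsScalarSpectral l m l0 m0 ν)
    (hl : 0 < l) (hl0 : 0 < l0) (hm0 : 0 < m0) (α : Fin 2) :
    ∫⁻ x, (ENNReal.ofReal x)⁻¹ ∂(spectralMatrix l m l0 m0 ν α α).variation < ⊤ ↔ l ≠ m := by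
  have hmeas : AEStronglyMeasurable (fun x => numer l m l0 m0 x α α * x⁻¹) ν :=
    ((continuous_numer α α).measurable.mul measurable_inv).aestronglyMeasurable
  rw [h.lintegral_inv_eq]
  constructor
  · rintro hlt rfl
    exact h.not_integrable_numer_mul_inv hl hl0 hm0 α ⟨hmeas, hlt⟩
  · intro hlm
    obtain ⟨ε, hε, hae⟩ := h.away hlm
    have : Integrable (fun x => numer l m l0 m0 x α α * x⁻¹) ν := by
      refine ((h.integrable_of_continuous (continuous_numer (l := l) (m := m) (l0 := l0)
        (m0 := m0) α α)).norm.mul_const ε⁻¹).mono' hmeas ?_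
      filter_upwards [hae] with x hx
      rw [norm_mul]
      refine mul_le_mul_of_nonneg_left ?_ (norm_nonneg _)
      rw [Real.norm_of_nonneg (inv_nonneg.2 (hε.le.trans hx))]
      exact inv_anti₀ hε hx
    exact this.2

end

/-! ### Orthogonality with respect to the potential coefficients -/

section orthogonality

variable {l m : ℤ → ℝ}

/-- Detailed balance, valid across the two branches of the definition. -/
theorem potCoef_succ (hl : ∀ n, l n ≠ 0) (hm : ∀ n, m n ≠ 0) (j : ℤ) :
    potCoef l m (j + 1) * m (j + 1) = potCoef l m j * l j := by
  rcases j with n | n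
  · have h1 : potCoef l m (Int.ofNat n + 1) = potCoef l m (Int.ofNat n) * (l n / m (n + 1)) :=
      Finset.prod_range_succ (fun k : ℕ => l k / m (k + 1)) n
    have h2 := hm (n + 1)
    rw [h1, show Int.ofNat n = (n : ℤ) from rfl]
    field_simp
  · rcases n with _ | n
    · have h1 : potCoef l m (Int.negSucc 0) = m 0 / l (-1) := by simp [potCoef]
      have h2 : potCoef l m (Int.negSucc 0 + 1) = 1 := by
        rw [show Int.negSucc 0 + 1 = Int.ofNat 0 from rfl, potCoef]; simp
      have h3 := hl (-1)
      rw [h1, h2, show Int.negSucc 0 = -1 from rfl, show (-1 + 1 : ℤ) = 0 from rfl]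
      field_simp
    · have h1 : potCoef l m (Int.negSucc (n + 1)) = potCoef l m (Int.negSucc n) *
          (m (-((n + 1 : ℕ) : ℤ)) / l (-((n + 1 : ℕ) : ℤ) - 1)) :=
        Finset.prod_range_succ (fun k : ℕ => m (-k) / l (-k - 1)) (n + 1)
      have h2 : Int.negSucc (n + 1) + 1 = Int.negSucc n := by omega
      have h3 : Int.negSucc n = -((n + 1 : ℕ) : ℤ) := by omega
      have h4 : Int.negSucc (n + 1) = -((n + 1 : ℕ) : ℤ) - 1 := by omega
      have h5 := hl (-((n + 1 : ℕ) : ℤ) - 1)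
      rw [h2, h1, h3, h4]
      field_simp

theorem potCoef_pos (hl : ∀ n, 0 < l n) (hm : ∀ n, 0 < m n) (j : ℤ) : 0 < potCoef l m j := by
  rcases j with n | n
  · exact Finset.prod_pos fun k _ => div_pos (hl _) (hm _)
  · exact Finset.prod_pos fun k _ => div_pos (hm _) (hl _)

/-- Detailed balance makes the generator symmetric with respect to the potential coefficients, so
the diagonal matrix of their inverses satisfies the recurrence in rows and in columns alike. -/
theorem delta_recurrence (hl : ∀ n, 0 < l n) (hm : ∀ n, 0 < m n) (i j : ℤ) :
    l i * (if i + 1 = j then (potCoef l m j)⁻¹ else 0) -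
        (l i + m i) * (if i = j then (potCoef l m j)⁻¹ else 0) +
        m i * (if i - 1 = j then (potCoef l m j)⁻¹ else 0) =
      l j * (if i = j + 1 then (potCoef l m (j + 1))⁻¹ else 0) -
        (l j + m j) * (if i = j then (potCoef l m j)⁻¹ else 0) +
        m j * (if i = j - 1 then (potCoef l m (j - 1))⁻¹ else 0) := by
  have h1 := potCoef_succ (fun n => (hl n).ne') (fun n => (hm n).ne')
  have h2 := potCoef_pos hl hm
  by_cases e1 : i = j
  · subst e1; simp [show ¬ (i = i - 1) by omega]
  · by_cases e2 : i = j + 1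
    · subst e2
      have h3 := h1 j
      have h4 := (h2 j).ne'
      have h5 := (h2 (j + 1)).ne'
      simp only [add_sub_cancel_right, if_true, one_ne_zero, add_eq_left, if_false,
        mul_zero, show j + 1 + 1 ≠ j by omega, show j + 1 ≠ j - 1 by omega, sub_zero, add_zero,
        zero_add]
      field_simp
      linarith
    · by_cases e3 : i = j - 1
      · subst e3
        have h3 := h1 (j - 1)
        rw [sub_add_cancel] at h3
        have h4 := (h2 j).ne'
        have h5 := (h2 (j - 1)).ne'
        simp only [sub_add_cancel, if_true, e1, e2, if_false, mul_zero, sub_zero,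
          show j - 1 - 1 ≠ j by omega, add_zero, zero_add]
        field_simp
        linarith
      · simp [e1, e2, e3, show i + 1 ≠ j by omega, show i - 1 ≠ j by omega]

/-- `hrec` determines each column from the two adjacent ones, so the columns `0` and `-1` determine
the array. The diagonal array of inverse potential coefficients solves the same recurrence. -/
theorem orthogonality (hl : ∀ n, 0 < l n) (hm : ∀ n, 0 < m n) {M : ℤ → ℤ → ℝ}
    (hrec : ∀ i j, l i * M (i + 1) j - (l i + m i) * M i j + m i * M (i - 1) j =
      l j * M i (j + 1) - (l j + m j) * M i j + m j * M i (j - 1))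
    (h0 : ∀ i, M i 0 = if i = 0 then (potCoef l m 0)⁻¹ else 0)
    (h1 : ∀ i, M i (-1) = if i = -1 then (potCoef l m (-1))⁻¹ else 0) (i j : ℤ) :
    M i j = if i = j then (potCoef l m j)⁻¹ else 0 := by
  have key : ∀ j, (∀ i, M i j = if i = j then (potCoef l m j)⁻¹ else 0) ∧
      (∀ i, M i (j - 1) = if i = j - 1 then (potCoef l m (j - 1))⁻¹ else 0) := by
    intro j
    induction j using Int.induction_on with
    | zero => exact ⟨h0, h1⟩
    | succ j ih =>
      refine ⟨fun i => ?_, by simpa using ih.1⟩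
      have e := hrec i j
      rw [ih.1, ih.1, ih.1, ih.2, delta_recurrence hl hm] at e
      have : l j * M i (j + 1) = l j * (if i = j + 1 then (potCoef l m (j + 1))⁻¹ else 0) := by
        linarith
      exact mul_left_cancel₀ (hl j).ne' this
    | pred j ih =>
      refine ⟨ih.2, fun i => ?_⟩
      have e := hrec i (-j - 1)
      have e' := ih.1 i
      rw [ih.2, ih.2, ih.2, delta_recurrence hl hm, sub_add_cancel, e'] at e
      have : m (-j - 1) * M i (-j - 1 - 1) = m (-j - 1) *
          (if i = -j - 1 - 1 then (potCoef l m (-j - 1 - 1))⁻¹ else 0) := by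
        linarith
      exact mul_left_cancel₀ (hm _).ne' this
  exact (key j).1 i

theorem Q_eval_recurrence (hl : ∀ n, 0 < l n) (hm : ∀ n, 0 < m n) (α : Fin 2) (n : ℤ) (x : ℝ) :
    -x * (Q l m α n).eval x = l n * (Q l m α (n + 1)).eval x -
      (l n + m n) * (Q l m α n).eval x + m n * (Q l m α (n - 1)).eval x := by
  have := congrArg (Polynomial.eval x)
    (Q_recurrence l m (fun n => (hl n).ne') (fun n => (hm n).ne') α n)
  simpa only [eval_mul, eval_add, eval_sub, eval_neg, eval_X, eval_C] using this

/-- Geometric growth in the state, uniform for `|x| ≤ B`; it supplies the growth hypothesis of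
`backward_unique`. -/
theorem abs_le_pow_of_recurrence {q : ℤ → ℝ} {x δ c B ρ : ℝ} (hδ : 0 < δ)
    (hrec : ∀ n, -x * q n = l n * q (n + 1) - (l n + m n) * q n + m n * q (n - 1))
    (hl : ∀ n, δ ≤ l n ∧ l n ≤ c) (hm : ∀ n, δ ≤ m n ∧ m n ≤ c) (hx : |x| ≤ B)
    (h0 : |q 0| ≤ 1) (h1 : |q (-1)| ≤ 1) (hρ : 1 ≤ ρ) (hρ2 : 3 * c + B ≤ δ * ρ) (i : ℤ) :
    |q i| ≤ ρ ^ i.natAbs := by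
  have hB : 0 ≤ B := (abs_nonneg _).trans hx
  have hc : 0 < c := hδ.trans_le ((hl 0).1.trans (hl 0).2)
  -- Here `r` is the rate towards the new state and `s` the opposite one, so the same estimate
  -- serves upwards and downwards.
  have step : ∀ (r s a b y z : ℝ), (δ ≤ r ∧ r ≤ c) → (δ ≤ s ∧ s ≤ c) →
      -x * a = r * y - (r + s) * a + s * b → 0 ≤ z → |a| ≤ z → |b| ≤ z → |y| ≤ ρ * z := by
    intro r s a b y z hr hs he hz ha hb
    have hr0 : 0 < r := hδ.trans_le hr.1
    have hs0 : 0 < s := hδ.trans_le hs.1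
    have e : r * y = ((r + s) - x) * a - s * b := by linarith
    have h2 : |r * y| ≤ (3 * c + B) * z := by
      rw [e]
      calc |((r + s) - x) * a - s * b| ≤ |((r + s) - x) * a| + |s * b| := abs_sub _ _
        _ = |(r + s) - x| * |a| + s * |b| := by rw [abs_mul, abs_mul, abs_of_pos hs0]
        _ ≤ (2 * c + B) * z + c * z := by
          refine add_le_add (mul_le_mul ?_ ha (abs_nonneg _) (by positivity))
            (mul_le_mul hs.2 hb (abs_nonneg _) hc.le)
          calc |(r + s) - x| ≤ |r + s| + |x| := abs_sub _ _
            _ ≤ 2 * c + B := by rw [abs_of_pos (by linarith)]; linarith [hr.2, hs.2]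
        _ = (3 * c + B) * z := by ring
    rw [abs_mul, abs_of_pos hr0] at h2
    have h3 : δ * |y| ≤ δ * (ρ * z) := by
      calc δ * |y| ≤ r * |y| := mul_le_mul_of_nonneg_right hr.1 (abs_nonneg _)
        _ ≤ (3 * c + B) * z := h2
        _ ≤ δ * ρ * z := mul_le_mul_of_nonneg_right hρ2 hz
        _ = δ * (ρ * z) := by ring
    exact le_of_mul_le_mul_left h3 hδ
  have hmono : ∀ n : ℕ, ρ ^ n ≤ ρ ^ (n + 1) := fun n => pow_le_pow_right₀ hρ (Nat.le_succ n)
  have up : ∀ n : ℕ, |q n| ≤ ρ ^ n ∧ |q (n - 1)| ≤ ρ ^ n := by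
    intro n
    induction n with
    | zero => exact ⟨by simpa using h0, by simpa using h1⟩
    | succ n ih =>
      push_cast
      refine ⟨?_, by rw [add_sub_cancel_right]; exact ih.1.trans (hmono n)⟩
      have := step _ _ _ _ _ (ρ ^ n) (hl n) (hm n) (hrec n) (by positivity) ih.1 ih.2
      rwa [pow_succ']
  have down : ∀ n : ℕ, |q (-n - 1)| ≤ ρ ^ n ∧ |q (-n)| ≤ ρ ^ n := by
    intro n
    induction n with
    | zero => exact ⟨by simpa using h1, by simpa using h0⟩
    | succ n ih =>
      push_cast
      have e : (-((n : ℤ) + 1)) = -n - 1 := by ring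
      rw [e]
      refine ⟨?_, ih.1.trans (hmono n)⟩
      have h3 := hrec (-n - 1)
      rw [sub_add_cancel] at h3
      have := step _ _ _ _ (q (-n - 1 - 1)) (ρ ^ n) (hm (-n - 1)) (hl (-n - 1))
        (by rw [h3]; ring) (by positivity) ih.1 ih.2
      rwa [pow_succ']
  rcases i with n | n
  · exact (up n).1
  · have h2 := (down n).1
    rw [show (-(n : ℤ) - 1) = Int.negSucc n by omega] at h2
    exact h2.trans (hmono n)

end orthogonality

/-! ### Moments of the orthogonal polynomials -/

section moments

open Filter Topology

variable {l m l0 m0 : ℝ} {ν : Measure ℝ}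

theorem defectRate_zero (r r0 : ℝ) : defectRate r r0 0 = r0 := if_pos rfl

theorem defectRate_of_ne (r r0 : ℝ) {n : ℤ} (hn : n ≠ 0) : defectRate r r0 n = r := if_neg hn

theorem defectRate_pos {r r0 : ℝ} (hr : 0 < r) (hr0 : 0 < r0) (n : ℤ) : 0 < defectRate r r0 n := by
  rw [defectRate]; split_ifs <;> assumption

/-- The rows `∑ α, Q α i * numer α β`. -/
noncomputable def kern (l m l0 m0 : ℝ) (i : ℤ) (β : Fin 2) (x : ℝ) : ℝ :=
  ∑ α, (Q (defectRate l l0) (defectRate m m0) α i).eval x * numer l m l0 m0 x α β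

theorem continuous_kern (i : ℤ) (β : Fin 2) : Continuous (kern l m l0 m0 i β) :=
  continuous_finsetSum _ fun α _ => (Polynomial.continuous _).mul (continuous_numer α β)

theorem kern_zero (β : Fin 2) (x : ℝ) : kern l m l0 m0 0 β x = numer l m l0 m0 x 0 β := by
  obtain ⟨h1, h2, -, -⟩ := Q_initial (defectRate l l0) (defectRate m m0)
  simp [kern, h1, h2]

theorem kern_neg_one (β : Fin 2) (x : ℝ) : kern l m l0 m0 (-1) β x = numer l m l0 m0 x 1 β := by
  obtain ⟨-, -, h1, h2⟩ := Q_initial (defectRate l l0) (defectRate m m0)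
  simp [kern, h1, h2]

theorem kern_recurrence (hl : 0 < l) (hm : 0 < m) (hl0 : 0 < l0) (hm0 : 0 < m0) (i : ℤ)
    (β : Fin 2) (x : ℝ) : -x * kern l m l0 m0 i β x =
      defectRate l l0 i * kern l m l0 m0 (i + 1) β x -
        (defectRate l l0 i + defectRate m m0 i) * kern l m l0 m0 i β x +
        defectRate m m0 i * kern l m l0 m0 (i - 1) β x := by
  have h := fun α => Q_eval_recurrence (defectRate_pos hl hl0) (defectRate_pos hm hm0) α i x
  simp only [kern, Fin.sum_univ_two]
  linear_combination numer l m l0 m0 x 0 β * h 0 + numer l m l0 m0 x 1 β * h 1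

/-- At the spectral parameter `-θ` with `θ > 0` everything is real. The moments are the defects in
the resolvent recurrence and are recovered by letting `θ → ∞`. -/
noncomputable def resolvent (l m l0 m0 : ℝ) (ν : Measure ℝ) (i : ℤ) (β : Fin 2) (θ : ℝ) : ℝ :=
  ∫ x, kern l m l0 m0 i β x * (x + θ)⁻¹ ∂ν

noncomputable def moment (l m l0 m0 : ℝ) (ν : Measure ℝ) (i : ℤ) (β : Fin 2) : ℝ :=
  ∫ x, kern l m l0 m0 i β x ∂ν

namespace IsScalarSpectral

theorem integrable_kern_mul_inv (h : IsScalarSpectral l m l0 m0 ν) (i : ℤ) (β : Fin 2) {θ : ℝ}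
    (hθ : 0 < θ) : Integrable (fun x => kern l m l0 m0 i β x * (x + θ)⁻¹) ν := by
  refine h.integrable_of_continuousOn ((continuous_kern i β).continuousOn.mul
    (ContinuousOn.inv₀ (by fun_prop) fun x hx => ?_))
  have : 0 ≤ x := hx
  positivity

/-- From `θ / (x + θ) - 1 = -x / (x + θ)`: multiplication by `-x` is the three-term recurrence of
the rows. -/
theorem resolvent_recurrence (h : IsScalarSpectral l m l0 m0 ν)
    (hl : 0 < l) (hm : 0 < m) (hl0 : 0 < l0) (hm0 : 0 < m0) (i : ℤ) (β : Fin 2) {θ : ℝ}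
    (hθ : 0 < θ) : θ * resolvent l m l0 m0 ν i β θ - moment l m l0 m0 ν i β =
      defectRate l l0 i * resolvent l m l0 m0 ν (i + 1) β θ -
        (defectRate l l0 i + defectRate m m0 i) * resolvent l m l0 m0 ν i β θ +
        defectRate m m0 i * resolvent l m l0 m0 ν (i - 1) β θ := by
  have hi := fun j => h.integrable_kern_mul_inv j β hθ
  have hsub : Integrable (fun x => defectRate l l0 i * (kern l m l0 m0 (i + 1) β x * (x + θ)⁻¹) -
      (defectRate l l0 i + defectRate m m0 i) * (kern l m l0 m0 i β x * (x + θ)⁻¹)) ν :=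
    ((hi _).const_mul _).sub ((hi _).const_mul _)
  simp only [resolvent, moment]
  rw [← integral_const_mul, ← integral_const_mul, ← integral_const_mul, ← integral_const_mul,
    ← integral_sub ((hi i).const_mul _) (h.integrable_of_continuous (continuous_kern i β)),
    ← integral_sub ((hi _).const_mul _) ((hi _).const_mul _),
    ← integral_add hsub ((hi _).const_mul _)]
  refine integral_congr_ae ?_
  filter_upwards [h.ae_pos] with x hx
  have hrec := kern_recurrence hl hm hl0 hm0 i β x
  have hne : x + θ ≠ 0 := by positivity
  have e : θ * (kern l m l0 m0 i β x * (x + θ)⁻¹) - kern l m l0 m0 i β x =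
      -x * kern l m l0 m0 i β x * (x + θ)⁻¹ := by field_simp; ring
  simp only [e, hrec]
  ring

theorem tendsto_resolvent (h : IsScalarSpectral l m l0 m0 ν) (i : ℤ) (β : Fin 2) :
    Tendsto (resolvent l m l0 m0 ν i β) atTop (𝓝 0) := by
  refine squeeze_zero_norm' (a := fun θ : ℝ => (∫ x, ‖kern l m l0 m0 i β x‖ ∂ν) * θ⁻¹) ?_ ?_
  · filter_upwards [eventually_gt_atTop 0] with θ hθ
    rw [← integral_mul_const]
    refine norm_integral_le_of_norm_le
      ((h.integrable_of_continuous (continuous_kern i β)).norm.mul_const _) ?_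
    filter_upwards [h.ae_pos] with x hx
    rw [norm_mul, norm_inv, Real.norm_of_nonneg (by positivity : 0 ≤ x + θ)]
    exact mul_le_mul_of_nonneg_left (inv_anti₀ hθ (by linarith)) (norm_nonneg _)
  · simpa using tendsto_inv_atTop_zero.const_mul (∫ x, ‖kern l m l0 m0 i β x‖ ∂ν)

theorem integral_numer_real (h : IsScalarSpectral l m l0 m0 ν)
    (hl : 0 < l) (hm : 0 < m) (hl0 : 0 < l0) (hm0 : 0 < m0) {θ : ℝ} (hθ : 0 < θ)
    (α β : Fin 2) :
    D l m l0 m0 (-θ) * ∫ x, numer l m l0 m0 x α β * (x + θ)⁻¹ ∂ν =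
      pMat l m l0 m0 (-θ) α β + qMat l m l0 m0 (-θ) α β * √((l + m + θ) ^ 2 - 4 * l * m) := by
  obtain ⟨s, hs0, hs⟩ := sqrtBranch_pos l m (neg_lt_zero.2 hθ)
  have h1 := sqrtBranch_sq hl.le hm.le ((-θ : ℝ) : ℂ)
  have h2 := h.integral_numer_mul_inv hl hm hl0 hm0 (z := ((-θ : ℝ) : ℂ))
    (by rw [Complex.ofReal_re]; intro h; linarith [h.1]) α β
  rw [hs] at h1 h2
  have hsq : s = √((l + m + θ) ^ 2 - 4 * l * m) := by
    have : ((s ^ 2 : ℝ) : ℂ) = (((l + m + θ) ^ 2 - 4 * l * m : ℝ) : ℂ) := by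
      push_cast at h1 ⊢; rw [h1]; ring
    rw [← Real.sqrt_sq hs0.le]
    congr 1
    exact_mod_cast this
  rw [← hsq]
  have e1 : ∫ x : ℝ, numer l m l0 m0 x α β • ((x : ℂ) - ((-θ : ℝ) : ℂ))⁻¹ ∂ν =
      ((∫ x, numer l m l0 m0 x α β * (x + θ)⁻¹ ∂ν : ℝ) : ℂ) := by
    rw [← integral_complex_ofReal]
    congr 1; ext x; rw [Complex.real_smul]; push_cast; rw [sub_neg_eq_add]
  have e2 : D (l : ℂ) m l0 m0 ((-θ : ℝ) : ℂ) = ((D l m l0 m0 (-θ) : ℝ) : ℂ) := by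
    simp only [D]; push_cast; ring
  have e3 : pMat (l : ℂ) m l0 m0 ((-θ : ℝ) : ℂ) α β = ((pMat l m l0 m0 (-θ) α β : ℝ) : ℂ) := by
    fin_cases α <;> fin_cases β <;> simp [pMat, p11, p12, p22]
  have e4 : qMat (l : ℂ) m l0 m0 ((-θ : ℝ) : ℂ) α β = ((qMat l m l0 m0 (-θ) α β : ℝ) : ℂ) := by
    fin_cases α <;> fin_cases β <;> simp [qMat, q11, q12, q22]
  rw [e1, e2, e3, e4] at h2
  exact_mod_cast h2

end IsScalarSpectral

theorem eventually_D_neg_ne_zero (hl : 0 < l) (hm : 0 < m) (hl0 : 0 < l0) (hm0 : 0 < m0) :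
    ∀ᶠ θ : ℝ in atTop, D l m l0 m0 (-θ) ≠ 0 := by
  set p : ℝ[X] := C (-2 * l0 * m - 2 * m0 * l + 2 * l * m) * X ^ 2 +
      C (2 * l0 ^ 2 * m + 2 * l0 * m0 * l + 2 * l0 * m0 * m - 2 * l0 * l * m + 2 * l0 * m ^ 2
        + 2 * m0 ^ 2 * l + 2 * m0 * l ^ 2 - 2 * m0 * l * m) * X +
      C (- 2 * l0 * m0 * (l - m) ^ 2)
  have hp : ∀ x, p.eval x = D l m l0 m0 x := by
    intro x; simp only [p, D, eval_add, eval_mul, eval_C, eval_pow, eval_X]; ring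
  have hab := sigmaMinus_lt_sigmaPlus hl hm
  have hmid := D_pos hl hm hl0 hm0 (x := (sigmaMinus l m + sigmaPlus l m) / 2)
      ⟨by linarith, by linarith⟩
  have hp0 : p ≠ 0 := by
    intro h0
    rw [← hp, h0, eval_zero] at hmid
    exact lt_irrefl _ hmid
  obtain ⟨b, hb⟩ := (Polynomial.finite_setOfPred_isRoot hp0).bddBelow
  filter_upwards [eventually_gt_atTop (-b)] with θ hθ h0
  have := hb (show p.IsRoot (-θ) by rw [IsRoot.def, hp, h0])
  linarith

theorem tendsto_gap (hl : 0 < l) (hm : 0 < m) :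
    Tendsto (fun θ => l + m + θ - √((l + m + θ) ^ 2 - 4 * l * m)) atTop (𝓝 0) := by
  have key : ∀ θ : ℝ, 0 < θ → 0 ≤ l + m + θ - √((l + m + θ) ^ 2 - 4 * l * m) ∧
      l + m + θ - √((l + m + θ) ^ 2 - 4 * l * m) ≤ 4 * l * m * θ⁻¹ := by
    intro θ hθ
    have h1 : 0 ≤ (l + m + θ) ^ 2 - 4 * l * m := by nlinarith [sq_nonneg (l - m)]
    have h2 := Real.sq_sqrt h1
    have h3 : √((l + m + θ) ^ 2 - 4 * l * m) ≤ l + m + θ := by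
      rw [Real.sqrt_le_left (by positivity)]; nlinarith [mul_pos hl hm]
    have h4 := Real.sqrt_nonneg ((l + m + θ) ^ 2 - 4 * l * m)
    refine ⟨by linarith, ?_⟩
    rw [← div_eq_mul_inv, le_div_iff₀ hθ]
    nlinarith
  refine squeeze_zero' (g := fun θ => 4 * l * m * θ⁻¹) ?_ ?_ ?_
  · filter_upwards [eventually_gt_atTop 0] with θ hθ using (key θ hθ).1
  · filter_upwards [eventually_gt_atTop 0] with θ hθ using (key θ hθ).2
  · simpa using tendsto_inv_atTop_zero.const_mul (4 * l * m)

/-- The device that identifies moments: in an identity between decaying functions of `θ`, the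
constant term must vanish. -/
theorem eq_of_eventually_add_sub {f g : ℝ → ℝ} {c d : ℝ} (hf : Tendsto f atTop (𝓝 0))
    (hg : Tendsto g atTop (𝓝 0)) (h : ∀ᶠ θ in atTop, f θ = g θ + (d - c)) : c = d := by
  have h1 : Tendsto f atTop (𝓝 (0 + (d - c))) :=
    (hg.add_const (d - c)).congr' (h.mono fun θ hθ => hθ.symm)
  have := tendsto_nhds_unique hf h1
  linarith

namespace IsScalarSpectral

/-- The explicit transforms at `0` and `-1`, arranged as the recurrence with the outer resolvents
replaced by their expected decaying continuations. Both equations are algebraic identities once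
multiplied by `D (-θ)`. -/
theorem resolvent_boundary (h : IsScalarSpectral l m l0 m0 ν)
    (hl : 0 < l) (hm : 0 < m) (hl0 : 0 < l0) (hm0 : 0 < m0) (β : Fin 2) {θ : ℝ} (hθ : 0 < θ)
    (hD : D l m l0 m0 (-θ) ≠ 0) :
    (θ + l0 + m0) * resolvent l m l0 m0 ν 0 β θ - m0 * resolvent l m l0 m0 ν (-1) β θ =
      l0 / (2 * l) * (l + m + θ - √((l + m + θ) ^ 2 - 4 * l * m)) *
        resolvent l m l0 m0 ν 0 β θ + (if β = 0 then 1 else 0) ∧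
    (θ + l + m) * resolvent l m l0 m0 ν (-1) β θ - l * resolvent l m l0 m0 ν 0 β θ =
      1 / 2 * (l + m + θ - √((l + m + θ) ^ 2 - 4 * l * m)) *
        resolvent l m l0 m0 ν (-1) β θ + (if β = 0 then 0 else l / m0) := by
  have h0 := h.integral_numer_real hl hm hl0 hm0 hθ 0 β
  have h1 := h.integral_numer_real hl hm hl0 hm0 hθ 1 β
  have hr0 : resolvent l m l0 m0 ν 0 β θ = ∫ x, numer l m l0 m0 x 0 β * (x + θ)⁻¹ ∂ν := by
    simp only [resolvent, kern_zero]
  have hr1 : resolvent l m l0 m0 ν (-1) β θ = ∫ x, numer l m l0 m0 x 1 β * (x + θ)⁻¹ ∂ν := by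
    simp only [resolvent, kern_neg_one]
  rw [← hr0] at h0
  rw [← hr1] at h1
  have hs : √((l + m + θ) ^ 2 - 4 * l * m) ^ 2 = (l + m + θ) ^ 2 - 4 * l * m :=
    Real.sq_sqrt (by nlinarith [sq_nonneg (l - m)])
  set s := √((l + m + θ) ^ 2 - 4 * l * m)
  set r := resolvent l m l0 m0 ν 0 β θ
  set r' := resolvent l m l0 m0 ν (-1) β θ
  have e0 : ∀ p, p = D l m l0 m0 (-θ) * r → r = p / D l m l0 m0 (-θ) := fun p hp => by
    rw [hp, mul_div_cancel_left₀ _ hD]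
  have e1 : ∀ p, p = D l m l0 m0 (-θ) * r' → r' = p / D l m l0 m0 (-θ) := fun p hp => by
    rw [hp, mul_div_cancel_left₀ _ hD]
  fin_cases β
  · simp only [Fin.zero_eta, if_true]
    simp only [pMat, qMat, Fin.zero_eta, Matrix.of_apply, Matrix.cons_val', Matrix.cons_val_zero,
      Matrix.cons_val_one, Matrix.cons_val_fin_one, p11, q11, p12, q12] at h0 h1
    constructor
    · refine mul_left_cancel₀ hD ?_
      have : D l m l0 m0 (-θ) * ((θ + l0 + m0) * r - m0 * r') -
        D l m l0 m0 (-θ) * (l0 / (2 * l) * (l + m + θ - s) * r + 1) =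
        (θ + l0 + m0 - l0 / (2 * l) * (l + m + θ - s)) * (D l m l0 m0 (-θ) * r) -
          m0 * (D l m l0 m0 (-θ) * r') - D l m l0 m0 (-θ) := by ring
      rw [← sub_eq_zero, this, h0, h1, D]
      field_simp
      grind
    · refine mul_left_cancel₀ hD ?_
      have : D l m l0 m0 (-θ) * ((θ + l + m) * r' - l * r) -
        D l m l0 m0 (-θ) * (1 / 2 * (l + m + θ - s) * r' + 0) =
        (θ + l + m - 1 / 2 * (l + m + θ - s)) * (D l m l0 m0 (-θ) * r') -
          l * (D l m l0 m0 (-θ) * r) := by ring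
      rw [← sub_eq_zero, this, h0, h1]
      field_simp
      grind
  · simp only [Fin.mk_one, one_ne_zero, if_false]
    simp only [pMat, qMat, Fin.mk_one, Matrix.of_apply, Matrix.cons_val', Matrix.cons_val_zero,
      Matrix.cons_val_one, Matrix.cons_val_fin_one, p22, q22, p12, q12] at h0 h1
    constructor
    · refine mul_left_cancel₀ hD ?_
      have : D l m l0 m0 (-θ) * ((θ + l0 + m0) * r - m0 * r') -
        D l m l0 m0 (-θ) * (l0 / (2 * l) * (l + m + θ - s) * r + 0) =
        (θ + l0 + m0 - l0 / (2 * l) * (l + m + θ - s)) * (D l m l0 m0 (-θ) * r) -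
          m0 * (D l m l0 m0 (-θ) * r') := by ring
      rw [← sub_eq_zero, this, h0, h1]
      field_simp
      grind
    · refine mul_left_cancel₀ hD ?_
      have : D l m l0 m0 (-θ) * ((θ + l + m) * r' - l * r) -
        D l m l0 m0 (-θ) * (1 / 2 * (l + m + θ - s) * r' + l / m0) =
        (θ + l + m - 1 / 2 * (l + m + θ - s)) * (D l m l0 m0 (-θ) * r') -
          l * (D l m l0 m0 (-θ) * r) - D l m l0 m0 (-θ) * (l / m0) := by ring
      rw [← sub_eq_zero, this, h0, h1, D]
      field_simp
      grind

/-- Moment and resolvent ratio are proved together. The recurrence expresses the next resolvent as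
ratio times current one plus a constant multiple of the unknown moment minus its expected value; `θ
→ ∞` removes that constant, and what remains is the ratio needed at the next step. -/
theorem moment_nonneg (h : IsScalarSpectral l m l0 m0 ν)
    (hl : 0 < l) (hm : 0 < m) (hl0 : 0 < l0) (hm0 : 0 < m0) (β : Fin 2) (n : ℕ) :
    moment l m l0 m0 ν n β = (if n = 0 then (if β = 0 then 1 else 0) else 0) ∧
    ∀ᶠ θ in atTop, resolvent l m l0 m0 ν (n + 1) β θ =
      (2 * l)⁻¹ * (l + m + θ - √((l + m + θ) ^ 2 - 4 * l * m)) *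
        resolvent l m l0 m0 ν n β θ := by
  have hu := (tendsto_gap hl hm).const_mul (2 * l)⁻¹
  rw [mul_zero] at hu
  have step : ∀ (n : ℕ) (r d : ℝ), r ≠ 0 → (∀ᶠ θ in atTop, r * resolvent l m l0 m0 ν (n + 1) β θ =
      r * ((2 * l)⁻¹ * (l + m + θ - √((l + m + θ) ^ 2 - 4 * l * m)) *
        resolvent l m l0 m0 ν n β θ) + (d - moment l m l0 m0 ν n β)) →
      moment l m l0 m0 ν n β = d ∧ ∀ᶠ θ in atTop, resolvent l m l0 m0 ν (n + 1) β θ =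
      (2 * l)⁻¹ * (l + m + θ - √((l + m + θ) ^ 2 - 4 * l * m)) *
        resolvent l m l0 m0 ν n β θ := by
    intro n r d hr he
    have h1 : moment l m l0 m0 ν n β = d := by
      refine eq_of_eventually_add_sub ?_ ?_ he
      · simpa using (h.tendsto_resolvent (n + 1) β).const_mul r
      · simpa using (hu.mul (h.tendsto_resolvent n β)).const_mul r
    refine ⟨h1, he.mono fun θ hθ => ?_⟩
    rw [h1, sub_self, add_zero] at hθ
    exact mul_left_cancel₀ hr hθ
  induction n with
  | zero =>
    refine step 0 l0 _ hl0.ne' ?_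
    filter_upwards [eventually_gt_atTop 0, eventually_D_neg_ne_zero hl hm hl0 hm0] with θ hθ hD
    have h1 := (h.resolvent_boundary hl hm hl0 hm0 β hθ hD).1
    have h2 := h.resolvent_recurrence hl hm hl0 hm0 0 β hθ
    rw [defectRate_zero, defectRate_zero, zero_sub] at h2
    simp only [Nat.cast_zero, if_true]
    linear_combination h1 - h2
  | succ n ih =>
    refine step (n + 1) l _ hl.ne' ?_
    filter_upwards [eventually_gt_atTop 0, ih.2] with θ hθ hr
    have h2 := h.resolvent_recurrence hl hm hl0 hm0 (n + 1) β hθ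
    rw [defectRate_of_ne _ _ (by omega), defectRate_of_ne _ _ (by omega),
      add_sub_cancel_right] at h2
    have hs : √((l + m + θ) ^ 2 - 4 * l * m) ^ 2 = (l + m + θ) ^ 2 - 4 * l * m :=
      Real.sq_sqrt (by nlinarith [sq_nonneg (l - m)])
    simp only [Nat.cast_add, Nat.cast_one, Nat.add_eq_zero_iff, one_ne_zero, and_false, if_false]
    set s := √((l + m + θ) ^ 2 - 4 * l * m)
    -- The ratio `u` solves `l * u ^ 2 - (l + m + θ) * u + m = 0`; it is the root that tends to zero
    -- as `θ → ∞`.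
    have hq : (l + m + θ) * ((2 * l)⁻¹ * (l + m + θ - s)) - m =
        l * ((2 * l)⁻¹ * (l + m + θ - s)) * ((2 * l)⁻¹ * (l + m + θ - s)) := by
      field_simp; linear_combination -hs
    linear_combination -h2 + (l + m + θ - l * ((2 * l)⁻¹ * (l + m + θ - s))) * hr +
      resolvent l m l0 m0 ν n β θ * hq

/-- The mirror image below the defect, with ratio `(l + m + θ - s) / (2 * m)`. The value `l / m0` is
the inverse of the potential coefficient at `-1`. -/
theorem moment_neg (h : IsScalarSpectral l m l0 m0 ν)
    (hl : 0 < l) (hm : 0 < m) (hl0 : 0 < l0) (hm0 : 0 < m0) (β : Fin 2) (n : ℕ) :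
    moment l m l0 m0 ν (-n - 1) β = (if n = 0 then (if β = 0 then 0 else l / m0) else 0) ∧
    ∀ᶠ θ in atTop, resolvent l m l0 m0 ν (-n - 1 - 1) β θ =
      (2 * m)⁻¹ * (l + m + θ - √((l + m + θ) ^ 2 - 4 * l * m)) *
        resolvent l m l0 m0 ν (-n - 1) β θ := by
  have hu := (tendsto_gap hl hm).const_mul (2 * m)⁻¹
  rw [mul_zero] at hu
  have step : ∀ (i : ℤ) (d : ℝ), (∀ᶠ θ in atTop, m * resolvent l m l0 m0 ν (i - 1) β θ =
      m * ((2 * m)⁻¹ * (l + m + θ - √((l + m + θ) ^ 2 - 4 * l * m)) *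
        resolvent l m l0 m0 ν i β θ) + (d - moment l m l0 m0 ν i β)) →
      moment l m l0 m0 ν i β = d ∧ ∀ᶠ θ in atTop, resolvent l m l0 m0 ν (i - 1) β θ =
      (2 * m)⁻¹ * (l + m + θ - √((l + m + θ) ^ 2 - 4 * l * m)) *
        resolvent l m l0 m0 ν i β θ := by
    intro i d he
    have h1 : moment l m l0 m0 ν i β = d := by
      refine eq_of_eventually_add_sub ?_ ?_ he
      · simpa using (h.tendsto_resolvent (i - 1) β).const_mul m
      · simpa using (hu.mul (h.tendsto_resolvent i β)).const_mul m
    refine ⟨h1, he.mono fun θ hθ => ?_⟩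
    rw [h1, sub_self, add_zero] at hθ
    exact mul_left_cancel₀ hm.ne' hθ
  induction n with
  | zero =>
    refine step _ _ ?_
    filter_upwards [eventually_gt_atTop 0, eventually_D_neg_ne_zero hl hm hl0 hm0] with θ hθ hD
    have h1 := (h.resolvent_boundary hl hm hl0 hm0 β hθ hD).2
    have h2 := h.resolvent_recurrence hl hm hl0 hm0 (-1) β hθ
    rw [defectRate_of_ne _ _ (by omega), defectRate_of_ne _ _ (by omega),
      neg_add_cancel] at h2
    simp only [Nat.cast_zero, if_true, neg_zero, zero_sub]
    have e : m * ((2 * m)⁻¹ * (l + m + θ - √((l + m + θ) ^ 2 - 4 * l * m)) *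
        resolvent l m l0 m0 ν (-1) β θ) = 1 / 2 * (l + m + θ - √((l + m + θ) ^ 2 - 4 * l * m)) *
        resolvent l m l0 m0 ν (-1) β θ := by field_simp
    rw [e]
    linear_combination h1 - h2
  | succ n ih =>
    have e : (-((n + 1 : ℕ) : ℤ)) - 1 = -n - 1 - 1 := by push_cast; ring
    rw [e, if_neg (Nat.succ_ne_zero n)]
    refine step _ _ ?_
    filter_upwards [eventually_gt_atTop 0, ih.2] with θ hθ hr
    have h2 := h.resolvent_recurrence hl hm hl0 hm0 (-n - 1 - 1) β hθ
    rw [defectRate_of_ne _ _ (by omega), defectRate_of_ne _ _ (by omega),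
      sub_add_cancel] at h2
    have hs : √((l + m + θ) ^ 2 - 4 * l * m) ^ 2 = (l + m + θ) ^ 2 - 4 * l * m :=
      Real.sq_sqrt (by nlinarith [sq_nonneg (l - m)])
    set s := √((l + m + θ) ^ 2 - 4 * l * m)
    have hq : (l + m + θ) * ((2 * m)⁻¹ * (l + m + θ - s)) - l =
        m * ((2 * m)⁻¹ * (l + m + θ - s)) * ((2 * m)⁻¹ * (l + m + θ - s)) := by
      field_simp; linear_combination -hs
    linear_combination -h2 + (l + m + θ - m * ((2 * m)⁻¹ * (l + m + θ - s))) * hr +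
      resolvent l m l0 m0 ν (-n - 1) β θ * hq

theorem moment_eq (h : IsScalarSpectral l m l0 m0 ν)
    (hl : 0 < l) (hm : 0 < m) (hl0 : 0 < l0) (hm0 : 0 < m0) (i : ℤ) :
    moment l m l0 m0 ν i 0 = (if i = 0 then 1 else 0) ∧
    moment l m l0 m0 ν i 1 = (if i = -1 then l / m0 else 0) := by
  rcases i with n | n
  · have h0 := (h.moment_nonneg hl hm hl0 hm0 0 n).1
    have h1 := (h.moment_nonneg hl hm hl0 hm0 1 n).1
    rw [show Int.ofNat n = (n : ℤ) from rfl, h0, h1]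
    simp [show (n : ℤ) ≠ -1 by omega]
  · have h0 := (h.moment_neg hl hm hl0 hm0 0 n).1
    have h1 := (h.moment_neg hl hm hl0 hm0 1 n).1
    have e : Int.negSucc n = -n - 1 := by omega
    rw [e, h0, h1]
    refine ⟨by simp [show (-n - 1 : ℤ) ≠ 0 by omega], ?_⟩
    by_cases hn : n = 0
    · simp [hn]
    · simp [hn]

end IsScalarSpectral

end moments

/-! ### The Karlin-McGregor formula -/

section karlinMcGregor

open Filter Topology

variable {l m l0 m0 : ℝ} {ν : Measure ℝ}

/-- The integrand `∑ α β, Q α i * numer α β * Q β j` of the Karlin-McGregor formula. -/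
noncomputable def kernel (l m l0 m0 : ℝ) (i j : ℤ) (x : ℝ) : ℝ :=
  ∑ β, kern l m l0 m0 i β x * (Q (defectRate l l0) (defectRate m m0) β j).eval x

theorem continuous_kernel (i j : ℤ) : Continuous (kernel l m l0 m0 i j) :=
  continuous_finsetSum _ fun β _ => (continuous_kern i β).mul (Polynomial.continuous _)

theorem kernel_recurrence_left (hl : 0 < l) (hm : 0 < m) (hl0 : 0 < l0) (hm0 : 0 < m0) (i j : ℤ)
    (x : ℝ) : -x * kernel l m l0 m0 i j x = defectRate l l0 i * kernel l m l0 m0 (i + 1) j x -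
      (defectRate l l0 i + defectRate m m0 i) * kernel l m l0 m0 i j x +
      defectRate m m0 i * kernel l m l0 m0 (i - 1) j x := by
  have h := fun β => kern_recurrence hl hm hl0 hm0 i β x
  simp only [kernel, Fin.sum_univ_two]
  linear_combination (Q (defectRate l l0) (defectRate m m0) 0 j).eval x * h 0 +
    (Q (defectRate l l0) (defectRate m m0) 1 j).eval x * h 1

theorem kernel_recurrence_right (hl : 0 < l) (hm : 0 < m) (hl0 : 0 < l0) (hm0 : 0 < m0) (i j : ℤ)
    (x : ℝ) : -x * kernel l m l0 m0 i j x = defectRate l l0 j * kernel l m l0 m0 i (j + 1) x -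
      (defectRate l l0 j + defectRate m m0 j) * kernel l m l0 m0 i j x +
      defectRate m m0 j * kernel l m l0 m0 i (j - 1) x := by
  have h := fun α => Q_eval_recurrence (defectRate_pos hl hl0) (defectRate_pos hm hm0) α j x
  simp only [kernel, Fin.sum_univ_two]
  linear_combination kern l m l0 m0 i 0 x * h 0 + kern l m l0 m0 i 1 x * h 1

theorem kernel_self_nonneg (hl : 0 < l) (hm : 0 < m) (hl0 : 0 < l0) (hm0 : 0 < m0) (i : ℤ) {x : ℝ}
    (hx : 0 ≤ D l m l0 m0 x) : 0 ≤ kernel l m l0 m0 i i x := by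
  have := numer_form_nonneg hl hm hl0 hm0 hx
    fun α => (Q (defectRate l l0) (defectRate m m0) α i).eval x
  refine this.trans_eq ?_
  simp only [kernel, kern, Fin.sum_univ_two]
  ring

theorem kernel_zero_zero (x : ℝ) : kernel l m l0 m0 0 0 x = l0 * m + l * m0 := by
  obtain ⟨h1, h2, -, -⟩ := Q_initial (defectRate l l0) (defectRate m m0)
  simp [kernel, kern_zero, h1, h2, numer]

namespace IsScalarSpectral

theorem integrable_exp_mul (h : IsScalarSpectral l m l0 m0 ν) {f : ℝ → ℝ} (hf : Continuous f)
    (t : ℝ) : Integrable (fun x => Real.exp (-x * t) * f x) ν :=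
  h.integrable_of_continuous (by fun_prop)

theorem hasDerivAt_integral_exp (h : IsScalarSpectral l m l0 m0 ν) {f : ℝ → ℝ}
    (hf : Continuous f) (t : ℝ) :
    HasDerivAt (fun t => ∫ x, Real.exp (-x * t) * f x ∂ν)
      (∫ x, Real.exp (-x * t) * (-x * f x) ∂ν) t := by
  refine (hasDerivAt_integral_of_dominated_loc_of_deriv_le (s := Metric.ball t 1)
    (bound := fun x => Real.exp (|x| * (|t| + 1)) * |x * f x|)
    (F' := fun t x => Real.exp (-x * t) * (-x * f x))
    (Metric.ball_mem_nhds t one_pos) ?_ (h.integrable_exp_mul hf t) ?_ ?_ ?_ ?_).2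
  · exact Eventually.of_forall fun s => (h.integrable_exp_mul hf s).aestronglyMeasurable
  · exact (h.integrable_exp_mul (by fun_prop) t).aestronglyMeasurable
  · refine Eventually.of_forall fun x s hs => ?_
    rw [norm_mul, Real.norm_of_nonneg (Real.exp_pos _).le, neg_mul x (f x), norm_neg, Real.norm_eq_abs]
    refine mul_le_mul_of_nonneg_right (Real.exp_le_exp.2 ?_) (abs_nonneg _)
    have h1 : |s| ≤ |t| + 1 := by
      have h2 : |s - t| < 1 := by rwa [Metric.mem_ball, Real.dist_eq] at hs
      have h3 := abs_sub_abs_le_abs_sub s t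
      linarith
    calc -x * s ≤ |-x * s| := le_abs_self _
      _ = |x| * |s| := by rw [abs_mul, abs_neg]
      _ ≤ |x| * (|t| + 1) := mul_le_mul_of_nonneg_left h1 (abs_nonneg _)
  · exact h.integrable_of_continuous (by fun_prop)
  · refine Eventually.of_forall fun x s _ => ?_
    have h1 : HasDerivAt (fun s : ℝ => -x * s) (-x) s := by
      simpa using (hasDerivAt_id s).const_mul (-x)
    exact (h1.exp.mul_const (f x)).congr_deriv (mul_assoc _ _ _)

/-- The columns `0` and `-1` of the kernel are the rows `kern`, whose integrals are the moments
already found; the recurrences in `i` and `j` give the rest. -/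
theorem integral_kernel (h : IsScalarSpectral l m l0 m0 ν)
    (hl : 0 < l) (hm : 0 < m) (hl0 : 0 < l0) (hm0 : 0 < m0) (i j : ℤ) :
    ∫ x, kernel l m l0 m0 i j x ∂ν =
      if i = j then (potCoef (defectRate l l0) (defectRate m m0) j)⁻¹ else 0 := by
  have hi : ∀ i j, Integrable (kernel l m l0 m0 i j) ν := fun i j =>
    h.integrable_of_continuous (continuous_kernel i j)
  have hcomb : ∀ (a b c : ℝ) (f g k : ℝ → ℝ), Integrable f ν → Integrable g ν → Integrable k ν →
      ∫ x, (a * f x - b * g x + c * k x) ∂ν = a * ∫ x, f x ∂ν - b * ∫ x, g x ∂ν + c * ∫ x, k x ∂ν := by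
    intro a b c f g k hf hg hk
    have hs : Integrable (fun x => a * f x - b * g x) ν := (hf.const_mul a).sub (hg.const_mul b)
    rw [integral_add hs (hk.const_mul c), integral_sub (hf.const_mul a) (hg.const_mul b),
      integral_const_mul, integral_const_mul, integral_const_mul]
  refine orthogonality (M := fun i j => ∫ x, kernel l m l0 m0 i j x ∂ν)
    (defectRate_pos hl hl0) (defectRate_pos hm hm0) ?_ ?_ ?_ i j
  · intro i j
    rw [← hcomb _ _ _ _ _ _ (hi _ _) (hi _ _) (hi _ _),
      ← hcomb _ _ _ _ _ _ (hi _ _) (hi _ _) (hi _ _)]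
    refine integral_congr_ae (Eventually.of_forall fun x => ?_)
    simp only
    rw [← kernel_recurrence_left hl hm hl0 hm0, ← kernel_recurrence_right hl hm hl0 hm0]
  · intro i
    obtain ⟨h1, h2, -, -⟩ := Q_initial (defectRate l l0) (defectRate m m0)
    have e : potCoef (defectRate l l0) (defectRate m m0) 0 = 1 := by
      rw [show (0 : ℤ) = Int.ofNat 0 from rfl, potCoef]; simp
    have := (h.moment_eq hl hm hl0 hm0 i).1
    simpa [kernel, h1, h2, e, moment] using this
  · intro i
    obtain ⟨-, -, h1, h2⟩ := Q_initial (defectRate l l0) (defectRate m m0)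
    have e : potCoef (defectRate l l0) (defectRate m m0) (-1) = m0 / l := by
      rw [show (-1 : ℤ) = Int.negSucc 0 from rfl, potCoef]; simp [defectRate]
    have := (h.moment_eq hl hm hl0 hm0 i).2
    simpa [kernel, h1, h2, e, moment] using this

theorem abs_integral_kernel_le (h : IsScalarSpectral l m l0 m0 ν)
    (hl : 0 < l) (hm : 0 < m) (hl0 : 0 < l0) (hm0 : 0 < m0) (j : ℤ) :
    ∃ ρ : ℝ, 1 ≤ ρ ∧ ∃ W : ℝ, 0 ≤ W ∧ ∀ i t, 0 ≤ t →
      |∫ x, Real.exp (-x * t) * kernel l m l0 m0 i j x ∂ν| ≤ W * ρ ^ i.natAbs := by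
  obtain ⟨B, hB⟩ := h.bounded
  set δ := min (min l l0) (min m m0)
  set c := l + l0 + m + m0
  have hδ : 0 < δ := lt_min (lt_min hl hl0) (lt_min hm hm0)
  have hL : ∀ n, δ ≤ defectRate l l0 n ∧ defectRate l l0 n ≤ c := by
    intro n
    rw [defectRate]
    split_ifs
    · exact ⟨(min_le_left _ _).trans (min_le_right _ _), by simp only [c]; linarith⟩
    · exact ⟨(min_le_left _ _).trans (min_le_left _ _), by simp only [c]; linarith⟩
  have hM : ∀ n, δ ≤ defectRate m m0 n ∧ defectRate m m0 n ≤ c := by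
    intro n
    rw [defectRate]
    split_ifs
    · exact ⟨(min_le_right _ _).trans (min_le_right _ _), by simp only [c]; linarith⟩
    · exact ⟨(min_le_right _ _).trans (min_le_left _ _), by simp only [c]; linarith⟩
  set ρ := max 1 ((3 * c + B) / δ) with hρ
  have hρ2 : 3 * c + B ≤ δ * ρ := by
    rw [← div_le_iff₀' hδ]; exact le_max_right _ _
  have hQ : ∀ α i x, |x| ≤ B →
      |(Q (defectRate l l0) (defectRate m m0) α i).eval x| ≤ ρ ^ i.natAbs := by
    intro α i x hx
    refine abs_le_pow_of_recurrence
      (q := fun i => (Q (defectRate l l0) (defectRate m m0) α i).eval x) hδ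
      (fun n => Q_eval_recurrence (defectRate_pos hl hl0) (defectRate_pos hm hm0) α n x)
      hL hM hx ?_ ?_ (le_max_left _ _) hρ2 i
    · obtain ⟨h1, h2, -, -⟩ := Q_initial (defectRate l l0) (defectRate m m0)
      fin_cases α <;> simp [h1, h2]
    · obtain ⟨-, -, h1, h2⟩ := Q_initial (defectRate l l0) (defectRate m m0)
      fin_cases α <;> simp [h1, h2]
  set w : ℝ → ℝ := fun x => ∑ β, (∑ α, |numer l m l0 m0 x α β|) *
    |(Q (defectRate l l0) (defectRate m m0) β j).eval x| with hw
  have hwc : Continuous w := continuous_finsetSum _ fun β _ =>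
    (continuous_finsetSum _ fun α _ => (continuous_numer α β).abs).mul
      (Polynomial.continuous _).abs
  have hw0 : ∀ x, 0 ≤ w x := fun x => Finset.sum_nonneg fun β _ =>
    mul_nonneg (Finset.sum_nonneg fun α _ => abs_nonneg _) (abs_nonneg _)
  refine ⟨ρ, le_max_left _ _, ∫ x, w x ∂ν, integral_nonneg hw0, fun i t ht => ?_⟩
  rw [← integral_mul_const, ← Real.norm_eq_abs]
  refine norm_integral_le_of_norm_le ((h.integrable_of_continuous hwc).mul_const _) ?_
  filter_upwards [hB] with x hx
  have hxB : |x| ≤ B := by rw [abs_of_pos hx.1]; exact hx.2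
  rw [norm_mul, Real.norm_of_nonneg (Real.exp_pos _).le, Real.norm_eq_abs]
  have h1 : Real.exp (-x * t) ≤ 1 := Real.exp_le_one_iff.2 (by nlinarith [hx.1])
  have h2 : |kernel l m l0 m0 i j x| ≤ w x * ρ ^ i.natAbs := by
    rw [hw, kernel, Finset.sum_mul]
    refine (Finset.abs_sum_le_sum_abs _ _).trans (Finset.sum_le_sum fun β _ => ?_)
    rw [abs_mul, mul_right_comm]
    refine mul_le_mul_of_nonneg_right ?_ (abs_nonneg _)
    rw [kern, Finset.sum_mul]
    refine (Finset.abs_sum_le_sum_abs _ _).trans (Finset.sum_le_sum fun α _ => ?_)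
    rw [abs_mul, mul_comm]
    exact mul_le_mul_of_nonneg_left (hQ α i x hxB) (abs_nonneg _)
  calc Real.exp (-x * t) * |kernel l m l0 m0 i j x| ≤ 1 * |kernel l m l0 m0 i j x| :=
        mul_le_mul_of_nonneg_right h1 (abs_nonneg _)
    _ ≤ w x * ρ ^ i.natAbs := by rw [one_mul]; exact h2

/-- Both sides solve the backward equation in `i` for fixed `j`. They agree at time zero by
orthogonality, and their difference grows at most geometrically in `i`, so `backward_unique`
applies. -/
theorem transProb_eq (h : IsScalarSpectral l m l0 m0 ν)
    (hl : 0 < l) (hm : 0 < m) (hl0 : 0 < l0) (hm0 : 0 < m0)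
    {Ω : Type*} [MeasurableSpace Ω] {Pr : ℤ → Measure Ω} {X : ℝ≥0 → Ω → ℤ}
    (hX : IsBirthDeathProcess (defectRate l l0) (defectRate m m0) Pr X) (i j : ℤ) (t : ℝ≥0) :
    transProb Pr X i j t = potCoef (defectRate l l0) (defectRate m m0) j *
      ∫ x, Real.exp (-x * t) * kernel l m l0 m0 i j x ∂ν := by
  obtain ⟨ρ, hρ, W, hW, hb⟩ := h.abs_integral_kernel_le hl hm hl0 hm0 j
  have hπ := potCoef_pos (defectRate_pos hl hl0) (defectRate_pos hm hm0) j
  set π := potCoef (defectRate l l0) (defectRate m m0) j with hπdef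
  have hd : ∀ i t, HasDerivAt (fun t => ∫ x, Real.exp (-x * t) * kernel l m l0 m0 i j x ∂ν)
      (defectRate l l0 i * ∫ x, Real.exp (-x * t) * kernel l m l0 m0 (i + 1) j x ∂ν -
        (defectRate l l0 i + defectRate m m0 i) *
          ∫ x, Real.exp (-x * t) * kernel l m l0 m0 i j x ∂ν +
        defectRate m m0 i * ∫ x, Real.exp (-x * t) * kernel l m l0 m0 (i - 1) j x ∂ν) t := by
    intro i t
    have hi := fun i => h.integrable_exp_mul (continuous_kernel (l := l) (m := m) (l0 := l0)
      (m0 := m0) i j) t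
    have hs : Integrable (fun x => defectRate l l0 i *
        (Real.exp (-x * t) * kernel l m l0 m0 (i + 1) j x) -
        (defectRate l l0 i + defectRate m m0 i) *
          (Real.exp (-x * t) * kernel l m l0 m0 i j x)) ν :=
      ((hi _).const_mul _).sub ((hi _).const_mul _)
    convert h.hasDerivAt_integral_exp (continuous_kernel i j) t using 1
    rw [← integral_const_mul, ← integral_const_mul, ← integral_const_mul,
      ← integral_sub ((hi _).const_mul _) ((hi _).const_mul _),
      ← integral_add hs ((hi _).const_mul _)]
    refine integral_congr_ae (Eventually.of_forall fun x => ?_)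
    simp only
    rw [kernel_recurrence_left hl hm hl0 hm0]
    ring
  have hc : ∀ (r r0 : ℝ), 0 < r → 0 < r0 → r ≤ l + l0 + m + m0 → r0 ≤ l + l0 + m + m0 →
      ∀ i, |defectRate r r0 i| ≤ l + l0 + m + m0 := by
    intro r r0 hr hr0 h1 h2 i
    rw [abs_of_pos (defectRate_pos hr hr0 i), defectRate]
    split_ifs <;> assumption
  have key := backward_unique (l := defectRate l l0) (m := defectRate m m0)
    (c := l + l0 + m + m0) (M := 1 + π * W) (ρ := ρ)
    (hc l l0 hl hl0 (by linarith) (by linarith)) (hc m m0 hm hm0 (by linarith) (by linarith)) hρ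
    (u := fun i t => transProb Pr X i j t.toNNReal -
      π * ∫ x, Real.exp (-x * t) * kernel l m l0 m0 i j x ∂ν) ?_ ?_ ?_ ?_ i t.2
  · have : transProb Pr X i j (t : ℝ).toNNReal -
      π * ∫ x, Real.exp (-x * t) * kernel l m l0 m0 i j x ∂ν = 0 := key
    rw [Real.toNNReal_coe] at this
    linarith
  · intro i
    refine (hX.continuousOn_transProb i j).sub (ContinuousOn.mul continuousOn_const ?_)
    exact fun t _ => (hd i t).continuousAt.continuousWithinAt
  · intro i t ht
    have h1 := (hX.hasDerivWithinAt_transProb i j ht).sub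
      (((hd i t).const_mul π).hasDerivWithinAt (s := Set.Ici t))
    refine h1.congr_deriv ?_
    ring
  · intro i
    have h0 := h.integral_kernel hl hm hl0 hm0 i j
    simp only [mul_zero, Real.exp_zero, one_mul, Real.toNNReal_zero]
    rw [h0, hX.transProb_zero, ← hπdef]
    split_ifs
    · rw [mul_inv_cancel₀ hπ.ne', sub_self]
    · simp
  · intro i t ht
    have h1 : |transProb Pr X i j t.toNNReal| ≤ 1 := by
      rw [abs_of_nonneg (transProb_nonneg ..)]; exact hX.transProb_le_one ..
    have h2 : (1 : ℝ) ≤ ρ ^ i.natAbs := one_le_pow₀ hρ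
    calc |transProb Pr X i j t.toNNReal - π * ∫ x, Real.exp (-x * t) * kernel l m l0 m0 i j x ∂ν|
        ≤ |transProb Pr X i j t.toNNReal| +
          |π * ∫ x, Real.exp (-x * t) * kernel l m l0 m0 i j x ∂ν| := abs_sub _ _
      _ ≤ ρ ^ i.natAbs + π * (W * ρ ^ i.natAbs) := by
          rw [abs_mul, abs_of_pos hπ]
          exact add_le_add (h1.trans h2) (mul_le_mul_of_nonneg_left (hb i t ht) hπ.le)
      _ = (1 + π * W) * ρ ^ i.natAbs := by ring

theorem isSpectralMatrix (h : IsScalarSpectral l m l0 m0 ν)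
    (hl : 0 < l) (hm : 0 < m) (hl0 : 0 < l0) (hm0 : 0 < m0)
    {Ω : Type*} [MeasurableSpace Ω] {Pr : ℤ → Measure Ω} {X : ℝ≥0 → Ω → ℤ}
    (hX : IsBirthDeathProcess (defectRate l l0) (defectRate m m0) Pr X) :
    IsSpectralMatrix (defectRate l l0) (defectRate m m0) (transProb Pr X)
      (spectralMatrix l m l0 m0 ν) := by
  have hcont : ∀ (i j : ℤ) (t : ℝ≥0) (α β : Fin 2), Continuous fun x : ℝ => Real.exp (-x * t) *
      (Q (defectRate l l0) (defectRate m m0) α i).eval x *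
      (Q (defectRate l l0) (defectRate m m0) β j).eval x := fun i j t α β => by
    have h1 := Polynomial.continuous (Q (defectRate l l0) (defectRate m m0) α i)
    have h2 := Polynomial.continuous (Q (defectRate l l0) (defectRate m m0) β j)
    fun_prop
  refine ⟨fun S hS => h.posSemidef hl hm hl0 hm0 hS, fun α β => h.variation_Iio α β,
    fun i j t α β => h.integrable_spectralMatrix (hcont i j t α β).stronglyMeasurable
      (hcont i j t α β).continuousOn α β, fun i j t => ?_⟩
  rw [h.transProb_eq hl hm hl0 hm0 hX]
  congr 1
  have hi : ∀ α β, Integrable (fun x : ℝ => numer l m l0 m0 x α β • (Real.exp (-x * t) *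
      (Q (defectRate l l0) (defectRate m m0) α i).eval x *
      (Q (defectRate l l0) (defectRate m m0) β j).eval x)) ν := fun α β =>
    h.integrable_of_continuous ((continuous_numer α β).smul (hcont i j t α β))
  simp_rw [h.integral_spectralMatrix (hcont i j t _ _).stronglyMeasurable
    (hcont i j t _ _).continuousOn]
  simp_rw [← integral_finsetSum _ fun β _ => hi _ β]
  rw [← integral_finsetSum _ fun α _ => integrable_finsetSum _ fun β _ => hi α β]
  refine integral_congr_ae (Eventually.of_forall fun x => ?_)
  simp only [kernel, kern, Fin.sum_univ_two, smul_eq_mul]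
  ring

end IsScalarSpectral

/-- At the states `0` and `-1` the polynomials `Q` are zero or one, so the double sum reduces to a
single entry of the matrix. -/
theorem IsSpectralMatrix.integral_exp_eq {l m : ℤ → ℝ} (hl : ∀ n, 0 < l n) (hm : ∀ n, 0 < m n)
    {P : ℤ → ℤ → ℝ≥0 → ℝ} {Ψ : Matrix (Fin 2) (Fin 2) (SignedMeasure ℝ)}
    (h : IsSpectralMatrix l m P Ψ) (t : ℝ≥0) (α β : Fin 2) :
    ∫ᵛ x, Real.exp (-x * t) ∂<•(Ψ α β) = (potCoef l m (if β = 0 then 0 else -1))⁻¹ *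
      P (if α = 0 then 0 else -1) (if β = 0 then 0 else -1) t := by
  obtain ⟨h1, h2, h3, h4⟩ := Q_initial l m
  rw [h.karlinMcGregor, inv_mul_cancel_left₀ (potCoef_pos hl hm _).ne']
  fin_cases α <;> fin_cases β <;> simp [Fin.sum_univ_two, h1, h2, h3, h4]

theorem IsSpectralMatrix.unique {l m : ℤ → ℝ} (hl : ∀ n, 0 < l n) (hm : ∀ n, 0 < m n)
    {P : ℤ → ℤ → ℝ≥0 → ℝ} {Ψ Ψ' : Matrix (Fin 2) (Fin 2) (SignedMeasure ℝ)}
    (h : IsSpectralMatrix l m P Ψ) (h' : IsSpectralMatrix l m P Ψ') : Ψ' = Ψ := by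
  ext1 α β
  refine signedMeasure_ext_of_laplace (h'.support α β) (h.support α β) fun t => ?_
  rw [h.integral_exp_eq hl hm, h'.integral_exp_eq hl hm]

end karlinMcGregor

/-! ### Transience and null recurrence -/

section recurrence

open Filter Topology

variable {l m l0 m0 : ℝ} {ν : Measure ℝ} {Ω : Type*} [MeasurableSpace Ω] {Pr : ℤ → Measure Ω}
  {X : ℝ≥0 → Ω → ℤ}

namespace IsScalarSpectral

/-- The diagonal kernel is nonnegative where `D ≥ 0` and has integral `1 / π i`, so `P i i` is a
probability average of `exp (-x * t)` over `x ≥ ε`. -/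
theorem transProb_self_le_exp (h : IsScalarSpectral l m l0 m0 ν)
    (hl : 0 < l) (hm : 0 < m) (hl0 : 0 < l0) (hm0 : 0 < m0)
    (hX : IsBirthDeathProcess (defectRate l l0) (defectRate m m0) Pr X) {ε : ℝ}
    (hε : ∀ᵐ x ∂ν, ε ≤ x) (i : ℤ) (t : ℝ≥0) :
    transProb Pr X i i t ≤ Real.exp (-ε * t) := by
  have hπ := potCoef_pos (defectRate_pos hl hl0) (defectRate_pos hm hm0) i
  have hint := h.integral_kernel hl hm hl0 hm0 i i
  rw [if_pos rfl] at hint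
  rw [h.transProb_eq hl hm hl0 hm0 hX]
  have h1 : ∫ x, Real.exp (-x * t) * kernel l m l0 m0 i i x ∂ν ≤
      ∫ x, Real.exp (-ε * t) * kernel l m l0 m0 i i x ∂ν := by
    refine integral_mono_ae (h.integrable_exp_mul (continuous_kernel i i) t)
      ((h.integrable_of_continuous (continuous_kernel i i)).const_mul _) ?_
    filter_upwards [hε, h.D_nonneg] with x hx hD
    refine mul_le_mul_of_nonneg_right (Real.exp_le_exp.2 ?_)
      (kernel_self_nonneg hl hm hl0 hm0 i hD)
    exact mul_le_mul_of_nonneg_right (neg_le_neg hx) t.2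
  rw [integral_const_mul, hint] at h1
  refine (mul_le_mul_of_nonneg_left h1 hπ.le).trans_eq ?_
  field_simp

theorem antitone_transProb_self (h : IsScalarSpectral l m l0 m0 ν)
    (hl : 0 < l) (hm : 0 < m) (hl0 : 0 < l0) (hm0 : 0 < m0)
    (hX : IsBirthDeathProcess (defectRate l l0) (defectRate m m0) Pr X) (i : ℤ) :
    Antitone (transProb Pr X i i) := by
  intro s t hst
  rw [h.transProb_eq hl hm hl0 hm0 hX, h.transProb_eq hl hm hl0 hm0 hX]
  refine mul_le_mul_of_nonneg_left ?_
    (potCoef_pos (defectRate_pos hl hl0) (defectRate_pos hm hm0) i).le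
  refine integral_mono_ae (h.integrable_exp_mul (continuous_kernel i i) t)
    (h.integrable_exp_mul (continuous_kernel i i) s) ?_
  filter_upwards [h.ae_pos, h.D_nonneg] with x hx hD
  refine mul_le_mul_of_nonneg_right (Real.exp_le_exp.2 ?_)
    (kernel_self_nonneg hl hm hl0 hm0 i hD)
  have : (s : ℝ) ≤ t := hst
  nlinarith

/-- Dominated convergence: `ν` has no mass at `0`, so `exp (-x * t)` tends to zero almost
everywhere. -/
theorem exists_transProb_self_le (h : IsScalarSpectral l m l0 m0 ν)
    (hl : 0 < l) (hm : 0 < m) (hl0 : 0 < l0) (hm0 : 0 < m0)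
    (hX : IsBirthDeathProcess (defectRate l l0) (defectRate m m0) Pr X) (i : ℤ) {η : ℝ}
    (hη : 0 < η) : ∃ t₀ : ℝ≥0, ∀ t ≥ t₀, transProb Pr X i i t ≤ η := by
  have h1 : Tendsto (fun t : ℝ≥0 => ∫ x, Real.exp (-x * t) * kernel l m l0 m0 i i x ∂ν) atTop
      (𝓝 (∫ _, (0 : ℝ) ∂ν)) := by
    refine tendsto_integral_filter_of_dominated_convergence (fun x => ‖kernel l m l0 m0 i i x‖)
      (Eventually.of_forall fun t =>
        (h.integrable_exp_mul (continuous_kernel i i) t).aestronglyMeasurable)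
      (Eventually.of_forall fun t => ?_) (h.integrable_of_continuous (continuous_kernel i i)).norm ?_
    · filter_upwards [h.ae_pos] with x hx
      rw [norm_mul, Real.norm_of_nonneg (Real.exp_pos _).le]
      refine mul_le_of_le_one_left (norm_nonneg _) (Real.exp_le_one_iff.2 ?_)
      have := t.2
      nlinarith
    · filter_upwards [h.ae_pos] with x hx
      have h2 : Tendsto (fun t : ℝ≥0 => -x * (t : ℝ)) atTop atBot :=
        (NNReal.tendsto_coe_atTop.2 tendsto_id).const_mul_atTop_of_neg (neg_lt_zero.2 hx)
      simpa using (Real.tendsto_exp_atBot.comp h2).mul_const (kernel l m l0 m0 i i x)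
  rw [integral_zero] at h1
  have h3 := h1.const_mul (potCoef (defectRate l l0) (defectRate m m0) i)
  rw [mul_zero] at h3
  obtain ⟨t₀, ht₀⟩ := eventually_atTop.1 (h3.eventually (ge_mem_nhds hη))
  exact ⟨t₀, fun t ht => by rw [h.transProb_eq hl hm hl0 hm0 hX]; exact ht₀ t ht⟩

/-- Summing the spectral formula gives `∑ exp (-x) ^ n = 1 / (1 - exp (-x)) ≥ x⁻¹`, and `x⁻¹` is not
`ν`-integrable. The state `0` is convenient because its kernel is constant. -/
theorem tsum_transProb_zero (h : IsScalarSpectral l l l0 m0 ν)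
    (hl : 0 < l) (hl0 : 0 < l0) (hm0 : 0 < m0)
    (hX : IsBirthDeathProcess (defectRate l l0) (defectRate l m0) Pr X) :
    ∑' n : ℕ, ENNReal.ofReal (transProb Pr X 0 0 n) = ⊤ := by
  have hq : 0 < l0 * l + l * m0 := by positivity
  have hπ : potCoef (defectRate l l0) (defectRate l m0) 0 = 1 := by
    rw [show (0 : ℤ) = Int.ofNat 0 from rfl, potCoef]; simp
  have hterm : ∀ n : ℕ, ENNReal.ofReal (transProb Pr X 0 0 n) =
      ∫⁻ x, ENNReal.ofReal (Real.exp (-x) ^ n * (l0 * l + l * m0)) ∂ν := by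
    intro n
    rw [h.transProb_eq hl hl hl0 hm0 hX, hπ, one_mul, ofReal_integral_eq_lintegral_ofReal
      (h.integrable_exp_mul (continuous_kernel 0 0) _)]
    · refine lintegral_congr fun x => ?_
      rw [kernel_zero_zero, ← Real.exp_nat_mul, NNReal.coe_natCast, mul_comm (-x)]
    · filter_upwards [h.D_nonneg] with x hD
      exact mul_nonneg (Real.exp_pos _).le (kernel_self_nonneg hl hl hl0 hm0 0 hD)
  simp_rw [hterm]
  rw [← lintegral_tsum fun n => by fun_prop]
  have hni := h.not_integrable_inv hl hl0 hm0
  have htop : ∫⁻ x, ENNReal.ofReal (l0 * l + l * m0) * ‖x⁻¹‖ₑ ∂ν = ⊤ := by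
    rw [lintegral_const_mul _ (by fun_prop)]
    have : ∫⁻ x, ‖x⁻¹‖ₑ ∂ν = ⊤ := by
      by_contra hne
      exact hni ⟨measurable_inv.aestronglyMeasurable, lt_top_iff_ne_top.2 hne⟩
    rw [this, ENNReal.mul_top (ENNReal.ofReal_pos.2 hq).ne']
  rw [← top_le_iff, ← htop]
  refine lintegral_mono_ae ?_
  filter_upwards [h.ae_pos] with x hx
  have h1 : Real.exp (-x) < 1 := Real.exp_lt_one_iff.2 (by linarith)
  have h2 : HasSum (fun n : ℕ => Real.exp (-x) ^ n * (l0 * l + l * m0))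
      ((1 - Real.exp (-x))⁻¹ * (l0 * l + l * m0)) :=
    (hasSum_geometric_of_lt_one (Real.exp_pos _).le h1).mul_right _
  rw [← ENNReal.ofReal_tsum_of_nonneg (fun n => by positivity) h2.summable, h2.tsum_eq,
    Real.enorm_of_nonneg (inv_nonneg.2 hx.le), ← ENNReal.ofReal_mul hq.le]
  refine ENNReal.ofReal_le_ofReal ?_
  rw [mul_comm]
  refine mul_le_mul_of_nonneg_right (inv_anti₀ (by linarith) ?_) hq.le
  have := Real.add_one_le_exp (-x)
  linarith

theorem isTransient (h : IsScalarSpectral l m l0 m0 ν)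
    (hl : 0 < l) (hm : 0 < m) (hl0 : 0 < l0) (hm0 : 0 < m0)
    (hX : IsBirthDeathProcess (defectRate l l0) (defectRate m m0) Pr X) (hlm : l ≠ m) :
    IsTransient Pr X := by
  obtain ⟨ε, hε, hae⟩ := h.away hlm
  exact fun i => hX.measure_return_lt_one i
    (add_pos (defectRate_pos hl hl0 i) (defectRate_pos hm hm0 i)) hε
    (h.transProb_self_le_exp hl hm hl0 hm0 hX hae i)

theorem isNullRecurrent (h : IsScalarSpectral l l l0 m0 ν)
    (hl : 0 < l) (hl0 : 0 < l0) (hm0 : 0 < m0)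
    (hX : IsBirthDeathProcess (defectRate l l0) (defectRate l m0) Pr X) :
    IsNullRecurrent Pr X := by
  refine ⟨fun i => hX.measure_return_eq_one i
    (fun η hη => h.exists_transProb_self_le hl hl hl0 hm0 hX i hη) ?_,
    fun i => hX.lintegral_returnTime_eq_top i
      (add_pos (defectRate_pos hl hl0 i) (defectRate_pos hl hm0 i))
      (fun η hη => h.exists_transProb_self_le hl hl hl0 hm0 hX i hη)⟩
  exact hX.tsum_transProb_eq_top (defectRate_pos hl hl0) (defectRate_pos hl hm0) i 0
    (h.antitone_transProb_self hl hl hl0 hm0 hX i) (h.tsum_transProb_zero hl hl0 hm0 hX)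

end IsScalarSpectral

end recurrence

/-! ### The explicit roots and weights in the symmetric case, and the main theorem. -/

theorem gam_of_eq {l l0 m0 : ℝ} (hl : 0 < l) (hl0 : 0 < l0) (hm0 : 0 < m0)
    (hκ : kappa l l l0 m0 ≠ 0) : gam (-1) l l l0 m0 = 0 ∧
      gam 1 l l l0 m0 = (l0 + m0) ^ 2 / (l0 + m0 - l) ∧ weight 1 l l l0 m0 = 0 := by
  have hR : R l l l0 m0 = (l0 + m0) ^ 2 := by rw [R]; ring
  have hr : √(R l l l0 m0) = l0 + m0 := by rw [hR, Real.sqrt_sq (by positivity)]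
  have hk : kappa l l l0 m0 = l * (l0 + m0 - l) := by rw [kappa]; ring
  have hne : l0 + m0 - l ≠ 0 := fun h0 => hκ (by rw [hk, h0, mul_zero])
  have hs : l0 + m0 ≠ 0 := by positivity
  refine ⟨?_, ?_, ?_⟩
  · rw [gam, hr, sub_self, mul_zero, div_eq_zero_iff]
    left; ring
  · rw [gam, hr, hk]
    field_simp
    ring
  · have e : √((l0 + m0) ^ 2) = l0 + m0 := by rw [← hR, hr]
    ext α β
    fin_cases α <;> fin_cases β <;>
      simp only [weight, e, bigC, hR, kappa, Fin.zero_eta, Fin.mk_one, Matrix.of_apply,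
        Matrix.cons_val', Matrix.cons_val_zero, Matrix.cons_val_one, Matrix.cons_val_fin_one,
        Matrix.zero_apply, mul_eq_zero]
    · right; field_simp; ring
    · right; field_simp; ring
    · right; field_simp; ring
    · right; field_simp; ring

end BilateralBD

theorem mainTheorem6 (l m l0 m0 : ℝ) (hl : 0 < l) (hm : 0 < m) (hl0 : 0 < l0) (hm0 : 0 < m0)
    {Ω : Type*} [MeasurableSpace Ω] (Pr : ℤ → Measure Ω) (X : ℝ≥0 → Ω → ℤ)
    (hX : BilateralBD.IsBirthDeathProcess (BilateralBD.defectRate l l0)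
      (BilateralBD.defectRate m m0) Pr X) :
    -- the spectral matrix
    (∃ Ψ : Matrix (Fin 2) (Fin 2) (SignedMeasure ℝ),
      BilateralBD.IsSpectralMatrix (BilateralBD.defectRate l l0) (BilateralBD.defectRate m m0)
        (BilateralBD.transProb Pr X) Ψ ∧
      (∀ Ψ' : Matrix (Fin 2) (Fin 2) (SignedMeasure ℝ),
        BilateralBD.IsSpectralMatrix (BilateralBD.defectRate l l0) (BilateralBD.defectRate m m0)
          (BilateralBD.transProb Pr X) Ψ' → Ψ' = Ψ) ∧
      -- Stieltjes transforms
      (∀ (α β : Fin 2) (z : ℂ), ¬ (0 ≤ z.re ∧ z.im = 0) →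
        (Ψ α β).Integrable (fun x : ℝ => ((x : ℂ) - z)⁻¹) ∧
        (BilateralBD.D (l : ℂ) m l0 m0 z ≠ 0 →
          BilateralBD.stieltjes (Ψ α β) z =
            (BilateralBD.pMat (l : ℂ) m l0 m0 z α β +
              BilateralBD.qMat (l : ℂ) m l0 m0 z α β * BilateralBD.sqrtBranch l m z) /
              BilateralBD.D (l : ℂ) m l0 m0 z)) ∧
      -- absolutely continuous part and discrete part
      (∀ α β, Integrable (BilateralBD.acDensity l m l0 m0 α β)) ∧
      (∃ Ψd : Matrix (Fin 2) (Fin 2) (SignedMeasure ℝ),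
        Ψ = BilateralBD.acPart l m l0 m0 + Ψd ∧
        (∀ α β, (Ψd α β).variation {x | BilateralBD.D l m l0 m0 x ≠ 0} = 0) ∧
        (l0 * m + m0 * l ≠ l * m → Ψd = BilateralBD.discretePart l m l0 m0)) ∧
      -- behaviour at the origin
      (∀ α, ∫⁻ x, (ENNReal.ofReal x)⁻¹ ∂(Ψ α α).variation < ⊤ ↔ l ≠ m) ∧
      (l = m → ∀ α β, Ψ α β {0} = 0)) ∧
    -- the roots of the quadratic
    (l0 * m + m0 * l ≠ l * m →
      (∀ z : ℂ, BilateralBD.D (l : ℂ) m l0 m0 z = 0 ↔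
        z = BilateralBD.gam 1 l m l0 m0 ∨ z = BilateralBD.gam (-1) l m l0 m0) ∧
      (l = m → BilateralBD.gam (-1) l m l0 m0 = 0 ∧
        BilateralBD.gam 1 l m l0 m0 = (l0 + m0) ^ 2 / (l0 + m0 - l) ∧
        BilateralBD.weight 1 l m l0 m0 = 0)) ∧
    -- the polynomials
    (∀ (n : ℕ) (x : ℝ),
      (BilateralBD.Q (BilateralBD.defectRate l l0) (BilateralBD.defectRate m m0) 0 n).eval x =
        (m / l) ^ ((n : ℝ) / 2) *
          (2 * (l0 - l) / l0 * (Polynomial.Chebyshev.T ℝ n).eval (BilateralBD.yVar l m x) +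
            (2 * l - l0) / l0 * (Polynomial.Chebyshev.U ℝ n).eval (BilateralBD.yVar l m x) +
            √(l / m) * ((l0 + m0 - l - m) / l0) *
              (Polynomial.Chebyshev.U ℝ (n - 1)).eval (BilateralBD.yVar l m x)) ∧
      (BilateralBD.Q (BilateralBD.defectRate l l0) (BilateralBD.defectRate m m0) 0
          (-n - 1)).eval x =
        -(l / m) ^ (((n : ℝ) + 1) / 2) *
          (Polynomial.Chebyshev.U ℝ (n - 1)).eval (BilateralBD.yVar l m x) ∧
      (BilateralBD.Q (BilateralBD.defectRate l l0) (BilateralBD.defectRate m m0) 1 n).eval x =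
        -(m0 / l0) * (m / l) ^ (((n : ℝ) - 1) / 2) *
          (Polynomial.Chebyshev.U ℝ (n - 1)).eval (BilateralBD.yVar l m x) ∧
      (BilateralBD.Q (BilateralBD.defectRate l l0) (BilateralBD.defectRate m m0) 1
          (-n - 1)).eval x =
        (l / m) ^ ((n : ℝ) / 2) *
          (Polynomial.Chebyshev.U ℝ n).eval (BilateralBD.yVar l m x)) ∧
    -- transience and recurrence
    (l ≠ m → BilateralBD.IsTransient Pr X) ∧
    (l = m → BilateralBD.IsNullRecurrent Pr X) := by
  obtain ⟨ν, h⟩ := BilateralBD.exists_isScalarSpectral hl hm hl0 hm0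
  have hsp := h.isSpectralMatrix hl hm hl0 hm0 hX
  obtain ⟨Ψd, hd1, hd2, hd3⟩ := h.decomposition
  refine ⟨⟨BilateralBD.spectralMatrix l m l0 m0 ν, hsp, fun Ψ' h' => hsp.unique
      (BilateralBD.defectRate_pos hl hl0) (BilateralBD.defectRate_pos hm hm0) h',
      fun α β z hz => h.stieltjes_spectralMatrix hl hm hl0 hm0 hz α β, h.integrable_acDensity,
      ⟨Ψd, hd1, hd2, hd3⟩, h.lintegral_inv_lt_top_iff hl hl0 hm0, fun _ => h.apply_zero⟩,
    fun hne => ?_, BilateralBD.Q_eq_chebyshev hl hm hl0, h.isTransient hl hm hl0 hm0 hX, ?_⟩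
  · have hκ : BilateralBD.kappa l m l0 m0 ≠ 0 := sub_ne_zero.2 hne
    refine ⟨BilateralBD.D_eq_zero_iff hκ hl0 hm0, ?_⟩
    rintro rfl
    exact BilateralBD.gam_of_eq hl hl0 hm0 hκ
  · rintro rfl
    exact h.isNullRecurrent hl hl0 hm0 hX
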